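/- Let $d\ge 2$ and let $\Omega\subset\mathbb R^d$ be open and bounded. Let $g(s)=\sum_{i=0}^N a_i s^{\alpha_i}$ for $s\ge 0$, with $N\ge 1$, real exponents $0=\alpha_0<\alpha_1<\dots<\alpha_N$ and coefficients $a_i\ge 0$ with $a_0,a_N>0$. For $\xi\ge 0$ put $K(\xi)=1/g(s(\xi))$, where $s=s(\xi)\ge 0$ is the unique solution of $s\,g(s)=\xi$. Let $$a=\frac{\alpha_N}{\alpha_N+1},\qquad \beta=2-a,\qquad \lambda=\frac{2-a}{1-a},$$ and assume the degree condition $a\le \frac{4}{d+2}$. Write $(\cdot,\cdot)$ and $\|\cdot\|$ for the inner product and norm of $L^2(\Omega)$ or $(L^2(\Omega))^d$, and $\|v\|_1=(\|v\|^2+\|\nabla v\|^2)^{1/2}$ for the norm of $H^1(\Omega)$. Let $r\ge 0$ be an integer and $\sigma>0$. A mesh $\mathcal T_h$ of $\Omega$ of size $h>0$ consists of finitely many pairwise disjoint open sets $T\subset\Omega$ (elements) that cover $\Omega$ up to a null set, each of diameter at most $h$ and star-shaped with respect to every point of some ball of radius $\sigma h$ contained in it (for example a quasi-uniform triangulation,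 possibly with curved simplices at the boundary). Let $W_h$ be the space of discontinuous piecewise polynomials of total degree at most $r$ over $\mathcal T_h$; gradients of elements of $W_h$ are taken element by element. Let $\pi$ be the $L^2$-projection onto $W_h$: $(\pi w,v)=(w,v)$ for all $v\in W_h$. Let $\phi:[0,\infty)\to H^1(\Omega)$ (the extension of the boundary data) be differentiable with derivative $\phi_t$, let $f:[0,\infty)\to L^2(\Omega)$ be such that $\tilde f=f-\phi_t:[0,\infty)\to L^2(\Omega)$ is differentiable with derivative $\tilde f_t$, and assume that $\|\phi_t\|_1^2$ and $\|\tilde f_t\|^2$ are integrable over bounded time intervals. Let $\rho^0\in L^2(\Omega)$ and $\tilde\rho^0=\rho^0-\phi(0)$. Let $\tilde\rho_h:[0,\infty)\to W_h$ be a solution of the semidiscrete problem: it is continuous on $[0,\infty)$, differentiable on $(0,\infty)$ with derivative $\tilde\rho_{h,t}$, satisfies $\tilde\rho_h(0)=\pi\tilde\rho^0$, and, with $\rho_h=\tilde\rho_h+\pi\phi$, $$(\tilde\rho_{h,t},w_h)+\big(K(|\nabla\rho_h|)\nabla\rho_h,\nabla w_h\big)=(\tilde f,w_h)\qquad\text{for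 all } w_h\in W_h,\ t>0 .$$ **Theorem 4.5.** There is a constant $C>0$, depending only on $d$, $\Omega$, the exponents and coefficients of $g$, the degree $r$ and the mesh regularity constant $\sigma$ (hence independent of $h$, of the mesh, of the data $\phi,f,\rho^0$ and of the solution), such that for every continuous nondecreasing function $\mathrm{Env}\,G$ on $[0,\infty)$ with $\mathrm{Env}\,G(t)\ge G(t):=\|\tilde f(t)\|^{\lambda}+\|\phi(t)\|_1^2$ for all $t\ge0$, and for all $t\ge 1$, $$\|\tilde\rho_{h,t}(t)\|^2\le C\left\{1+\|\tilde\rho^0\|^2+\big(\mathrm{Env}\,G(t)\big)^{2/\beta}+\int_{t-1}^{t}\left(\|\phi_t(s)\|_1^2+\|\tilde f_t(s)\|^2\right)ds\right\}.$$ -/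

import Mathlib

open MeasureTheory Set
open scoped ContDiff

namespace Forchheimer

/-! ### The generalized polynomial `g` and the nonlinearity `K` -/

/-- Data of a generalized polynomial `g(s) = a₀ s^{α₀} + ⋯ + a_N s^{α_N}` with `N ≥ 1`, real exponents
`0 = α₀ < α₁ < ⋯ < α_N` and nonnegative coefficients with `a₀ > 0`, `a_N > 0`. -/
structure GenPoly where
  N : ℕ
  one_le_N : 1 ≤ N
  α : Fin (N + 1) → ℝ
  α_zero : α 0 = 0
  α_strictMono : StrictMono α
  coeff : Fin (N + 1) → ℝ
  coeff_nonneg : ∀ i, 0 ≤ coeff i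
  coeff_zero_pos : 0 < coeff 0
  coeff_last_pos : 0 < coeff (Fin.last N)

namespace GenPoly

/-- The function `g`, meant for `s ≥ 0`. -/
noncomputable def g (P : GenPoly) (s : ℝ) : ℝ := ∑ i, P.coeff i * s ^ P.α i

/-- `deg g = α_N`. -/
def deg (P : GenPoly) : ℝ := P.α (Fin.last P.N)

/-- `a = deg g / (deg g + 1)`. -/
noncomputable def a (P : GenPoly) : ℝ := P.deg / (P.deg + 1)

/-- `β = 2 - a`. -/
noncomputable def β (P : GenPoly) : ℝ := 2 - P.a

/-- `λ = (2 - a) / (1 - a)`. -/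
noncomputable def lam (P : GenPoly) : ℝ := (2 - P.a) / (1 - P.a)

lemma α_nonneg (P : GenPoly) (i : Fin (P.N + 1)) : 0 ≤ P.α i := by
  rw [← P.α_zero]
  exact P.α_strictMono.monotone (Fin.zero_le i)

lemma coeff_zero_le_g (P : GenPoly) {s : ℝ} (hs : 0 ≤ s) : P.coeff 0 ≤ P.g s := by
  have h := Finset.single_le_sum (f := fun i => P.coeff i * s ^ P.α i)
    (fun i _ => mul_nonneg (P.coeff_nonneg i) (Real.rpow_nonneg hs _)) (Finset.mem_univ 0)
  simpa [P.α_zero, g] using h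

lemma g_monotoneOn (P : GenPoly) : MonotoneOn P.g (Ici 0) := by
  intro s hs t _ hst
  exact Finset.sum_le_sum fun i _ => mul_le_mul_of_nonneg_left
    (Real.rpow_le_rpow hs hst (P.α_nonneg i)) (P.coeff_nonneg i)

lemma g_continuous (P : GenPoly) : Continuous P.g :=
  continuous_finsetSum _ fun i _ =>
    continuous_const.mul (Real.continuous_rpow_const (P.α_nonneg i))

/-- For `ξ ≥ 0` the equation `s g(s) = ξ` has exactly one solution `s ≥ 0`. -/
theorem existsUnique_sol (P : GenPoly) {ξ : ℝ} (hξ : 0 ≤ ξ) :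
    ∃! s : ℝ, s ∈ Ici (0 : ℝ) ∧ s * P.g s = ξ := by
  have hc := P.coeff_zero_pos
  have hR : 0 ≤ ξ / P.coeff 0 := by positivity
  have hcont : ContinuousOn (fun s => s * P.g s) (Icc 0 (ξ / P.coeff 0)) :=
    (continuous_id.mul P.g_continuous).continuousOn
  have hmem : ξ ∈ Icc ((fun s => s * P.g s) 0) ((fun s => s * P.g s) (ξ / P.coeff 0)) := by
    refine ⟨by simpa using hξ, ?_⟩
    calc ξ = ξ / P.coeff 0 * P.coeff 0 := by field_simp
      _ ≤ _ := mul_le_mul_of_nonneg_left (P.coeff_zero_le_g hR) hR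
  obtain ⟨s, hs, hs'⟩ := intermediate_value_Icc hR hcont hmem
  have hlt : ∀ x y : ℝ, 0 ≤ x → x < y → x * P.g x < y * P.g y := by
    intro x y hx hxy
    have hy : 0 ≤ y := hx.trans hxy.le
    have h1 : P.g x ≤ P.g y := P.g_monotoneOn hx hy hxy.le
    have h2 : 0 < P.g y := hc.trans_le (P.coeff_zero_le_g hy)
    calc x * P.g x ≤ x * P.g y := mul_le_mul_of_nonneg_left h1 hx
      _ < y * P.g y := mul_lt_mul_of_pos_right hxy h2
  refine ⟨s, ⟨hs.1, hs'⟩, ?_⟩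
  rintro t ⟨ht, ht'⟩
  have hs'' : s * P.g s = ξ := hs'
  rcases lt_trichotomy t s with h | h | h
  · have := hlt t s ht h
    linarith
  · exact h
  · have := hlt s t hs.1 h
    linarith

/-- `s(ξ)`: for `ξ ≥ 0` the unique `s ≥ 0` with `s g(s) = ξ`. -/
noncomputable def sol (P : GenPoly) (ξ : ℝ) : ℝ := Function.invFunOn (fun s => s * P.g s) (Ici 0) ξ

lemma sol_spec (P : GenPoly) {ξ : ℝ} (hξ : 0 ≤ ξ) : 0 ≤ P.sol ξ ∧ P.sol ξ * P.g (P.sol ξ) = ξ :=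
  Function.invFunOn_pos (f := fun s => s * P.g s) (P.existsUnique_sol hξ).exists

/-- `K(ξ) = 1 / g(s(ξ))`, for `ξ ≥ 0`. -/
noncomputable def K (P : GenPoly) (ξ : ℝ) : ℝ := 1 / P.g (P.sol ξ)

end GenPoly

/-- `F` is an envelope of `f` on `I`: a continuous, increasing function with `f ≤ F` on `I`. -/
def IsEnvelope (I : Set ℝ) (f F : ℝ → ℝ) : Prop :=
  ContinuousOn F I ∧ MonotoneOn F I ∧ ∀ t ∈ I, f t ≤ F t

/-! ### The Sobolev space `H¹(Ω)` -/

/-- `ℝᵈ` with the Euclidean norm. -/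
abbrev Space (d : ℕ) := EuclideanSpace ℝ (Fin d)

/-- The scalar space `L²(Ω)`. -/
noncomputable abbrev L2 {d : ℕ} (Ω : Set (Space d)) := Lp ℝ 2 (volume.restrict Ω)

/-- The space `(L²(Ω))ᵈ`. -/
noncomputable abbrev L2Vec {d : ℕ} (Ω : Set (Space d)) := Lp (Space d) 2 (volume.restrict Ω)

/-- `ψ` is a test function on `Ω`: smooth with compact support inside `Ω`. -/
def IsTestFunction {d : ℕ} (Ω : Set (Space d)) (ψ : Space d → ℝ) : Prop :=
  ContDiff ℝ ∞ ψ ∧ HasCompactSupport ψ ∧ tsupport ψ ⊆ Ω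

/-- `G` is the weak gradient of `u` on `Ω`: `∫_Ω u ∂ᵢψ = - ∫_Ω Gᵢ ψ` for all test functions `ψ` and all `i`. -/
def IsWeakGradient {d : ℕ} {Ω : Set (Space d)} (u : L2 Ω) (G : L2Vec Ω) : Prop :=
  ∀ ψ : Space d → ℝ, IsTestFunction Ω ψ → ∀ i : Fin d,
    ∫ x in Ω, u x * fderiv ℝ ψ x (EuclideanSpace.single i 1) = - ∫ x in Ω, G x i * ψ x

lemma integrable_mul_partial {d : ℕ} {Ω : Set (Space d)} {ψ : Space d → ℝ}
    (hψ : IsTestFunction Ω ψ) (u : L2 Ω) (i : Fin d) :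
    Integrable (fun x => u x * fderiv ℝ ψ x (EuclideanSpace.single i 1)) (volume.restrict Ω) := by
  have hc : Continuous fun x => fderiv ℝ ψ x (EuclideanSpace.single i 1) :=
    (hψ.1.continuous_fderiv (by simp)).clm_apply continuous_const
  have hs : HasCompactSupport fun x => fderiv ℝ ψ x (EuclideanSpace.single i 1) :=
    hψ.2.1.fderiv_apply (𝕜 := ℝ) _
  exact MemLp.integrable_mul (p := 2) (q := 2) (Lp.memLp u) ((hc.memLp_of_hasCompactSupport hs).restrict Ω)

lemma integrable_coord_mul {d : ℕ} {Ω : Set (Space d)} {ψ : Space d → ℝ}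
    (hψ : IsTestFunction Ω ψ) (G : L2Vec Ω) (i : Fin d) :
    Integrable (fun x => G x i * ψ x) (volume.restrict Ω) := by
  have h1 : MemLp (fun x => G x i) 2 (volume.restrict Ω) :=
    (Lp.memLp G).continuousLinearMap_comp (EuclideanSpace.proj (𝕜 := ℝ) i)
  exact MemLp.integrable_mul (p := 2) (q := 2) h1 ((hψ.1.continuous.memLp_of_hasCompactSupport hψ.2.1).restrict Ω)

/-- `H¹(Ω) = W^{1,2}(Ω)`, realized as the space of pairs `(u, ∇u)` in `L²(Ω) × (L²(Ω))ᵈ`; the inherited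
norm is `‖u‖₁ = (‖u‖² + ‖∇u‖²)^{1/2}`. -/
noncomputable def H1 {d : ℕ} (Ω : Set (Space d)) : Submodule ℝ (WithLp 2 (L2 Ω × L2Vec Ω)) where
  carrier := {p | IsWeakGradient p.fst p.snd}
  zero_mem' := by
    intro ψ hψ i
    have h1 : ∀ᵐ x ∂(volume.restrict Ω), (0 : L2 Ω) x = 0 := Lp.coeFn_zero _ _ _
    have h2 : ∀ᵐ x ∂(volume.restrict Ω), (0 : L2Vec Ω) x = 0 := Lp.coeFn_zero _ _ _
    rw [integral_eq_zero_of_ae, integral_eq_zero_of_ae, neg_zero]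
    · filter_upwards [h2] with x hx
      have e : (0 : WithLp 2 (L2 Ω × L2Vec Ω)).snd x i = 0 := by
        rw [WithLp.zero_snd, hx]; rfl
      simp only [e, zero_mul, Pi.zero_apply]
    · filter_upwards [h1] with x hx
      simp only [WithLp.zero_fst, hx, zero_mul, Pi.zero_apply]
  add_mem' := by
    intro p q hp hq ψ hψ i
    have h1 := Lp.coeFn_add p.fst q.fst
    have h2 := Lp.coeFn_add p.snd q.snd
    have e1 : ∫ x in Ω, (p + q).fst x * fderiv ℝ ψ x (EuclideanSpace.single i 1)
        = ∫ x in Ω, (p.fst x * fderiv ℝ ψ x (EuclideanSpace.single i 1)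
          + q.fst x * fderiv ℝ ψ x (EuclideanSpace.single i 1)) := by
      refine integral_congr_ae ?_
      filter_upwards [h1] with x hx
      simp only [WithLp.add_fst, hx, Pi.add_apply]
      ring
    have e2 : ∫ x in Ω, (p + q).snd x i * ψ x
        = ∫ x in Ω, (p.snd x i * ψ x + q.snd x i * ψ x) := by
      refine integral_congr_ae ?_
      filter_upwards [h2] with x hx
      simp only [WithLp.add_snd, hx, Pi.add_apply, PiLp.add_apply]
      ring
    rw [e1, e2, integral_add (integrable_mul_partial hψ _ i) (integrable_mul_partial hψ _ i),
      integral_add (integrable_coord_mul hψ _ i) (integrable_coord_mul hψ _ i),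
      hp ψ hψ i, hq ψ hψ i]
    ring
  smul_mem' := by
    intro c p hp ψ hψ i
    have h1 := Lp.coeFn_smul c p.fst
    have h2 := Lp.coeFn_smul c p.snd
    have e1 : ∫ x in Ω, (c • p).fst x * fderiv ℝ ψ x (EuclideanSpace.single i 1)
        = ∫ x in Ω, c * (p.fst x * fderiv ℝ ψ x (EuclideanSpace.single i 1)) := by
      refine integral_congr_ae ?_
      filter_upwards [h1] with x hx
      simp only [WithLp.smul_fst, hx, Pi.smul_apply, smul_eq_mul]
      ring
    have e2 : ∫ x in Ω, (c • p).snd x i * ψ x = ∫ x in Ω, c * (p.snd x i * ψ x) := by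
      refine integral_congr_ae ?_
      filter_upwards [h2] with x hx
      simp only [WithLp.smul_snd, hx, Pi.smul_apply, PiLp.smul_apply, smul_eq_mul]
      ring
    rw [e1, e2, integral_const_mul, integral_const_mul, hp ψ hψ i]
    ring

/-- The function in `L²(Ω)` underlying an element of `H¹(Ω)`. -/
noncomputable def H1.fn {d : ℕ} {Ω : Set (Space d)} (u : H1 Ω) : L2 Ω := (u : WithLp 2 (L2 Ω × L2Vec Ω)).fst

/-! ### The finite element space -/

/-- A mesh of `Ω` of size `h` and quasi-uniformity constant `σ`: finitely many pairwise disjoint open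
elements that fill `Ω` up to a null set, each of diameter at most `h` and star-shaped with respect to
some ball of radius `σ h`. Quasi-uniform simplicial triangulations are of this kind (the elements being
the open simplices), and so are those with curved simplices along a smooth boundary. -/
structure Mesh {d : ℕ} (Ω : Set (Space d)) (σ h : ℝ) where
  card : ℕ
  cell : Fin card → Set (Space d)
  isOpen_cell : ∀ T, IsOpen (cell T)
  cell_subset : ∀ T, cell T ⊆ Ω
  disjoint_cell : Pairwise fun T T' => Disjoint (cell T) (cell T')
  cover : volume (Ω \ ⋃ T, cell T) = 0
  dist_le : ∀ T, ∀ x ∈ cell T, ∀ y ∈ cell T, dist x y ≤ h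
  star : ∀ T, ∃ z, Metric.ball z (σ * h) ⊆ cell T ∧
    ∀ y ∈ Metric.ball z (σ * h), StarConvex ℝ y (cell T)

/-- Value of a polynomial in `d` variables at a point of `ℝᵈ`. -/
noncomputable def polyEval {d : ℕ} (p : MvPolynomial (Fin d) ℝ) (x : Space d) : ℝ :=
  MvPolynomial.eval (fun i => x i) p

/-- Gradient of a polynomial in `d` variables at a point of `ℝᵈ`. -/
noncomputable def polyGrad {d : ℕ} (p : MvPolynomial (Fin d) ℝ) (x : Space d) : Space d :=
  WithLp.toLp 2 fun i => polyEval (MvPolynomial.pderiv i p) x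

lemma continuous_polyEval {d : ℕ} (p : MvPolynomial (Fin d) ℝ) : Continuous (polyEval p) :=
  (MvPolynomial.continuous_eval p).comp (by fun_prop)

namespace Mesh

variable {d : ℕ} {Ω : Set (Space d)} {σ h : ℝ}

/-- The space `W_h` of discontinuous piecewise polynomials of degree at most `r`: one polynomial of total
degree at most `r` for each element, independently of each other. -/
abbrev PolySpace (M : Mesh Ω σ h) (r : ℕ) :=
  Fin M.card → MvPolynomial.restrictTotalDegree (Fin d) ℝ r

/-- The values of a piecewise polynomial (and `0` off the elements). -/
noncomputable def eval (M : Mesh Ω σ h) {r : ℕ} (v : M.PolySpace r) (x : Space d) : ℝ :=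
  ∑ T, (M.cell T).indicator (polyEval (v T : MvPolynomial (Fin d) ℝ)) x

/-- The elementwise gradient of a piecewise polynomial (and `0` off the elements). -/
noncomputable def grad (M : Mesh Ω σ h) {r : ℕ} (v : M.PolySpace r) (x : Space d) : Space d :=
  ∑ T, (M.cell T).indicator (polyGrad (v T : MvPolynomial (Fin d) ℝ)) x

lemma isBounded_cell (M : Mesh Ω σ h) (T : Fin M.card) : Bornology.IsBounded (M.cell T) :=
  Metric.isBounded_iff.2 ⟨h, fun x hx y hy => M.dist_le T x hx y hy⟩

lemma memLp_eval (M : Mesh Ω σ h) {r : ℕ} (v : M.PolySpace r) :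
    MemLp (M.eval v) 2 (volume.restrict Ω) := by
  refine memLp_finsetSum _ fun T _ => ?_
  rw [memLp_indicator_iff_restrict (M.isOpen_cell T).measurableSet]
  have hfin : IsFiniteMeasure ((volume.restrict Ω).restrict (M.cell T)) :=
    ⟨by
      rw [Measure.restrict_apply_univ]
      exact (Measure.restrict_apply_le _ _).trans_lt (M.isBounded_cell T).measure_lt_top⟩
  obtain ⟨B, hB⟩ := (M.isBounded_cell T).isCompact_closure.exists_bound_of_continuousOn
    (continuous_polyEval (v T : MvPolynomial (Fin d) ℝ)).continuousOn
  refine MemLp.of_bound (continuous_polyEval _).aestronglyMeasurable B ?_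
  filter_upwards [ae_restrict_mem (M.isOpen_cell T).measurableSet] with x hx
  exact hB x (subset_closure hx)

lemma eval_add (M : Mesh Ω σ h) {r : ℕ} (v w : M.PolySpace r) :
    M.eval (v + w) = M.eval v + M.eval w := by
  funext x
  simp only [eval, Pi.add_apply, ← Finset.sum_add_distrib]
  refine Finset.sum_congr rfl fun T _ => ?_
  by_cases hx : x ∈ M.cell T <;> simp [hx, polyEval]

lemma eval_smul (M : Mesh Ω σ h) {r : ℕ} (c : ℝ) (v : M.PolySpace r) :
    M.eval (c • v) = c • M.eval v := by
  funext x
  simp only [eval, Pi.smul_apply, smul_eq_mul, Finset.mul_sum]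
  refine Finset.sum_congr rfl fun T _ => ?_
  by_cases hx : x ∈ M.cell T <;> simp [hx, polyEval]

/-- A piecewise polynomial as an element of `L²(Ω)`. -/
noncomputable def toL2 (M : Mesh Ω σ h) (r : ℕ) : M.PolySpace r →ₗ[ℝ] L2 Ω where
  toFun v := (M.memLp_eval v).toLp (M.eval v)
  map_add' v w := by
    rw [← MemLp.toLp_add]
    congr 1
    exact M.eval_add v w
  map_smul' c v := by
    rw [RingHom.id_apply, ← MemLp.toLp_const_smul]
    congr 1
    exact M.eval_smul c v

theorem exists_proj (M : Mesh Ω σ h) (r : ℕ) (w : L2 Ω) :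
    ∃ p : M.PolySpace r, ∀ v, inner ℝ (M.toL2 r p) (M.toL2 r v) = inner ℝ w (M.toL2 r v) := by
  obtain ⟨p, hp⟩ := ((M.toL2 r).range.starProjection_apply_mem w)
  refine ⟨p, fun v => ?_⟩
  rw [hp]
  have := Submodule.starProjection_inner_eq_zero (K := (M.toL2 r).range) w (M.toL2 r v) ⟨v, rfl⟩
  rw [inner_sub_left] at this
  linarith

/-- The `L²`-projection `π` onto `W_h`: the piecewise polynomial with `(π w, v) = (w, v)` for all
`v ∈ W_h`. -/
noncomputable def proj (M : Mesh Ω σ h) (r : ℕ) (w : L2 Ω) : M.PolySpace r := (M.exists_proj r w).choose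

lemma proj_spec (M : Mesh Ω σ h) (r : ℕ) (w : L2 Ω) (v : M.PolySpace r) :
    inner ℝ (M.toL2 r (M.proj r w)) (M.toL2 r v) = inner ℝ w (M.toL2 r v) :=
  (M.exists_proj r w).choose_spec v

/-- `u = ρ̃_h` with time derivative `ut = ρ̃_{h,t}` solves the semidiscrete problem with boundary data
extension `φ`, right-hand side `F = f̃` and initial value `u₀ = ρ̃⁰`: with `ρ_h = ρ̃_h + π φ`,
`(ρ̃_{h,t}, w) + (K(|∇ρ_h|) ∇ρ_h, ∇w) = (f̃, w)` for all `w ∈ W_h` and all `t > 0`, `ρ̃_h(0) = π ρ̃⁰`, and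
`ρ̃_h` is continuous up to `t = 0`. Gradients of elements of `W_h` are taken elementwise. -/
structure IsSemidiscreteSolution (M : Mesh Ω σ h) (P : GenPoly) {r : ℕ} (φ : ℝ → H1 Ω) (F : ℝ → L2 Ω)
    (u₀ : L2 Ω) (u ut : ℝ → M.PolySpace r) : Prop where
  continuousOn : ContinuousOn (fun t => M.toL2 r (u t)) (Ici 0)
  hasDerivAt : ∀ t, 0 < t → HasDerivAt (fun s => M.toL2 r (u s)) (M.toL2 r (ut t)) t
  equation : ∀ t, 0 < t → ∀ w : M.PolySpace r,
    inner ℝ (M.toL2 r (ut t)) (M.toL2 r w)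
      + ∫ x in Ω, inner ℝ (P.K ‖M.grad (u t + M.proj r (H1.fn (φ t))) x‖ • M.grad (u t + M.proj r (H1.fn (φ t))) x)
          (M.grad w x)
      = inner ℝ (F t) (M.toL2 r w)
  initial : u 0 = M.proj r u₀

end Mesh

end Forchheimer

namespace Forchheimer

open Filter Topology intervalIntegral

/-! ### Scalar and Hilbert space calculus in time -/

section Calculus

variable {E : Type*} [NormedAddCommGroup E] [InnerProductSpace ℝ E]

/-! The proof separates an abstract evolution equation in time from estimates in space that are
uniform in the mesh.

In time, the equation is (U', w) + (A(DU + Λφ), Dw) = (F, w), where A is the field p ↦ K(|p|)p on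
vector-valued L², D is the elementwise gradient and Λφ = ∇πφ. Three properties of A are enough. It
is cocoercive with constant a₀, because it inverts x ↦ g(|x|)x, which is strongly monotone. It has a
convex potential J with 0 ≤ J(p) ≤ (A p, p). It satisfies |p|^β ≤ C(1 + K(|p|)|p|²) pointwise.

The scheme has no jump terms, so functions of W_h with zero elementwise gradient, such as piecewise
constants, are not damped at all, and no Poincaré inequality can hold on W_h. The remedy is the
projection Q onto the orthogonal complement of these functions: D does not distinguish w from Qw,
and ‖Qw‖^β is controlled by the dissipation (A p, p).

Three estimates then lead to the bound. Testing with QU gives a differential inequality for ‖QU‖²,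
which bounds it by the data for all times and bounds the dissipation over a unit time interval
(`exists_norm_Q_bound`, `exists_integral_diss_bound`). Testing with U' and integrating J along the
solution bounds the integral of ‖U'‖² (`exists_integral_deriv_bound`). Subtracting the equation at
times s and s − δ and using cocoercivity bounds ‖U(t) − U(t − δ)‖² by a constant times δ², and δ → 0
gives the pointwise bound (`exists_deriv_bound`). No second time derivative of U and no derivative
of A is needed. Weights linear in time remove the initial values in the last two estimates.

In space, two constants must not depend on h. The map Λ is bounded on H¹ because the h⁻¹ lost in the
inverse inequality is regained from the Poincaré inequality on star-shaped cells
(`exists_norm_gradL2_proj_le`). The Poincaré inequality for Q follows from a Sobolev-Poincaré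
inequality on each cell, proved by scaling; the power of h left over is d + 2 − 2d/β, and the degree
condition says exactly that it is nonnegative (`exists_norm_sub_piecewiseConst_le`,
`exists_poincare_dissipation`). -/

lemma norm_sub_sq_le_integral {X X' : ℝ → E} {s t : ℝ} (hst : s < t)
    (hX : ∀ τ ∈ Icc s t, HasDerivAt X (X' τ) τ)
    (hint : IntervalIntegrable (fun τ => ‖X' τ‖ ^ 2) volume s t) :
    ‖X t - X s‖ ^ 2 ≤ (t - s) * ∫ τ in s..t, ‖X' τ‖ ^ 2 := by
  -- Pairing with the fixed vector `Z` leaves a scalar function of time. Its derivative needs only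
  -- an integrable upper bound, so `X'` itself need not be integrable. Young's inequality with
  -- weight t − s makes half of ‖Z‖² absorbable.
  set Z := X t - X s with hZ
  have hδ : 0 < t - s := sub_pos.2 hst
  have hd : ∀ τ ∈ Icc s t, HasDerivAt (fun τ => inner ℝ Z (X τ)) (inner ℝ Z (X' τ)) τ := by
    intro τ hτ
    simpa using (hasDerivAt_const τ Z).inner ℝ (hX τ hτ)
  have hint' : IntervalIntegrable
      (fun τ => ‖Z‖ ^ 2 / (2 * (t - s)) + (t - s) / 2 * ‖X' τ‖ ^ 2) volume s t :=
    intervalIntegrable_const.add (hint.const_mul _)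
  have key := sub_le_integral_of_hasDeriv_right_of_le hst.le
    (fun τ hτ => (hd τ hτ).continuousAt.continuousWithinAt)
    (fun τ hτ => (hd τ (Ioo_subset_Icc_self hτ)).hasDerivWithinAt)
    ((intervalIntegrable_iff_integrableOn_Icc_of_le hst.le).1 hint') (fun τ _ => by
      have h1 := real_inner_le_norm Z (X' τ)
      have h2 : ‖Z‖ * ‖X' τ‖ ≤ ‖Z‖ ^ 2 / (2 * (t - s)) + (t - s) / 2 * ‖X' τ‖ ^ 2 := by
        have : ‖Z‖ ^ 2 / (2 * (t - s)) + (t - s) / 2 * ‖X' τ‖ ^ 2 - ‖Z‖ * ‖X' τ‖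
            = (‖Z‖ - (t - s) * ‖X' τ‖) ^ 2 / (2 * (t - s)) := by
          field_simp
          ring
        have h3 : 0 ≤ (‖Z‖ - (t - s) * ‖X' τ‖) ^ 2 / (2 * (t - s)) := by positivity
        linarith
      exact h1.trans h2)
  rw [intervalIntegral.integral_add intervalIntegrable_const (hint.const_mul _),
    intervalIntegral.integral_const, intervalIntegral.integral_const_mul, ← inner_sub_right,
    real_inner_self_eq_norm_sq, smul_eq_mul] at key
  have e : (t - s) * (‖Z‖ ^ 2 / (2 * (t - s))) = ‖Z‖ ^ 2 / 2 := by
    field_simp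
  rw [e] at key
  linarith

/-- With `I` a primitive of ‖X'‖², the squared increment at τ is at most δ (I(τ) − I(τ − δ)). After
integration the two integrals cancel except on end strips of length δ; the left one has a favourable
sign and the right one is at most δ I(t). -/
lemma integral_norm_sub_sq_le {X X' : ℝ → E} {b t δ : ℝ} (hbt : b ≤ t) (hδ : 0 < δ)
    (hX : ∀ τ ∈ Icc (b - δ) t, HasDerivAt X (X' τ) τ)
    (hint : IntervalIntegrable (fun τ => ‖X' τ‖ ^ 2) volume (b - δ) t) :
    ∫ τ in b..t, ‖X τ - X (τ - δ)‖ ^ 2 ≤ δ ^ 2 * ∫ τ in (b - δ)..t, ‖X' τ‖ ^ 2 := by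
  set I : ℝ → ℝ := fun τ => ∫ s in (b - δ)..τ, ‖X' s‖ ^ 2 with hI
  have hsub : ∀ {x y}, x ∈ Icc (b - δ) t → y ∈ Icc (b - δ) t →
      IntervalIntegrable (fun τ => ‖X' τ‖ ^ 2) volume x y := by
    intro x y hx hy
    refine hint.mono_set ?_
    rw [uIcc_of_le (by linarith : b - δ ≤ t)]
    exact uIcc_subset_Icc hx hy
  have hIc : ContinuousOn I (Icc (b - δ) t) := by
    have := continuousOn_primitive_interval' hint left_mem_uIcc
    rwa [uIcc_of_le (by linarith : b - δ ≤ t)] at this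
  have hImono : ∀ x ∈ Icc (b - δ) t, ∀ y ∈ Icc (b - δ) t, x ≤ y → I x ≤ I y := by
    intro x hx y hy hxy
    have h1 : I y - I x = ∫ s in x..y, ‖X' s‖ ^ 2 :=
      integral_interval_sub_left (hsub ⟨le_rfl, by linarith⟩ hy) (hsub ⟨le_rfl, by linarith⟩ hx)
    have h2 : 0 ≤ ∫ s in x..y, ‖X' s‖ ^ 2 :=
      intervalIntegral.integral_nonneg hxy fun _ _ => sq_nonneg _
    linarith
  have hIint : ∀ {x y}, x ∈ Icc (b - δ) t → y ∈ Icc (b - δ) t → IntervalIntegrable I volume x y :=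
    fun hx hy => (hIc.mono (uIcc_subset_Icc hx hy)).intervalIntegrable
  have hXc : ContinuousOn X (Icc (b - δ) t) :=
    fun τ hτ => (hX τ hτ).continuousAt.continuousWithinAt
  have m1 : MapsTo (fun τ : ℝ => τ - δ) (Icc b t) (Icc (b - δ) t) :=
    fun τ hτ => ⟨by linarith [hτ.1], by linarith [hτ.2]⟩
  have m2 : Icc b t ⊆ Icc (b - δ) t := Icc_subset_Icc_left (by linarith)
  have c1 : ContinuousOn (fun τ => ‖X τ - X (τ - δ)‖ ^ 2) (uIcc b t) := by
    rw [uIcc_of_le hbt]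
    exact ((hXc.mono m2).sub (hXc.comp (by fun_prop) m1)).norm.pow 2
  have c2 : ContinuousOn (fun τ => I (τ - δ)) (uIcc b t) := by
    rw [uIcc_of_le hbt]
    exact hIc.comp (by fun_prop) m1
  have hbmem : b ∈ Icc (b - δ) t := ⟨by linarith, hbt⟩
  have htmem : t ∈ Icc (b - δ) t := ⟨by linarith, le_rfl⟩
  have hb'mem : b - δ ∈ Icc (b - δ) t := ⟨le_rfl, by linarith⟩
  have ht'mem : t - δ ∈ Icc (b - δ) t := ⟨by linarith, by linarith⟩
  have step : ∫ τ in b..t, ‖X τ - X (τ - δ)‖ ^ 2 ≤ ∫ τ in b..t, δ * (I τ - I (τ - δ)) := by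
    refine intervalIntegral.integral_mono_on hbt c1.intervalIntegrable
      (((hIint hbmem htmem).sub c2.intervalIntegrable).const_mul _) fun τ hτ => ?_
    have h1 := norm_sub_sq_le_integral (X := X) (X' := X') (s := τ - δ) (t := τ) (by linarith)
      (fun x hx => hX x ⟨by linarith [hx.1, hτ.1], by linarith [hx.2, hτ.2]⟩)
      (hsub (m1 hτ) (m2 hτ))
    have h2 : I τ - I (τ - δ) = ∫ s in (τ - δ)..τ, ‖X' s‖ ^ 2 :=
      integral_interval_sub_left (hsub hb'mem (m2 hτ)) (hsub hb'mem (m1 hτ))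
    rw [h2]
    calc _ ≤ _ := h1
      _ = _ := by ring_nf
  refine step.trans ?_
  rw [intervalIntegral.integral_const_mul, intervalIntegral.integral_sub (hIint hbmem htmem) c2.intervalIntegrable,
    intervalIntegral.integral_comp_sub_right (fun τ => I τ) δ]
  have e1 : ∫ τ in b..t, I τ = (∫ τ in (b - δ)..(t - δ), I τ) - (∫ τ in (b - δ)..b, I τ)
      + ∫ τ in (t - δ)..t, I τ := by
    have h1 := integral_add_adjacent_intervals (hIint hb'mem hbmem) (hIint hbmem htmem)
    have h2 := integral_add_adjacent_intervals (hIint hb'mem ht'mem) (hIint ht'mem htmem)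
    linarith
  have e2 : 0 ≤ ∫ τ in (b - δ)..b, I τ := by
    refine intervalIntegral.integral_nonneg (by linarith) fun τ hτ => ?_
    exact intervalIntegral.integral_nonneg hτ.1 fun _ _ => sq_nonneg _
  have e3 : ∫ τ in (t - δ)..t, I τ ≤ ∫ _ in (t - δ)..t, I t := by
    refine intervalIntegral.integral_mono_on (by linarith) (hIint ht'mem htmem)
      intervalIntegrable_const fun τ hτ => ?_
    exact hImono τ ⟨by linarith [hτ.1], hτ.2⟩ t htmem hτ.2
  rw [intervalIntegral.integral_const, smul_eq_mul] at e3
  have e5 : (∫ τ in b..t, I τ) - (∫ τ in (b - δ)..(t - δ), I τ) ≤ δ * I t := by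
    have : t - (t - δ) = δ := by ring
    rw [this] at e3
    linarith
  calc _ ≤ δ * (δ * I t) := mul_le_mul_of_nonneg_left e5 hδ.le
    _ = _ := by rw [hI]; ring

/-- A nonnegative function whose derivative is nonpositive above the level `(K / c) ^ q⁻¹` cannot
exceed this level plus its initial value. -/
lemma le_add_rpow_of_deriv_le {y y' : ℝ → ℝ} {c K q t : ℝ} (hc : 0 < c) (hK : 0 ≤ K) (hq : 0 < q)
    (ht : 0 ≤ t) (hy : ContinuousOn y (Icc 0 t)) (hy0 : ∀ s ∈ Icc 0 t, 0 ≤ y s)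
    (hd : ∀ s ∈ Ioo 0 t, HasDerivAt y (y' s) s)
    (hle : ∀ s ∈ Ioo 0 t, y' s ≤ -c * y s ^ q + K) :
    y t ≤ y 0 + (K / c) ^ (1 / q) := by
  set M := y 0 + (K / c) ^ (1 / q) with hM
  have hKc : 0 ≤ K / c := by positivity
  have hr : 0 ≤ (K / c) ^ (1 / q) := Real.rpow_nonneg hKc _
  by_contra! hcon
  -- The supremum of `T` is the last time at which `y` is at most `M`. Afterwards `y` stays above
  -- `M`, hence is nonincreasing, and cannot end above `M`.
  set T : Set ℝ := Icc 0 t ∩ y ⁻¹' Iic M with hT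
  have hTc : IsClosed T := hy.preimage_isClosed_of_isClosed isClosed_Icc isClosed_Iic
  have hTne : T.Nonempty := ⟨0, ⟨le_rfl, ht⟩, by simp only [mem_preimage, mem_Iic, hM]; linarith⟩
  have hTb : BddAbove T := ⟨t, fun x hx => hx.1.2⟩
  have hs := hTc.csSup_mem hTne hTb
  set s := sSup T
  have hanti : AntitoneOn y (Icc s t) := by
    refine antitoneOn_of_deriv_nonpos (convex_Icc _ _) (hy.mono (Icc_subset_Icc_left hs.1.1)) ?_ ?_
    · rw [interior_Icc]
      exact fun x hx => (hd x ⟨hs.1.1.trans_lt hx.1, hx.2⟩).differentiableAt.differentiableWithinAt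
    · rw [interior_Icc]
      intro x hx
      have hx0 : x ∈ Ioo 0 t := ⟨hs.1.1.trans_lt hx.1, hx.2⟩
      rw [(hd x hx0).deriv]
      refine (hle x hx0).trans ?_
      have hxM : M < y x := by
        by_contra! h
        exact absurd (le_csSup hTb ⟨⟨hx0.1.le, hx0.2.le⟩, h⟩) (not_le.2 hx.1)
      have h1 : (K / c) ^ (1 / q) ≤ y x := by
        have := hy0 0 ⟨le_rfl, ht⟩
        linarith
      have h2 : K / c ≤ y x ^ q := by
        have := Real.rpow_le_rpow hr h1 hq.le
        rwa [← Real.rpow_mul hKc, one_div_mul_cancel hq.ne', Real.rpow_one] at this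
      have := (div_le_iff₀ hc).1 h2
      linarith
  have := hanti ⟨le_rfl, hs.1.2⟩ ⟨hs.1.2, le_rfl⟩ hs.1.2
  have h3 : y s ≤ M := hs.2
  linarith

/-- Young's inequality with a small parameter. -/
lemma exists_young {p q : ℝ} (hpq : p.HolderConjugate q) {ε : ℝ} (hε : 0 < ε) :
    ∃ C : ℝ, 0 < C ∧ ∀ x y : ℝ, 0 ≤ x → 0 ≤ y → x * y ≤ ε * y ^ p + C * x ^ q := by
  have hp := hpq.pos
  have hq := hpq.symm.pos
  -- Scaling the factors by k and 1/k turns the coefficient of y^p in Young's inequality into k^p /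
  -- p = ε.
  set k : ℝ := (ε * p) ^ (1 / p) with hk
  have hεp : 0 < ε * p := mul_pos hε hp
  have hkpos : 0 < k := Real.rpow_pos_of_pos hεp _
  refine ⟨(1 / k) ^ q / q, by positivity, fun x y hx hy => ?_⟩
  have h := Real.young_inequality_of_nonneg (mul_nonneg hkpos.le hy)
    (mul_nonneg (one_div_pos.2 hkpos).le hx) hpq
  have e1 : k ^ p = ε * p := by
    rw [hk, ← Real.rpow_mul hεp.le, one_div_mul_cancel hp.ne', Real.rpow_one]
  rw [Real.mul_rpow hkpos.le hy, Real.mul_rpow (one_div_pos.2 hkpos).le hx, e1] at h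
  calc x * y = k * y * (1 / k * x) := by field_simp
    _ ≤ _ := h
    _ = _ := by field_simp

end Calculus

/-! ### An abstract degenerate parabolic equation -/

section Evolution

variable {H V X : Type*} [NormedAddCommGroup H] [InnerProductSpace ℝ H]
  [NormedAddCommGroup V] [InnerProductSpace ℝ V] [NormedAddCommGroup X] [InnerProductSpace ℝ X]

/-- A cocoercive operator `A` with potential `J`, a trial space `S` with a gradient `D`, a lifting `Λ` of
the boundary data, and a projection `Q` for which a Poincaré inequality of order `β` holds. -/
structure MonotoneSystem (H V X : Type*) [NormedAddCommGroup H] [InnerProductSpace ℝ H]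
    [NormedAddCommGroup V] [InnerProductSpace ℝ V] [NormedAddCommGroup X] [InnerProductSpace ℝ X]
    (a₀ c C₁ β : ℝ) where
  A : V → V
  J : V → ℝ
  Q : H →L[ℝ] H
  D : H →L[ℝ] V
  Λ : X →L[ℝ] V
  S : Submodule ℝ H
  A_zero : A 0 = 0
  cocoercive : ∀ p q, a₀ * ‖A p - A q‖ ^ 2 ≤ inner ℝ (A p - A q) (p - q)
  J_zero : J 0 = 0
  J_nonneg : ∀ p, 0 ≤ J p
  subgradient : ∀ p q, J q - J p ≤ inner ℝ (A q) (q - p)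
  inner_Q : ∀ x y, inner ℝ (Q x) y = inner ℝ (Q x) (Q y)
  norm_Q_le : ∀ x, ‖Q x‖ ≤ ‖x‖
  Q_mem : ∀ w ∈ S, Q w ∈ S
  D_Q : ∀ w ∈ S, D (Q w) = D w
  norm_Λ_le : ∀ x, ‖Λ x‖ ^ 2 ≤ c * ‖x‖ ^ 2
  poincare : ∀ w ∈ S, ∀ p, ‖Q w‖ ^ β ≤ C₁ * (1 + inner ℝ (A p) p + ‖p - D w‖ ^ 2)

namespace MonotoneSystem

variable {a₀ c C₁ β : ℝ} (𝓜 : MonotoneSystem H V X a₀ c C₁ β)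

/-- The gradient of the full unknown. -/
def flux (U : ℝ → H) (φ : ℝ → X) (t : ℝ) : V := 𝓜.D (U t) + 𝓜.Λ (φ t)

/-- The dissipation `(A p, p)`. -/
noncomputable def diss (U : ℝ → H) (φ : ℝ → X) (t : ℝ) : ℝ :=
  inner ℝ (𝓜.A (𝓜.flux U φ t)) (𝓜.flux U φ t)

/-- `U` solves the evolution equation `(U', w) + (A(DU + Λφ), Dw) = (F, w)` for `w ∈ S`. -/
structure IsSolution (φ φt : ℝ → X) (F Ft U Ut : ℝ → H) : Prop where
  mem : ∀ t, U t ∈ 𝓜.S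
  mem_deriv : ∀ t, Ut t ∈ 𝓜.S
  continuousOn : ContinuousOn U (Ici 0)
  hasDerivAt : ∀ t, 0 < t → HasDerivAt U (Ut t) t
  data_continuousOn : ContinuousOn φ (Ici 0)
  data_hasDerivAt : ∀ t, 0 < t → HasDerivAt φ (φt t) t
  source_continuousOn : ContinuousOn F (Ici 0)
  source_hasDerivAt : ∀ t, 0 < t → HasDerivAt F (Ft t) t
  equation : ∀ t, 0 < t → ∀ w ∈ 𝓜.S,
    inner ℝ (Ut t) w + inner ℝ (𝓜.A (𝓜.flux U φ t)) (𝓜.D w) = inner ℝ (F t) w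
  data_integrable : ∀ t, 1 ≤ t → IntervalIntegrable (fun s => ‖φt s‖ ^ 2) volume (t - 1) t
  source_integrable : ∀ t, 1 ≤ t → IntervalIntegrable (fun s => ‖Ft s‖ ^ 2) volume (t - 1) t

lemma sq_norm_A_le (p : V) : a₀ * ‖𝓜.A p‖ ^ 2 ≤ inner ℝ (𝓜.A p) p := by
  simpa [𝓜.A_zero] using 𝓜.cocoercive p 0

lemma J_le (p : V) : 𝓜.J p ≤ inner ℝ (𝓜.A p) p := by
  simpa [𝓜.J_zero] using 𝓜.subgradient 0 p

lemma norm_A_sub_le (ha : 0 < a₀) (p q : V) : ‖𝓜.A p - 𝓜.A q‖ ≤ a₀⁻¹ * ‖p - q‖ := by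
  have h1 := (𝓜.cocoercive p q).trans (real_inner_le_norm _ _)
  rcases (norm_nonneg (𝓜.A p - 𝓜.A q)).eq_or_lt with h | h
  · rw [← h]; positivity
  · have : a₀ * ‖𝓜.A p - 𝓜.A q‖ ≤ ‖p - q‖ := by nlinarith
    rw [inv_mul_eq_div, le_div_iff₀ ha]
    linarith

lemma continuous_A (ha : 0 < a₀) : Continuous 𝓜.A := by
  refine (LipschitzWith.of_dist_le_mul (K := ⟨a₀⁻¹, by positivity⟩) fun p q => ?_).continuous
  rw [dist_eq_norm, dist_eq_norm]
  exact 𝓜.norm_A_sub_le ha p q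

/-- The subgradient inequality, used from p and from p + h, traps the remainder between 0 and (A(p +
h) − A p, h), which is quadratic in h because A is Lipschitz. -/
lemma hasFDerivAt_J (ha : 0 < a₀) (p : V) : HasFDerivAt 𝓜.J (innerSL ℝ (𝓜.A p)) p := by
  rw [hasFDerivAt_iff_isLittleO_nhds_zero]
  have hO : (fun h : V => 𝓜.J (p + h) - 𝓜.J p - innerSL ℝ (𝓜.A p) h)
      =O[𝓝 0] fun h => ‖h‖ ^ 2 := by
    refine Asymptotics.IsBigO.of_bound a₀⁻¹ (Eventually.of_forall fun h => ?_)
    have h1 := 𝓜.subgradient p (p + h)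
    have h2 := 𝓜.subgradient (p + h) p
    have h3 : inner ℝ (𝓜.A (p + h) - 𝓜.A p) h ≤ a₀⁻¹ * ‖h‖ ^ 2 := by
      refine (real_inner_le_norm _ _).trans ?_
      have := 𝓜.norm_A_sub_le ha (p + h) p
      rw [add_sub_cancel_left] at this
      calc _ ≤ a₀⁻¹ * ‖h‖ * ‖h‖ := mul_le_mul_of_nonneg_right this (norm_nonneg _)
        _ = _ := by ring
    rw [add_sub_cancel_left] at h1
    have e : p - (p + h) = -h := by abel
    rw [e, inner_neg_right] at h2
    rw [inner_sub_left] at h3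
    rw [innerSL_apply_apply, Real.norm_eq_abs, norm_pow, norm_norm, abs_le]
    have h4 : 0 ≤ a₀⁻¹ * ‖h‖ ^ 2 := by positivity
    constructor <;> linarith
  refine hO.trans_isLittleO ?_
  simpa using (Asymptotics.isLittleO_norm_pow_id (E' := V) one_lt_two)

variable {𝓜} {φ φt : ℝ → X} {F Ft U Ut : ℝ → H}

namespace IsSolution

lemma continuousOn_flux (h : 𝓜.IsSolution φ φt F Ft U Ut) : ContinuousOn (𝓜.flux U φ) (Ici 0) :=
  (𝓜.D.continuous.comp_continuousOn h.continuousOn).add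
    (𝓜.Λ.continuous.comp_continuousOn h.data_continuousOn)

lemma hasDerivAt_flux (h : 𝓜.IsSolution φ φt F Ft U Ut) {t : ℝ} (ht : 0 < t) :
    HasDerivAt (𝓜.flux U φ) (𝓜.D (Ut t) + 𝓜.Λ (φt t)) t :=
  (𝓜.D.hasFDerivAt.comp_hasDerivAt t (h.hasDerivAt t ht)).add
    (𝓜.Λ.hasFDerivAt.comp_hasDerivAt t (h.data_hasDerivAt t ht))

lemma continuousOn_diss (h : 𝓜.IsSolution φ φt F Ft U Ut) (ha : 0 < a₀) : ContinuousOn (𝓜.diss U φ) (Ici 0) :=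
  ((𝓜.continuous_A ha).comp_continuousOn h.continuousOn_flux).inner h.continuousOn_flux

/-- The equation supplies the regularity: Ut s − Ut t is itself an admissible test function, and D
is bounded, so its norm is controlled by the changes of F and of A along the flux. This is what
makes ‖Ut‖² integrable away from time 0. -/
lemma continuousOn_deriv (h : 𝓜.IsSolution φ φt F Ft U Ut) (ha : 0 < a₀) : ContinuousOn Ut (Ioi 0) := by
  intro t ht
  set B : ℝ → ℝ := fun s => ‖F s - F t‖
    + ‖𝓜.D‖ * ‖𝓜.A (𝓜.flux U φ s) - 𝓜.A (𝓜.flux U φ t)‖ with hB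
  have hle : ∀ s ∈ Ioi (0 : ℝ), ‖Ut s - Ut t‖ ≤ B s := by
    intro s hs
    set w := Ut s - Ut t with hw
    have hwS : w ∈ 𝓜.S := 𝓜.S.sub_mem (h.mem_deriv s) (h.mem_deriv t)
    have e1 := h.equation s hs w hwS
    have e2 := h.equation t ht w hwS
    have e3 : ‖w‖ ^ 2 = inner ℝ (F s - F t) w
        - inner ℝ (𝓜.A (𝓜.flux U φ s) - 𝓜.A (𝓜.flux U φ t)) (𝓜.D w) := by
      rw [← real_inner_self_eq_norm_sq]
      nth_rewrite 1 [hw]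
      rw [inner_sub_left, inner_sub_left, inner_sub_left]
      linarith
    have e4 := real_inner_le_norm (F s - F t) w
    have e5 := neg_le_of_abs_le
      (abs_real_inner_le_norm (𝓜.A (𝓜.flux U φ s) - 𝓜.A (𝓜.flux U φ t)) (𝓜.D w))
    have e6 := mul_le_mul_of_nonneg_left (𝓜.D.le_opNorm w)
      (norm_nonneg (𝓜.A (𝓜.flux U φ s) - 𝓜.A (𝓜.flux U φ t)))
    have e7 : ‖w‖ * ‖w‖ ≤ B s * ‖w‖ := by
      simp only [hB]
      nlinarith
    rcases (norm_nonneg w).eq_or_lt with h0 | h0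
    · rw [← h0]; positivity
    · exact le_of_mul_le_mul_right e7 h0
  have hF : ContinuousWithinAt F (Ioi 0) t := (h.source_continuousOn.mono Ioi_subset_Ici_self) t ht
  have hA : ContinuousWithinAt (fun s => 𝓜.A (𝓜.flux U φ s)) (Ioi 0) t :=
    (((𝓜.continuous_A ha).comp_continuousOn h.continuousOn_flux).mono Ioi_subset_Ici_self) t ht
  have hBt : Tendsto B (𝓝[Ioi 0] t) (𝓝 0) := by
    have := ((hF.sub (continuousWithinAt_const (b := F t))).norm).add
      (((hA.sub (continuousWithinAt_const (b := 𝓜.A (𝓜.flux U φ t)))).norm).const_mul ‖𝓜.D‖)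
    have h0 : Tendsto B (𝓝[Ioi 0] t) (𝓝 (‖F t - F t‖
        + ‖𝓜.D‖ * ‖𝓜.A (𝓜.flux U φ t) - 𝓜.A (𝓜.flux U φ t)‖)) := this.tendsto
    simpa only [sub_self, norm_zero, mul_zero, add_zero] using h0
  refine tendsto_iff_norm_sub_tendsto_zero.2 ?_
  refine squeeze_zero' (Eventually.of_forall fun _ => norm_nonneg _) ?_ hBt
  filter_upwards [self_mem_nhdsWithin] with s hs using hle s hs

/-- The test function is QU, and the left side is the derivative of ‖QU‖². Of the two copies of the
dissipation, one absorbs the boundary term by means of a₀‖A p‖² ≤ (A p, p). -/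
lemma inner_deriv_le (h : 𝓜.IsSolution φ φt F Ft U Ut) (ha : 0 < a₀) {t : ℝ} (ht : 0 < t) :
    2 * inner ℝ (𝓜.Q (U t)) (Ut t) ≤
      2 * (‖F t‖ * ‖𝓜.Q (U t)‖) - 𝓜.diss U φ t + c / a₀ * ‖φ t‖ ^ 2 := by
  have e1 := h.equation t ht _ (𝓜.Q_mem _ (h.mem t))
  rw [𝓜.D_Q _ (h.mem t)] at e1
  have e2 := real_inner_le_norm (F t) (𝓜.Q (U t))
  have e3 : 𝓜.D (U t) = 𝓜.flux U φ t - 𝓜.Λ (φ t) := by simp [flux]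
  rw [e3, inner_sub_right] at e1
  have e4 : inner ℝ (𝓜.A (𝓜.flux U φ t)) (𝓜.flux U φ t) = 𝓜.diss U φ t := rfl
  have e5 := real_inner_le_norm (𝓜.A (𝓜.flux U φ t)) (𝓜.Λ (φ t))
  have e6 := 𝓜.sq_norm_A_le (𝓜.flux U φ t)
  have e7 := 𝓜.norm_Λ_le (φ t)
  set α := ‖𝓜.A (𝓜.flux U φ t)‖
  set l := ‖𝓜.Λ (φ t)‖
  have e8 : 2 * (α * l) ≤ a₀ * α ^ 2 + l ^ 2 / a₀ := by
    have : a₀ * α ^ 2 + l ^ 2 / a₀ - 2 * (α * l) = (a₀ * α - l) ^ 2 / a₀ := by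
      field_simp
      ring
    have h0 : 0 ≤ (a₀ * α - l) ^ 2 / a₀ := by positivity
    linarith
  have e9 : l ^ 2 / a₀ ≤ c / a₀ * ‖φ t‖ ^ 2 := by
    rw [div_mul_eq_mul_div]
    exact div_le_div_of_nonneg_right e7 ha.le
  rw [real_inner_comm]
  rw [e4] at e1 e6
  linarith

end IsSolution

/-- The same estimate is needed in two forms: one keeps the dissipation, to be integrated in time,
and the other trades it through the Poincaré inequality for ‖QU‖^β, which closes the differential
inequality. -/
lemma exists_energy_inequality (ha : 0 < a₀) (hc : 0 ≤ c) (hC₁ : 0 < C₁) {lam : ℝ}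
    (hβ : β.HolderConjugate lam) :
    ∃ C : ℝ, 0 < C ∧ ∀ (𝓜 : MonotoneSystem H V X a₀ c C₁ β) (φ φt : ℝ → X) (F Ft U Ut : ℝ → H),
      𝓜.IsSolution φ φt F Ft U Ut → ∀ t, 0 < t →
        2 * inner ℝ (𝓜.Q (U t)) (Ut t) ≤
            -(1 / 2) * 𝓜.diss U φ t + C * (1 + (‖F t‖ ^ lam + ‖φ t‖ ^ 2)) ∧
        2 * inner ℝ (𝓜.Q (U t)) (Ut t) ≤
            -(1 / (4 * C₁)) * ‖𝓜.Q (U t)‖ ^ β + C * (1 + (‖F t‖ ^ lam + ‖φ t‖ ^ 2)) := by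
  -- After the factor 2, the Young term is ‖QU‖^β / (4 C₁), a quarter of what the Poincaré
  -- inequality takes from the dissipation; enough is left for either form.
  obtain ⟨K, hK, hY⟩ := exists_young hβ (ε := 1 / (8 * C₁)) (by positivity)
  refine ⟨1 + 2 * K + c / a₀ + c, by positivity, fun 𝓜 φ φt F Ft U Ut h t ht => ?_⟩
  have e1 := h.inner_deriv_le ha ht
  have e2 := hY _ _ (norm_nonneg (F t)) (norm_nonneg (𝓜.Q (U t)))
  have e3 := 𝓜.poincare _ (h.mem t) (𝓜.flux U φ t)
  have e4 : 𝓜.flux U φ t - 𝓜.D (U t) = 𝓜.Λ (φ t) := by simp [flux]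
  have e5 := 𝓜.norm_Λ_le (φ t)
  have e6 : inner ℝ (𝓜.A (𝓜.flux U φ t)) (𝓜.flux U φ t) = 𝓜.diss U φ t := rfl
  rw [e4, e6] at e3
  set q := ‖𝓜.Q (U t)‖ ^ β
  set E := 𝓜.diss U φ t
  set x := ‖φ t‖ ^ 2
  set f := ‖F t‖ ^ lam
  have hf : 0 ≤ f := Real.rpow_nonneg (norm_nonneg _) _
  have hx : 0 ≤ x := sq_nonneg _
  have hE : 0 ≤ E := (by positivity : 0 ≤ a₀ * ‖𝓜.A (𝓜.flux U φ t)‖ ^ 2).trans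
    (𝓜.sq_norm_A_le (𝓜.flux U φ t))
  have e7 : q / C₁ ≤ 1 + E + c * x := by
    rw [div_le_iff₀ hC₁]
    nlinarith
  have e8 : 1 / (8 * C₁) * q = q / C₁ / 8 := by field_simp
  have e9 : 1 / (4 * C₁) * q = q / C₁ / 4 := by field_simp
  have h1 : 0 ≤ c / a₀ * x := by positivity
  have h2 : 0 ≤ c * x := by positivity
  have h3 : 0 ≤ c / a₀ := by positivity
  have h4 : 0 ≤ K * x := by positivity
  have h5 : 0 ≤ c / a₀ * f := by positivity
  have h6 : 0 ≤ c * f := by positivity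
  have h7 : 0 ≤ K * f := by positivity
  rw [e8] at e2
  constructor
  · nlinarith
  · rw [neg_mul, e9]
    nlinarith

end MonotoneSystem

end Evolution

/-! ### A priori bounds for the abstract equation -/

lemma one_add_rpow_le {e q : ℝ} (he : 0 ≤ e) (hq : 0 ≤ q) :
    (1 + e) ^ q ≤ 2 ^ q * (1 + e ^ q) := by
  have h0 : 0 ≤ e ^ q := Real.rpow_nonneg he q
  have h2 : (0 : ℝ) ≤ 2 ^ q := Real.rpow_nonneg (by norm_num) q
  rcases le_total e 1 with h | h
  · calc (1 + e) ^ q ≤ 2 ^ q := Real.rpow_le_rpow (by positivity) (by linarith) hq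
      _ ≤ _ := by nlinarith
  · calc (1 + e) ^ q ≤ (2 * e) ^ q := Real.rpow_le_rpow (by positivity) (by linarith) hq
      _ = 2 ^ q * e ^ q := Real.mul_rpow (by norm_num) he
      _ ≤ _ := by nlinarith

lemma le_one_add_rpow {e q : ℝ} (he : 0 ≤ e) (hq : 1 ≤ q) : e ≤ 1 + e ^ q := by
  have h0 : 0 ≤ e ^ q := Real.rpow_nonneg he q
  rcases le_total e 1 with h | h
  · linarith
  · have := Real.self_le_rpow_of_one_le h hq
    linarith

lemma intervalIntegrable_norm_sub_sq {E : Type*} [NormedAddCommGroup E] {Y : ℝ → E} {b t δ : ℝ}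
    (hbt : b ≤ t) (hb : 0 ≤ b) (hbδ : 0 ≤ b - δ) (hY : ContinuousOn Y (Ici 0)) :
    IntervalIntegrable (fun s => ‖Y s - Y (s - δ)‖ ^ 2) volume b t := by
  refine ContinuousOn.intervalIntegrable ?_
  rw [uIcc_of_le hbt]
  exact ((hY.mono fun s hs => mem_Ici.2 (hb.trans hs.1)).sub
    (hY.comp (by fun_prop) fun s hs => mem_Ici.2 (by linarith [hs.1]))).norm.pow 2

namespace MonotoneSystem

variable {H V X : Type*} [NormedAddCommGroup H] [InnerProductSpace ℝ H]
  [NormedAddCommGroup V] [InnerProductSpace ℝ V] [NormedAddCommGroup X] [InnerProductSpace ℝ X]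
  {a₀ c C₁ β : ℝ}

lemma diss_nonneg (ha : 0 < a₀) (𝓜 : MonotoneSystem H V X a₀ c C₁ β) (U : ℝ → H) (φ : ℝ → X)
    (t : ℝ) : 0 ≤ 𝓜.diss U φ t :=
  (by positivity : 0 ≤ a₀ * ‖𝓜.A (𝓜.flux U φ t)‖ ^ 2).trans (𝓜.sq_norm_A_le (𝓜.flux U φ t))

/-- The damping is of order y^(β/2) for y = ‖QU‖², so y cannot exceed its initial value plus the
equilibrium level, a constant times (1 + Env t)^(2/β). Since Env is nondecreasing, its value at the
final time serves on all of [0, t]. -/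
lemma exists_norm_Q_bound (ha : 0 < a₀) (hc : 0 ≤ c) (hC₁ : 0 < C₁) {lam : ℝ}
    (hβ : β.HolderConjugate lam) :
    ∃ C : ℝ, 0 < C ∧ ∀ (𝓜 : MonotoneSystem H V X a₀ c C₁ β) (φ φt : ℝ → X) (F Ft U Ut : ℝ → H)
      (Env : ℝ → ℝ), 𝓜.IsSolution φ φt F Ft U Ut →
      IsEnvelope (Ici 0) (fun t => ‖F t‖ ^ lam + ‖φ t‖ ^ 2) Env → ∀ t, 0 ≤ t →
        ‖𝓜.Q (U t)‖ ^ 2 ≤ ‖U 0‖ ^ 2 + C * (1 + Env t ^ (2 / β)) := by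
  obtain ⟨K, hK, hE⟩ := exists_energy_inequality (H := H) (V := V) (X := X) ha hc hC₁ hβ
  have hβ0 := hβ.pos
  refine ⟨(K / (1 / (4 * C₁))) ^ (2 / β) * 2 ^ (2 / β), by positivity,
    fun 𝓜 φ φt F Ft U Ut Env h henv t ht => ?_⟩
  have hG : ∀ s, 0 ≤ s → 0 ≤ ‖F s‖ ^ lam + ‖φ s‖ ^ 2 := fun s _ => by positivity
  have hEnv0 : 0 ≤ Env t := (hG t ht).trans (henv.2.2 t ht)
  have hQd : ∀ s, 0 < s →
      HasDerivAt (fun s => ‖𝓜.Q (U s)‖ ^ 2) (2 * inner ℝ (𝓜.Q (U s)) (Ut s)) s := by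
    intro s hs
    have := (𝓜.Q.hasFDerivAt.comp_hasDerivAt s (h.hasDerivAt s hs)).norm_sq
    rw [𝓜.inner_Q]
    exact this
  have hle := le_add_rpow_of_deriv_le (y := fun s => ‖𝓜.Q (U s)‖ ^ 2)
    (y' := fun s => 2 * inner ℝ (𝓜.Q (U s)) (Ut s)) (c := 1 / (4 * C₁)) (K := K * (1 + Env t))
    (q := β / 2) (by positivity) (by positivity) (by positivity) ht
    (((𝓜.Q.continuous.comp_continuousOn h.continuousOn).mono Icc_subset_Ici_self).norm.pow 2)
    (fun _ _ => sq_nonneg _) (fun s hs => hQd s hs.1) (fun s hs => by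
      refine (hE 𝓜 φ φt F Ft U Ut h s hs.1).2.trans ?_
      have e1 : (‖𝓜.Q (U s)‖ ^ 2) ^ (β / 2) = ‖𝓜.Q (U s)‖ ^ β := by
        rw [← Real.rpow_natCast, ← Real.rpow_mul (norm_nonneg _)]
        congr 1
        push_cast
        ring
      simp only [e1]
      have e2 := (henv.2.2 s hs.1.le).trans (henv.2.1 (mem_Ici.2 hs.1.le) (mem_Ici.2 ht) hs.2.le)
      have e3 : K * (1 + (‖F s‖ ^ lam + ‖φ s‖ ^ 2)) ≤ K * (1 + Env t) :=
        mul_le_mul_of_nonneg_left (by linarith) hK.le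
      linarith)
  have e4 : 1 / (β / 2) = 2 / β := by field_simp
  rw [e4, mul_div_right_comm, Real.mul_rpow (by positivity) (by positivity)] at hle
  have e5 := mul_le_mul_of_nonneg_left (one_add_rpow_le hEnv0 (q := 2 / β) (by positivity))
    (Real.rpow_nonneg (by positivity : 0 ≤ K / (1 / (4 * C₁))) (2 / β))
  have e6 : ‖𝓜.Q (U 0)‖ ^ 2 ≤ ‖U 0‖ ^ 2 :=
    pow_le_pow_left₀ (norm_nonneg _) (𝓜.norm_Q_le _) 2
  linarith

/-- The first energy inequality is integrated from t − 1, where ‖QU‖² is already bounded; this is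
why the bound does not grow with the elapsed time. -/
lemma exists_integral_diss_bound (ha : 0 < a₀) (hc : 0 ≤ c) (hC₁ : 0 < C₁) {lam : ℝ}
    (hβ : β.HolderConjugate lam) (hβ2 : β ≤ 2) :
    ∃ C : ℝ, 0 < C ∧ ∀ (𝓜 : MonotoneSystem H V X a₀ c C₁ β) (φ φt : ℝ → X) (F Ft U Ut : ℝ → H)
      (Env : ℝ → ℝ), 𝓜.IsSolution φ φt F Ft U Ut →
      IsEnvelope (Ici 0) (fun t => ‖F t‖ ^ lam + ‖φ t‖ ^ 2) Env → ∀ t, 1 ≤ t →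
        ∫ s in (t - 1)..t, 𝓜.diss U φ s ≤ C * (1 + ‖U 0‖ ^ 2 + Env t ^ (2 / β)) := by
  obtain ⟨K, hK, hE⟩ := exists_energy_inequality (H := H) (V := V) (X := X) ha hc hC₁ hβ
  obtain ⟨L, hL, hQ⟩ := exists_norm_Q_bound (H := H) (V := V) (X := X) ha hc hC₁ hβ
  have hβ0 := hβ.pos
  refine ⟨2 * (1 + L + 2 * K), by positivity, fun 𝓜 φ φt F Ft U Ut Env h henv t ht => ?_⟩
  have ht0 : (0 : ℝ) ≤ t := by linarith
  have hEnv0 : 0 ≤ Env t :=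
    (by positivity : 0 ≤ ‖F t‖ ^ lam + ‖φ t‖ ^ 2).trans (henv.2.2 t ht0)
  have hEnv1 : 0 ≤ Env (t - 1) :=
    (by positivity : 0 ≤ ‖F (t - 1)‖ ^ lam + ‖φ (t - 1)‖ ^ 2).trans
      (henv.2.2 (t - 1) (mem_Ici.2 (by linarith)))
  have hmono : Env (t - 1) ^ (2 / β) ≤ Env t ^ (2 / β) :=
    Real.rpow_le_rpow hEnv1 (henv.2.1 (mem_Ici.2 (by linarith)) (mem_Ici.2 ht0) (by linarith))
      (by positivity)
  have hsub : Icc (t - 1) t ⊆ Ici 0 := fun s hs => mem_Ici.2 (by linarith [hs.1])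
  have hdi : IntervalIntegrable (𝓜.diss U φ) volume (t - 1) t :=
    ContinuousOn.intervalIntegrable (by
      rw [uIcc_of_le (by linarith)]
      exact (h.continuousOn_diss ha).mono hsub)
  have hQd : ∀ s, 0 < s →
      HasDerivAt (fun s => ‖𝓜.Q (U s)‖ ^ 2) (2 * inner ℝ (𝓜.Q (U s)) (Ut s)) s := by
    intro s hs
    have := (𝓜.Q.hasFDerivAt.comp_hasDerivAt s (h.hasDerivAt s hs)).norm_sq
    rw [𝓜.inner_Q]
    exact this
  have hint : IntervalIntegrable (fun s => -(1 / 2) * 𝓜.diss U φ s + K * (1 + Env t))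
      volume (t - 1) t := (hdi.const_mul _).add intervalIntegrable_const
  have key := sub_le_integral_of_hasDeriv_right_of_le (g := fun s => ‖𝓜.Q (U s)‖ ^ 2)
    (g' := fun s => 2 * inner ℝ (𝓜.Q (U s)) (Ut s))
    (φ := fun s => -(1 / 2) * 𝓜.diss U φ s + K * (1 + Env t)) (by linarith : t - 1 ≤ t)
    (((𝓜.Q.continuous.comp_continuousOn h.continuousOn).mono hsub).norm.pow 2)
    (fun s hs => (hQd s (by linarith [hs.1])).hasDerivWithinAt)
    ((intervalIntegrable_iff_integrableOn_Icc_of_le (by linarith)).1 hint) (fun s hs => by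
      have hs0 : 0 < s := by linarith [hs.1]
      refine (hE 𝓜 φ φt F Ft U Ut h s hs0).1.trans ?_
      have e2 := (henv.2.2 s hs0.le).trans (henv.2.1 (mem_Ici.2 hs0.le) (mem_Ici.2 ht0) hs.2.le)
      have e3 : K * (1 + (‖F s‖ ^ lam + ‖φ s‖ ^ 2)) ≤ K * (1 + Env t) :=
        mul_le_mul_of_nonneg_left (by linarith) hK.le
      linarith)
  rw [intervalIntegral.integral_add (hdi.const_mul _) intervalIntegrable_const,
    intervalIntegral.integral_const_mul, intervalIntegral.integral_const, smul_eq_mul] at key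
  have e1 := hQ 𝓜 φ φt F Ft U Ut Env h henv (t - 1) (by linarith)
  have e2 : 0 ≤ ‖𝓜.Q (U t)‖ ^ 2 := sq_nonneg _
  -- β ≤ 2 makes the exponent at least 1, so the linear term in Env is absorbed.
  have e3 : Env t ≤ 1 + Env t ^ (2 / β) :=
    le_one_add_rpow hEnv0 (by rw [le_div_iff₀ hβ0]; linarith)
  have e4 : (t - (t - 1)) * (K * (1 + Env t)) = K * (1 + Env t) := by ring
  rw [e4] at key
  have e5 : 0 ≤ Env t ^ (2 / β) := Real.rpow_nonneg hEnv0 _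
  have e6 : 0 ≤ ‖U 0‖ ^ 2 := sq_nonneg _
  have e7 : K * Env t ≤ K * (1 + Env t ^ (2 / β)) := mul_le_mul_of_nonneg_left e3 hK.le
  have e8 : L * Env (t - 1) ^ (2 / β) ≤ L * Env t ^ (2 / β) :=
    mul_le_mul_of_nonneg_left hmono hL.le
  have e9 : 0 ≤ L * ‖U 0‖ ^ 2 := by positivity
  have e10 : 0 ≤ K * ‖U 0‖ ^ 2 := by positivity
  have e11 : 0 ≤ K * Env t ^ (2 / β) := by positivity
  nlinarith

/-- Tested with U', the nonlinear term is the time derivative of J along the flux, up to a boundary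
term. The weight s − a vanishes at a, so no bound on J at an initial time is required; the
derivative of the weight contributes J, which the dissipation dominates. -/
lemma exists_integral_deriv_bound (ha : 0 < a₀) (hc : 0 ≤ c) (hC₁ : 0 < C₁) {lam : ℝ}
    (hβ : β.HolderConjugate lam) (hβ2 : β ≤ 2) (hlam : 2 ≤ lam) :
    ∃ C : ℝ, 0 < C ∧ ∀ (𝓜 : MonotoneSystem H V X a₀ c C₁ β) (φ φt : ℝ → X) (F Ft U Ut : ℝ → H)
      (Env : ℝ → ℝ), 𝓜.IsSolution φ φt F Ft U Ut →
      IsEnvelope (Ici 0) (fun t => ‖F t‖ ^ lam + ‖φ t‖ ^ 2) Env → ∀ t, 1 ≤ t →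
        ∫ s in (t - 1 / 2)..t, ‖Ut s‖ ^ 2 ≤
          C * (1 + ‖U 0‖ ^ 2 + Env t ^ (2 / β) + ∫ s in (t - 1)..t, ‖φt s‖ ^ 2) := by
  obtain ⟨K, hK, hE⟩ := exists_integral_diss_bound (H := H) (V := V) (X := X) ha hc hC₁ hβ hβ2
  have hβ0 := hβ.pos
  refine ⟨8 * ((1 + 1 / (2 * a₀)) * K + 1 + c / 2), by positivity,
    fun 𝓜 φ φt F Ft U Ut Env h henv t ht => ?_⟩
  have ht0 : (0 : ℝ) ≤ t := by linarith
  have hEnv0 : 0 ≤ Env t :=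
    (by positivity : 0 ≤ ‖F t‖ ^ lam + ‖φ t‖ ^ 2).trans (henv.2.2 t ht0)
  -- The interval starts strictly after t − 1, which may be 0, where no differentiability is
  -- available. The weight is still at least 1/4 on [t − 1/2, t].
  set a := t - 3 / 4 with hadef
  have hat : a ≤ t := by linarith
  have hsub : Icc a t ⊆ Ioi 0 := fun s hs => mem_Ioi.2 (by linarith [hs.1])
  have hdi1 : IntervalIntegrable (𝓜.diss U φ) volume (t - 1) t :=
    ContinuousOn.intervalIntegrable (by
      rw [uIcc_of_le (by linarith)]
      exact (h.continuousOn_diss ha).mono fun s hs => mem_Ici.2 (by linarith [hs.1]))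
  have hmem : uIcc a t ⊆ uIcc (t - 1) t := by
    rw [uIcc_of_le hat, uIcc_of_le (by linarith)]
    exact Icc_subset_Icc_left (by linarith)
  have hdi : IntervalIntegrable (𝓜.diss U φ) volume a t := hdi1.mono_set hmem
  have hφi : IntervalIntegrable (fun s => ‖φt s‖ ^ 2) volume a t :=
    (h.data_integrable t ht).mono_set hmem
  have hUc : ContinuousOn (fun s => (s - a) * ‖Ut s‖ ^ 2) (Icc a t) :=
    ((continuous_id.sub continuous_const).continuousOn).mul
      (((h.continuousOn_deriv ha).mono hsub).norm.pow 2)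
  have hUi : IntervalIntegrable (fun s => (s - a) * ‖Ut s‖ ^ 2) volume a t :=
    ContinuousOn.intervalIntegrable (by rwa [uIcc_of_le hat])
  set ψ : ℝ → ℝ := fun s => ((1 + 1 / (2 * a₀)) * 𝓜.diss U φ s + (1 + Env t) / 2
    + c / 2 * ‖φt s‖ ^ 2) - 1 / 2 * ((s - a) * ‖Ut s‖ ^ 2) with hψ
  have hint : IntervalIntegrable ψ volume a t :=
    (((hdi.const_mul _).add intervalIntegrable_const).add (hφi.const_mul _)).sub (hUi.const_mul _)
  have hJd : ∀ s, 0 < s → HasDerivAt (fun s => (s - a) * 𝓜.J (𝓜.flux U φ s))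
      (1 * 𝓜.J (𝓜.flux U φ s) + (s - a) *
        inner ℝ (𝓜.A (𝓜.flux U φ s)) (𝓜.D (Ut s) + 𝓜.Λ (φt s))) s := by
    intro s hs
    refine HasDerivAt.mul ((hasDerivAt_id s).sub_const a) ?_
    exact (𝓜.hasFDerivAt_J ha _).comp_hasDerivAt s (h.hasDerivAt_flux hs)
  have key := sub_le_integral_of_hasDeriv_right_of_le
    (g := fun s => (s - a) * 𝓜.J (𝓜.flux U φ s)) (φ := ψ) hat
    (fun s hs => (hJd s (hsub hs)).continuousAt.continuousWithinAt)
    (fun s hs => (hJd s (hsub (Ioo_subset_Icc_self hs))).hasDerivWithinAt)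
    ((intervalIntegrable_iff_integrableOn_Icc_of_le hat).1 hint) (fun s hs => by
      have hs0 : 0 < s := hsub (Ioo_subset_Icc_self hs)
      have hθ0 : 0 ≤ s - a := by linarith [hs.1]
      have hθ1 : s - a ≤ 1 := by linarith [hs.2]
      have e1 := h.equation s hs0 _ (h.mem_deriv s)
      rw [real_inner_self_eq_norm_sq] at e1
      have e2 := real_inner_le_norm (F s) (Ut s)
      have e3 := real_inner_le_norm (𝓜.A (𝓜.flux U φ s)) (𝓜.Λ (φt s))
      have e4 := 𝓜.sq_norm_A_le (𝓜.flux U φ s)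
      have e5 := 𝓜.norm_Λ_le (φt s)
      have e6 := 𝓜.J_le (𝓜.flux U φ s)
      have e7 : inner ℝ (𝓜.A (𝓜.flux U φ s)) (𝓜.flux U φ s) = 𝓜.diss U φ s := rfl
      -- λ ≥ 2 lets ‖F‖^λ, hence the envelope, control ‖F‖².
      have e8 : ‖F s‖ ^ 2 ≤ 1 + Env t := by
        have h1 := (henv.2.2 s hs0.le).trans
          (henv.2.1 (mem_Ici.2 hs0.le) (mem_Ici.2 ht0) hs.2.le)
        have h2 := le_one_add_rpow (sq_nonneg ‖F s‖) (q := lam / 2) (by linarith)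
        rw [← Real.rpow_natCast, ← Real.rpow_mul (norm_nonneg _)] at h2
        have h3 : ((2 : ℕ) : ℝ) * (lam / 2) = lam := by push_cast; ring
        rw [h3, Real.rpow_natCast] at h2
        have h4 : 0 ≤ ‖φ s‖ ^ 2 := sq_nonneg _
        simp only at h1
        linarith
      rw [e7] at e4 e6
      have e9 : ‖𝓜.A (𝓜.flux U φ s)‖ ^ 2 ≤ 𝓜.diss U φ s / a₀ := by
        rw [le_div_iff₀ ha]; linarith
      have e10 : inner ℝ (𝓜.A (𝓜.flux U φ s)) (𝓜.D (Ut s) + 𝓜.Λ (φt s)) ≤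
          (1 + Env t) / 2 + 𝓜.diss U φ s / a₀ / 2 + c / 2 * ‖φt s‖ ^ 2 - 1 / 2 * ‖Ut s‖ ^ 2 := by
        rw [inner_add_right]
        nlinarith [sq_nonneg (‖F s‖ - ‖Ut s‖),
          sq_nonneg (‖𝓜.A (𝓜.flux U φ s)‖ - ‖𝓜.Λ (φt s)‖)]
      have e11 : 0 ≤ (1 + Env t) / 2 + 𝓜.diss U φ s / a₀ / 2 + c / 2 * ‖φt s‖ ^ 2 := by
        have := 𝓜.diss_nonneg ha U φ s
        positivity
      have e12 := mul_le_mul_of_nonneg_left e10 hθ0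
      have e13 := mul_le_mul_of_nonneg_right hθ1 e11
      have e14 : 1 / (2 * a₀) * 𝓜.diss U φ s = 𝓜.diss U φ s / a₀ / 2 := by field_simp
      simp only [hψ]
      rw [add_mul, e14]
      linarith)
  simp only [sub_self, zero_mul, sub_zero] at key
  have e0 : 0 ≤ (t - a) * 𝓜.J (𝓜.flux U φ t) := mul_nonneg (by linarith) (𝓜.J_nonneg _)
  rw [hψ, intervalIntegral.integral_sub
      (((hdi.const_mul _).add intervalIntegrable_const).add (hφi.const_mul _)) (hUi.const_mul _),
    intervalIntegral.integral_add ((hdi.const_mul _).add intervalIntegrable_const)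
      (hφi.const_mul _),
    intervalIntegral.integral_add (hdi.const_mul _) intervalIntegrable_const,
    intervalIntegral.integral_const_mul, intervalIntegral.integral_const_mul,
    intervalIntegral.integral_const_mul, intervalIntegral.integral_const, smul_eq_mul] at key
  have m1 : ∫ s in a..t, 𝓜.diss U φ s ≤ ∫ s in (t - 1)..t, 𝓜.diss U φ s :=
    intervalIntegral.integral_mono_interval (by linarith) hat le_rfl
      (Eventually.of_forall fun s => 𝓜.diss_nonneg ha U φ s) hdi1
  have m2 : ∫ s in a..t, ‖φt s‖ ^ 2 ≤ ∫ s in (t - 1)..t, ‖φt s‖ ^ 2 :=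
    intervalIntegral.integral_mono_interval (by linarith) hat le_rfl
      (Eventually.of_forall fun s => sq_nonneg _) (h.data_integrable t ht)
  have m3 : ∫ s in (t - 1 / 2)..t, 1 / 4 * ‖Ut s‖ ^ 2 ≤ ∫ s in a..t, (s - a) * ‖Ut s‖ ^ 2 := by
    have hsub2 : uIcc (t - 1 / 2) t ⊆ uIcc a t := by
      rw [uIcc_of_le hat, uIcc_of_le (by linarith)]
      exact Icc_subset_Icc_left (by linarith)
    have n1 : ∫ s in (t - 1 / 2)..t, 1 / 4 * ‖Ut s‖ ^ 2
        ≤ ∫ s in (t - 1 / 2)..t, (s - a) * ‖Ut s‖ ^ 2 := by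
      refine intervalIntegral.integral_mono_on (by linarith) ?_ (hUi.mono_set hsub2)
        fun s hs => mul_le_mul_of_nonneg_right (by linarith [hs.1]) (sq_nonneg _)
      refine ContinuousOn.intervalIntegrable ?_
      refine continuousOn_const.mul (((h.continuousOn_deriv ha).mono ?_).norm.pow 2)
      rw [uIcc_of_le (by linarith)]
      exact (Icc_subset_Icc_left (by linarith)).trans hsub
    have n2 : (∫ s in a..(t - 1 / 2), (s - a) * ‖Ut s‖ ^ 2)
        + ∫ s in (t - 1 / 2)..t, (s - a) * ‖Ut s‖ ^ 2 = ∫ s in a..t, (s - a) * ‖Ut s‖ ^ 2 := by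
      refine integral_add_adjacent_intervals (hUi.mono_set ?_) (hUi.mono_set hsub2)
      rw [uIcc_of_le hat, uIcc_of_le (by linarith)]
      exact Icc_subset_Icc_right (by linarith)
    have n3 : 0 ≤ ∫ s in a..(t - 1 / 2), (s - a) * ‖Ut s‖ ^ 2 :=
      intervalIntegral.integral_nonneg (by linarith)
        fun s hs => mul_nonneg (by linarith [hs.1]) (sq_nonneg _)
    linarith
  rw [intervalIntegral.integral_const_mul] at m3
  have e1 := hE 𝓜 φ φt F Ft U Ut Env h henv t ht
  have e3 : Env t ≤ 1 + Env t ^ (2 / β) :=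
    le_one_add_rpow hEnv0 (by rw [le_div_iff₀ hβ0]; linarith)
  have e4 : (t - a) * ((1 + Env t) / 2) ≤ 1 + Env t ^ (2 / β) := by
    have : 0 ≤ Env t ^ (2 / β) := Real.rpow_nonneg hEnv0 _
    rw [hadef]
    linarith
  set I := ∫ s in (t - 1)..t, ‖φt s‖ ^ 2
  have hI : 0 ≤ I := intervalIntegral.integral_nonneg (by linarith) fun s _ => sq_nonneg _
  set R := 1 + ‖U 0‖ ^ 2 + Env t ^ (2 / β) with hR
  have e5 : 1 + Env t ^ (2 / β) ≤ R := by
    have : 0 ≤ ‖U 0‖ ^ 2 := sq_nonneg _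
    rw [hR]; linarith
  have hR0 : 0 ≤ R := by
    have : 0 ≤ Env t ^ (2 / β) := Real.rpow_nonneg hEnv0 _
    linarith
  have hk : 0 ≤ 1 + 1 / (2 * a₀) := by positivity
  have e6 := mul_le_mul_of_nonneg_left (m1.trans e1) hk
  have e7 := mul_le_mul_of_nonneg_left m2 (by positivity : 0 ≤ c / 2)
  have e8 : 0 ≤ (1 + 1 / (2 * a₀)) * K * I := by positivity
  have e9 : 0 ≤ c / 2 * R := by positivity
  nlinarith

/-- The increment z = U(s) − U(s − δ) is tested in the difference of the equations at s and s − δ.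
Cocoercivity absorbs the increment of A paired with that of Λφ, so only increments of U, F and φ
remain, each of order δ in the mean square. -/
lemma exists_deriv_bound (ha : 0 < a₀) (hc : 0 ≤ c) (hC₁ : 0 < C₁) {lam : ℝ}
    (hβ : β.HolderConjugate lam) (hβ2 : β ≤ 2) (hlam : 2 ≤ lam) :
    ∃ C : ℝ, 0 < C ∧ ∀ (𝓜 : MonotoneSystem H V X a₀ c C₁ β) (φ φt : ℝ → X) (F Ft U Ut : ℝ → H)
      (Env : ℝ → ℝ), 𝓜.IsSolution φ φt F Ft U Ut →
      IsEnvelope (Ici 0) (fun t => ‖F t‖ ^ lam + ‖φ t‖ ^ 2) Env → ∀ t, 1 ≤ t →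
        ‖Ut t‖ ^ 2 ≤ C * (1 + ‖U 0‖ ^ 2 + Env t ^ (2 / β)
          + ∫ s in (t - 1)..t, (‖φt s‖ ^ 2 + ‖Ft s‖ ^ 2)) := by
  obtain ⟨K, hK, hE⟩ := exists_integral_deriv_bound (H := H) (V := V) (X := X) ha hc hC₁ hβ hβ2 hlam
  refine ⟨4 * (2 * K + 1 + c / (2 * a₀)), by positivity,
    fun 𝓜 φ φt F Ft U Ut Env h henv t ht => ?_⟩
  -- For δ < 1/4 all times involved stay above t − 1/2, where the integral of ‖Ut‖² is bounded. The
  -- weight s − b equals 1/4 at t, whence the factor 4 in front of `B`.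
  set b := t - 1 / 4 with hb
  set B := 2 * (∫ s in (t - 1 / 2)..t, ‖Ut s‖ ^ 2) + (∫ s in (t - 1)..t, ‖Ft s‖ ^ 2)
    + c / (2 * a₀) * ∫ s in (t - 1)..t, ‖φt s‖ ^ 2 with hB
  have hφi := h.data_integrable t ht
  have hFi := h.source_integrable t ht
  have hsub1 : ∀ {x}, x ∈ Icc (t - 1) t → uIcc x t ⊆ uIcc (t - 1) t := by
    intro x hx
    rw [uIcc_of_le hx.2, uIcc_of_le (by linarith)]
    exact Icc_subset_Icc_left hx.1
  have hUi : ∀ {x}, 0 < x → x ≤ t → IntervalIntegrable (fun s => ‖Ut s‖ ^ 2) volume x t := by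
    intro x hx0 hx
    refine ContinuousOn.intervalIntegrable (((h.continuousOn_deriv ha).mono ?_).norm.pow 2)
    rw [uIcc_of_le hx]
    exact fun s hs => mem_Ioi.2 (hx0.trans_le hs.1)
  have main : ∀ δ, 0 < δ → δ < 1 / 4 → ‖U t - U (t - δ)‖ ^ 2 ≤ 4 * B * δ ^ 2 := by
    intro δ hδ hδ4
    have hbt : b ≤ t := by linarith
    have hpos : ∀ s ∈ Icc (b - δ) t, 0 < s := fun s hs => by linarith [hs.1]
    have hpos' : ∀ s ∈ Icc b t, 0 < s ∧ 0 < s - δ := fun s hs =>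
      ⟨by linarith [hs.1], by linarith [hs.1]⟩
    have hb0 : 0 ≤ b := by linarith
    have hbδ : 0 ≤ b - δ := by linarith
    have hdz : ∀ s ∈ Icc b t, HasDerivAt (fun s => U s - U (s - δ)) (Ut s - Ut (s - δ)) s := by
      intro s hs
      exact (h.hasDerivAt s (hpos' s hs).1).sub
        ((h.hasDerivAt (s - δ) (hpos' s hs).2).comp_sub_const s δ)
    have hdy : ∀ s ∈ Icc b t, HasDerivAt (fun s => (s - b) * ‖U s - U (s - δ)‖ ^ 2)
        (1 * ‖U s - U (s - δ)‖ ^ 2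
          + (s - b) * (2 * inner ℝ (U s - U (s - δ)) (Ut s - Ut (s - δ)))) s := by
      intro s hs
      exact ((hasDerivAt_id s).sub_const b).mul (hdz s hs).norm_sq
    have hiU := intervalIntegrable_norm_sub_sq hbt (δ := δ) hb0 hbδ h.continuousOn
    have hiF := intervalIntegrable_norm_sub_sq hbt (δ := δ) hb0 hbδ h.source_continuousOn
    have hiφ := intervalIntegrable_norm_sub_sq hbt (δ := δ) hb0 hbδ h.data_continuousOn
    -- Of the two copies of ‖z‖², one comes from the derivative of the weight and the other from
    -- Young's inequality for the source increment paired with z.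
    have hint := ((hiU.const_mul 2).add hiF).add (hiφ.const_mul (c / (2 * a₀)))
    have key := sub_le_integral_of_hasDeriv_right_of_le hbt
      (fun s hs => (hdy s hs).continuousAt.continuousWithinAt)
      (fun s hs => (hdy s (Ioo_subset_Icc_self hs)).hasDerivWithinAt)
      ((intervalIntegrable_iff_integrableOn_Icc_of_le hbt).1 hint) (fun s hs => by
        have hs' := hpos' s (Ioo_subset_Icc_self hs)
        have hθ0 : 0 ≤ s - b := by linarith [hs.1]
        have hθ1 : s - b ≤ 1 := by linarith [hs.2]
        set z := U s - U (s - δ) with hz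
        have hzS : z ∈ 𝓜.S := 𝓜.S.sub_mem (h.mem _) (h.mem _)
        have e1 := h.equation s hs'.1 z hzS
        have e2 := h.equation (s - δ) hs'.2 z hzS
        set p := 𝓜.flux U φ s with hp
        set p' := 𝓜.flux U φ (s - δ) with hp'
        have e3 : 𝓜.D z = (p - p') - 𝓜.Λ (φ s - φ (s - δ)) := by
          simp only [hz, hp, hp', flux, map_sub]
          abel
        have e4 := 𝓜.cocoercive p p'
        have e5 := real_inner_le_norm (F s - F (s - δ)) z
        have e6 := real_inner_le_norm (𝓜.A p - 𝓜.A p') (𝓜.Λ (φ s - φ (s - δ)))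
        have e7 := 𝓜.norm_Λ_le (φ s - φ (s - δ))
        have e8 : inner ℝ z (Ut s - Ut (s - δ)) = inner ℝ (F s - F (s - δ)) z
            - (inner ℝ (𝓜.A p - 𝓜.A p') (p - p')
              - inner ℝ (𝓜.A p - 𝓜.A p') (𝓜.Λ (φ s - φ (s - δ)))) := by
          rw [← inner_sub_right, ← e3, real_inner_comm, inner_sub_left, inner_sub_left,
            inner_sub_left]
          linarith
        set α := ‖𝓜.A p - 𝓜.A p'‖
        set l := ‖𝓜.Λ (φ s - φ (s - δ))‖
        have e9 : 2 * (α * l) ≤ 2 * (a₀ * α ^ 2) + l ^ 2 / (2 * a₀) := by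
          have : 2 * (a₀ * α ^ 2) + l ^ 2 / (2 * a₀) - 2 * (α * l)
              = (2 * a₀ * α - l) ^ 2 / (2 * a₀) := by
            field_simp
            ring
          have h0 : 0 ≤ (2 * a₀ * α - l) ^ 2 / (2 * a₀) := by positivity
          linarith
        have e10 : l ^ 2 / (2 * a₀) ≤ c / (2 * a₀) * ‖φ s - φ (s - δ)‖ ^ 2 := by
          rw [div_mul_eq_mul_div]
          exact div_le_div_of_nonneg_right e7 (by positivity)
        have e11 : 2 * inner ℝ z (Ut s - Ut (s - δ)) ≤ ‖z‖ ^ 2 + ‖F s - F (s - δ)‖ ^ 2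
            + c / (2 * a₀) * ‖φ s - φ (s - δ)‖ ^ 2 := by
          rw [e8]
          nlinarith [sq_nonneg (‖F s - F (s - δ)‖ - ‖z‖)]
        have e12 : 0 ≤ ‖z‖ ^ 2 + ‖F s - F (s - δ)‖ ^ 2
            + c / (2 * a₀) * ‖φ s - φ (s - δ)‖ ^ 2 := by positivity
        have e13 := mul_le_mul_of_nonneg_left e11 hθ0
        have e14 := mul_le_mul_of_nonneg_right hθ1 e12
        linarith)
    rw [intervalIntegral.integral_add ((hiU.const_mul 2).add hiF) (hiφ.const_mul _),
      intervalIntegral.integral_add (hiU.const_mul 2) hiF, intervalIntegral.integral_const_mul,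
      intervalIntegral.integral_const_mul] at key
    have k1 := integral_norm_sub_sq_le hbt hδ (fun s hs => h.hasDerivAt s (hpos s hs))
      (hUi (by linarith) (by linarith))
    have k2 := integral_norm_sub_sq_le hbt hδ (fun s hs => h.source_hasDerivAt s (hpos s hs))
      (hFi.mono_set (hsub1 ⟨by linarith, by linarith⟩))
    have k3 := integral_norm_sub_sq_le hbt hδ (fun s hs => h.data_hasDerivAt s (hpos s hs))
      (hφi.mono_set (hsub1 ⟨by linarith, by linarith⟩))
    have m1 : ∫ s in (b - δ)..t, ‖Ut s‖ ^ 2 ≤ ∫ s in (t - 1 / 2)..t, ‖Ut s‖ ^ 2 :=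
      intervalIntegral.integral_mono_interval (by linarith) (by linarith) le_rfl
        (Eventually.of_forall fun s => sq_nonneg _) (hUi (by linarith) (by linarith))
    have m2 : ∫ s in (b - δ)..t, ‖Ft s‖ ^ 2 ≤ ∫ s in (t - 1)..t, ‖Ft s‖ ^ 2 :=
      intervalIntegral.integral_mono_interval (by linarith) (by linarith) le_rfl
        (Eventually.of_forall fun s => sq_nonneg _) hFi
    have m3 : ∫ s in (b - δ)..t, ‖φt s‖ ^ 2 ≤ ∫ s in (t - 1)..t, ‖φt s‖ ^ 2 :=
      intervalIntegral.integral_mono_interval (by linarith) (by linarith) le_rfl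
        (Eventually.of_forall fun s => sq_nonneg _) hφi
    have hδ2 : 0 ≤ δ ^ 2 := sq_nonneg _
    have k1' := k1.trans (mul_le_mul_of_nonneg_left m1 hδ2)
    have k2' := k2.trans (mul_le_mul_of_nonneg_left m2 hδ2)
    have k3' := mul_le_mul_of_nonneg_left (k3.trans (mul_le_mul_of_nonneg_left m3 hδ2))
      (by positivity : 0 ≤ c / (2 * a₀))
    have e : t - b = 1 / 4 := by rw [hb]; ring
    simp only [sub_self, zero_mul, sub_zero, e] at key
    rw [hB]
    linarith
  have ht0 : 0 < t := by linarith
  -- Only backward increments are estimated, and left slopes suffice because U is differentiable at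
  -- t.
  have hlim : Tendsto (fun s => ‖slope U t s‖ ^ 2) (𝓝[<] t) (𝓝 (‖Ut t‖ ^ 2)) := by
    have h1 := hasDerivAt_iff_tendsto_slope.1 (h.hasDerivAt t ht0)
    exact ((h1.mono_left (nhdsWithin_mono _ fun s (hs : s < t) => hs.ne)).norm).pow 2
  have hfin : ‖Ut t‖ ^ 2 ≤ 4 * B := by
    refine le_of_tendsto hlim ?_
    filter_upwards [Ioo_mem_nhdsLT (by linarith : t - 1 / 4 < t)] with s hs
    have h1 := main (t - s) (by linarith [hs.2]) (by linarith [hs.1])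
    rw [sub_sub_cancel] at h1
    rw [slope_def_module, norm_smul, mul_pow, norm_inv, inv_pow, ← norm_neg (U s - U t), neg_sub,
      Real.norm_eq_abs, sq_abs, inv_mul_le_iff₀ (by
        have : s - t ≠ 0 := by linarith [hs.2]
        positivity)]
    calc _ ≤ _ := h1
      _ = _ := by ring
  have e1 := hE 𝓜 φ φt F Ft U Ut Env h henv t ht
  rw [intervalIntegral.integral_add hφi hFi]
  set I := ∫ s in (t - 1)..t, ‖φt s‖ ^ 2
  set I' := ∫ s in (t - 1)..t, ‖Ft s‖ ^ 2
  have hI : 0 ≤ I := intervalIntegral.integral_nonneg (by linarith) fun s _ => sq_nonneg _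
  have hI' : 0 ≤ I' := intervalIntegral.integral_nonneg (by linarith) fun s _ => sq_nonneg _
  have hEnv0 : 0 ≤ Env t :=
    (by positivity : 0 ≤ ‖F t‖ ^ lam + ‖φ t‖ ^ 2).trans (henv.2.2 t ht0.le)
  set R := 1 + ‖U 0‖ ^ 2 + Env t ^ (2 / β) with hR
  have hR0 : 0 ≤ R := by
    have : 0 ≤ Env t ^ (2 / β) := Real.rpow_nonneg hEnv0 _
    positivity
  have hk : 0 ≤ c / (2 * a₀) := by positivity
  have n1 : 0 ≤ c / (2 * a₀) * R := by positivity
  have n2 : 0 ≤ c / (2 * a₀) * I' := by positivity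
  have n3 : 0 ≤ K * I' := by positivity
  rw [hB] at hfin
  nlinarith

end MonotoneSystem

end Forchheimer

namespace Forchheimer

/-! ### The nonlinearity: growth, cocoercivity and potential of p ↦ K(|p|)p -/

namespace GenPoly

variable (P : GenPoly)

lemma mul_g_strictMonoOn : StrictMonoOn (fun s => s * P.g s) (Ici 0) := by
  intro x hx y hy hxy
  have h1 : P.g x ≤ P.g y := P.g_monotoneOn hx hy hxy.le
  have h2 : 0 < P.g y := P.coeff_zero_pos.trans_le (P.coeff_zero_le_g hy)
  calc x * P.g x ≤ x * P.g y := mul_le_mul_of_nonneg_left h1 hx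
    _ < y * P.g y := mul_lt_mul_of_pos_right hxy h2

lemma sol_monotoneOn : MonotoneOn P.sol (Ici 0) := by
  intro x hx y hy hxy
  obtain ⟨hx1, hx2⟩ := P.sol_spec hx
  obtain ⟨hy1, hy2⟩ := P.sol_spec hy
  refine (P.mul_g_strictMonoOn.le_iff_le hx1 hy1).1 ?_
  simpa only [hx2, hy2] using hxy

lemma K_mul_self {ξ : ℝ} (hξ : 0 ≤ ξ) : P.K ξ * ξ = P.sol ξ := by
  obtain ⟨h1, h2⟩ := P.sol_spec hξ
  have h3 : 0 < P.g (P.sol ξ) := P.coeff_zero_pos.trans_le (P.coeff_zero_le_g h1)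
  rw [K]
  nth_rewrite 2 [← h2]
  field_simp

lemma K_nonneg {ξ : ℝ} (hξ : 0 ≤ ξ) : 0 ≤ P.K ξ :=
  one_div_nonneg.2 (P.coeff_zero_pos.le.trans (P.coeff_zero_le_g (P.sol_spec hξ).1))

lemma deg_pos : 0 < P.deg := by
  rw [deg, ← P.α_zero]
  refine P.α_strictMono ?_
  have := P.one_le_N
  rw [Fin.lt_def]
  simpa using Nat.lt_of_succ_le this

lemma a_pos : 0 < P.a := div_pos P.deg_pos (by linarith [P.deg_pos])

lemma a_lt_one : P.a < 1 := (div_lt_one (by linarith [P.deg_pos])).2 (by linarith)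

lemma one_lt_β : 1 < P.β := by linarith [P.a_lt_one, show P.β = 2 - P.a from rfl]

lemma β_lt_two : P.β < 2 := by linarith [P.a_pos, show P.β = 2 - P.a from rfl]

lemma holderConjugate : P.β.HolderConjugate P.lam := by
  rw [Real.holderConjugate_iff]
  have h1 := P.a_lt_one
  refine ⟨P.one_lt_β, ?_⟩
  have h2 : 2 - P.a ≠ 0 := by linarith
  have h3 : 1 - P.a ≠ 0 := by linarith
  rw [β, lam]
  field_simp
  ring

lemma two_le_lam : 2 ≤ P.lam := by
  have h1 := P.a_lt_one
  have h2 := P.a_pos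
  rw [lam, le_div_iff₀ (by linarith)]
  linarith

/-- The growth of `K`: `ξ ^ β ≤ C (1 + K(ξ) ξ²)`. -/
lemma exists_rpow_le : ∃ C : ℝ, 0 < C ∧ ∀ ξ, 0 ≤ ξ → ξ ^ P.β ≤ C * (1 + P.sol ξ * ξ) := by
  set B := ∑ i, P.coeff i with hB
  have hβ := P.one_lt_β
  have hB0 : 0 < B :=
    P.coeff_zero_pos.trans_le (Finset.single_le_sum (fun i _ => P.coeff_nonneg i) (Finset.mem_univ 0))
  refine ⟨B ^ P.β + B ^ (P.β - 1), by positivity, fun ξ hξ => ?_⟩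
  obtain ⟨h1, h2⟩ := P.sol_spec hξ
  set s := P.sol ξ with hs
  have hsξ : 0 ≤ s * ξ := mul_nonneg h1 hξ
  have hp1 : 0 ≤ B ^ P.β := by positivity
  have hp2 : 0 ≤ B ^ (P.β - 1) := by positivity
  -- For s ≤ 1, ξ is bounded by `B`. For s ≥ 1 the top power dominates, ξ ≤ B s^(α_N + 1), and (α_N
  -- + 1)(β − 1) = 1 turns this into ξ^(β − 1) ≤ B^(β − 1) s.
  rcases le_total s 1 with h | h
  · have h3 : P.g s ≤ B := by
      refine Finset.sum_le_sum fun i _ => ?_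
      exact mul_le_of_le_one_right (P.coeff_nonneg i) (Real.rpow_le_one h1 h (P.α_nonneg i))
    have h4 : ξ ≤ B := by
      rw [← h2]
      have := mul_le_mul h h3 (P.coeff_zero_pos.le.trans (P.coeff_zero_le_g h1)) zero_le_one
      linarith
    have := Real.rpow_le_rpow hξ h4 (by linarith : 0 ≤ P.β)
    nlinarith
  · have hs0 : 0 < s := by linarith
    have h3 : P.g s ≤ B * s ^ P.deg := by
      rw [hB, Finset.sum_mul]
      refine Finset.sum_le_sum fun i _ => mul_le_mul_of_nonneg_left ?_ (P.coeff_nonneg i)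
      exact Real.rpow_le_rpow_of_exponent_le h (P.α_strictMono.monotone (Fin.le_last i))
    have h4 : ξ ≤ B * s ^ (P.deg + 1) := by
      rw [← h2, Real.rpow_add_one hs0.ne']
      nlinarith
    have h5 : ξ ^ (P.β - 1) ≤ B ^ (P.β - 1) * s := by
      have := Real.rpow_le_rpow hξ h4 (by linarith : 0 ≤ P.β - 1)
      rw [Real.mul_rpow hB0.le (by positivity), ← Real.rpow_mul hs0.le] at this
      have e : (P.deg + 1) * (P.β - 1) = 1 := by
        have := P.deg_pos
        rw [β, a]
        field_simp
        ring
      rwa [e, Real.rpow_one] at this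
    have hξ0 : 0 < ξ := by
      rw [← h2]
      exact mul_pos hs0 (P.coeff_zero_pos.trans_le (P.coeff_zero_le_g h1))
    have h6 : ξ ^ P.β = ξ ^ (P.β - 1) * ξ := by
      rw [← Real.rpow_add_one hξ0.ne', sub_add_cancel]
    rw [h6]
    have := mul_le_mul_of_nonneg_right h5 hξ
    nlinarith

variable {E : Type*} [NormedAddCommGroup E]

/-- The potential of the vector field `p ↦ K(|p|) p`. -/
noncomputable def potential (p : E) : ℝ := ∫ s in (0 : ℝ)..‖p‖, P.sol s

lemma sol_intervalIntegrable {x y : ℝ} (hx : 0 ≤ x) (hy : 0 ≤ y) :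
    IntervalIntegrable P.sol volume x y :=
  (P.sol_monotoneOn.mono fun _ hs => (le_min hx hy).trans hs.1).intervalIntegrable

lemma potential_zero : P.potential (0 : E) = 0 := by simp [potential]

lemma potential_nonneg (p : E) : 0 ≤ P.potential p :=
  intervalIntegral.integral_nonneg (norm_nonneg p) fun _ hs => (P.sol_spec hs.1).1

variable [InnerProductSpace ℝ E]

/-- The vector field `p ↦ K(|p|) p`. -/
noncomputable def field (p : E) : E := P.K ‖p‖ • p

lemma norm_field (p : E) : ‖P.field p‖ = P.sol ‖p‖ := by
  rw [field, norm_smul, Real.norm_of_nonneg (P.K_nonneg (norm_nonneg p)),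
    P.K_mul_self (norm_nonneg p)]

/-- Since the field has length s(|p|), the factor g undoes K. The field thus has the explicit
inverse x ↦ g(|x|)x, and its cocoercivity is the strong monotonicity of that inverse. -/
lemma g_smul_field (p : E) : P.g ‖P.field p‖ • P.field p = p := by
  have h3 : P.g (P.sol ‖p‖) ≠ 0 :=
    (P.coeff_zero_pos.trans_le (P.coeff_zero_le_g (P.sol_spec (norm_nonneg p)).1)).ne'
  rw [norm_field, field, K, smul_smul, mul_one_div_cancel h3, one_smul]

lemma field_zero : P.field (0 : E) = 0 := by simp [field]

lemma inner_field_self (p : E) : inner ℝ (P.field p) p = P.sol ‖p‖ * ‖p‖ := by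
  rw [field, real_inner_smul_left, real_inner_self_eq_norm_sq, ← P.K_mul_self (norm_nonneg p)]
  ring

/-- Write S for g(|x|) + g(|y|) − 2a₀. The right side minus the left side is S (|x||y| − x·y) + S
(|x| − |y|)²/2 + (g(|x|) − g(|y|))(|x|² − |y|²)/2, and each summand is nonnegative because g is
nondecreasing and at least a₀. -/
lemma inner_g_smul_sub (x y : E) :
    P.coeff 0 * ‖x - y‖ ^ 2 ≤ inner ℝ (x - y) (P.g ‖x‖ • x - P.g ‖y‖ • y) := by
  have hx := P.coeff_zero_le_g (norm_nonneg x)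
  have hy := P.coeff_zero_le_g (norm_nonneg y)
  have hxy := real_inner_le_norm x y
  have e : inner ℝ (x - y) (P.g ‖x‖ • x - P.g ‖y‖ • y)
      = P.g ‖x‖ * ‖x‖ ^ 2 + P.g ‖y‖ * ‖y‖ ^ 2 - (P.g ‖x‖ + P.g ‖y‖) * inner ℝ x y := by
    simp only [inner_sub_left, inner_sub_right, real_inner_smul_right, real_inner_self_eq_norm_sq,
      real_inner_comm x y]
    ring
  rw [e, norm_sub_sq_real]
  have h1 : 0 ≤ (‖x‖ - ‖y‖) * (P.g ‖x‖ - P.g ‖y‖) := by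
    rcases le_total ‖x‖ ‖y‖ with h | h
    · exact mul_nonneg_of_nonpos_of_nonpos (by linarith)
        (by linarith [P.g_monotoneOn (norm_nonneg x) (norm_nonneg y) h])
    · exact mul_nonneg (by linarith)
        (by linarith [P.g_monotoneOn (norm_nonneg y) (norm_nonneg x) h])
  have h2 : 0 ≤ (P.g ‖x‖ + P.g ‖y‖ - 2 * P.coeff 0) * (‖x‖ * ‖y‖ - inner ℝ x y) :=
    mul_nonneg (by linarith) (by linarith)
  have h3 : 0 ≤ (P.g ‖x‖ + P.g ‖y‖ - 2 * P.coeff 0) * (‖x‖ - ‖y‖) ^ 2 :=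
    mul_nonneg (by linarith) (sq_nonneg _)
  have h4 : 0 ≤ (‖x‖ - ‖y‖) * (P.g ‖x‖ - P.g ‖y‖) * (‖x‖ + ‖y‖) := mul_nonneg h1 (by positivity)
  nlinarith

lemma field_cocoercive (p q : E) :
    P.coeff 0 * ‖P.field p - P.field q‖ ^ 2 ≤ inner ℝ (P.field p - P.field q) (p - q) := by
  have := P.inner_g_smul_sub (P.field p) (P.field q)
  rwa [g_smul_field, g_smul_field] at this

lemma field_lipschitz : LipschitzWith ⟨(P.coeff 0)⁻¹, inv_nonneg.2 P.coeff_zero_pos.le⟩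
    (P.field : E → E) := by
  refine LipschitzWith.of_dist_le_mul fun p q => ?_
  rw [dist_eq_norm, dist_eq_norm]
  have h1 := (P.field_cocoercive p q).trans (real_inner_le_norm _ _)
  have ha := P.coeff_zero_pos
  change _ ≤ (P.coeff 0)⁻¹ * _
  rcases (norm_nonneg (P.field p - P.field q)).eq_or_lt with h | h
  · rw [← h]; positivity
  · have : P.coeff 0 * ‖P.field p - P.field q‖ ≤ ‖p - q‖ := by nlinarith
    rw [inv_mul_eq_div, le_div_iff₀ ha]
    linarith

/-- In the radial direction this is the monotonicity of s(ξ), which bounds the integral between |p|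
and |q| by s(|q|)(|q| − |p|). The angle between p and q is handled by Cauchy-Schwarz, as the field
at q has length s(|q|). -/
lemma potential_sub_le (p q : E) :
    P.potential q - P.potential p ≤ inner ℝ (P.field q) (q - p) := by
  have hp := norm_nonneg p
  have hq := norm_nonneg q
  have e1 : P.potential q - P.potential p = ∫ s in ‖p‖..‖q‖, P.sol s :=
    intervalIntegral.integral_interval_sub_left (P.sol_intervalIntegrable le_rfl hq)
      (P.sol_intervalIntegrable le_rfl hp)
  have e2 : ∫ s in ‖p‖..‖q‖, P.sol s ≤ P.sol ‖q‖ * (‖q‖ - ‖p‖) := by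
    rcases le_total ‖p‖ ‖q‖ with h | h
    · have := intervalIntegral.integral_mono_on h (P.sol_intervalIntegrable hp hq)
        (intervalIntegrable_const (c := P.sol ‖q‖))
        fun s hs => P.sol_monotoneOn (mem_Ici.2 (hp.trans hs.1)) (mem_Ici.2 hq) hs.2
      rw [intervalIntegral.integral_const, smul_eq_mul] at this
      linarith
    · have := intervalIntegral.integral_mono_on h (intervalIntegrable_const (c := P.sol ‖q‖))
        (P.sol_intervalIntegrable hq hp)
        fun s hs => P.sol_monotoneOn (mem_Ici.2 hq) (mem_Ici.2 (hq.trans hs.1)) hs.1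
      rw [intervalIntegral.integral_const, smul_eq_mul] at this
      rw [intervalIntegral.integral_symm]
      linarith
  have e3 : inner ℝ (P.field q) p ≤ P.sol ‖q‖ * ‖p‖ := by
    have := real_inner_le_norm (P.field q) p
    rwa [norm_field] at this
  rw [e1, inner_sub_right, inner_field_self]
  linarith

lemma potential_le (p : E) : P.potential p ≤ P.sol ‖p‖ * ‖p‖ := by
  have := P.potential_sub_le 0 p
  rwa [potential_zero, sub_zero, sub_zero, inner_field_self] at this

lemma continuous_field : Continuous (P.field : E → E) := P.field_lipschitz.continuous

lemma continuous_potential : Continuous (P.potential : E → ℝ) := by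
  rw [continuous_iff_continuousAt]
  intro p
  have h : Filter.Tendsto (fun q => ‖P.field q‖ * ‖q - p‖ + ‖P.field p‖ * ‖q - p‖)
      (nhds p) (nhds 0) := by
    have c : Continuous fun q => ‖P.field q‖ * ‖q - p‖ + ‖P.field p‖ * ‖q - p‖ :=
      (P.continuous_field.norm.mul (continuous_id.sub continuous_const).norm).add
        (continuous_const.mul (continuous_id.sub continuous_const).norm)
    simpa using c.tendsto p
  refine tendsto_iff_norm_sub_tendsto_zero.2 (squeeze_zero (fun _ => norm_nonneg _) (fun q => ?_) h)
  have h1 := (P.potential_sub_le p q).trans (real_inner_le_norm _ _)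
  have h2 := (P.potential_sub_le q p).trans (real_inner_le_norm _ _)
  rw [norm_sub_rev p q] at h2
  have h3 : 0 ≤ ‖P.field q‖ * ‖q - p‖ := by positivity
  have h4 : 0 ≤ ‖P.field p‖ * ‖q - p‖ := by positivity
  rw [Real.norm_eq_abs, abs_le]
  constructor <;> linarith

end GenPoly

end Forchheimer

namespace Forchheimer

open Metric

variable {d : ℕ}

/-! ### Polynomials -/

lemma polyEval_add (p q : MvPolynomial (Fin d) ℝ) (x : Space d) :
    polyEval (p + q) x = polyEval p x + polyEval q x := by simp [polyEval]

lemma polyEval_smul (c : ℝ) (p : MvPolynomial (Fin d) ℝ) (x : Space d) :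
    polyEval (c • p) x = c * polyEval p x := by simp [polyEval]

lemma polyGrad_add (p q : MvPolynomial (Fin d) ℝ) (x : Space d) :
    polyGrad (p + q) x = polyGrad p x + polyGrad q x := by
  ext i
  simp [polyGrad, polyEval]

lemma polyGrad_smul (c : ℝ) (p : MvPolynomial (Fin d) ℝ) (x : Space d) :
    polyGrad (c • p) x = c • polyGrad p x := by
  ext i
  simp [polyGrad, polyEval]

lemma continuous_polyGrad (p : MvPolynomial (Fin d) ℝ) : Continuous (polyGrad p) :=
  (PiLp.continuous_toLp 2 _).comp (continuous_pi fun _ => continuous_polyEval _)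

lemma hasFDerivAt_polyEval (p : MvPolynomial (Fin d) ℝ) (x : Space d) :
    HasFDerivAt (polyEval p) (innerSL ℝ (polyGrad p x)) x := by
  induction p using MvPolynomial.induction_on with
  | C a =>
    have e1 : polyEval (MvPolynomial.C a : MvPolynomial (Fin d) ℝ) = fun _ => a := by
      funext y; simp [polyEval]
    have e2 : polyGrad (MvPolynomial.C a : MvPolynomial (Fin d) ℝ) x = 0 := by
      ext i; simp [polyGrad, polyEval]
    rw [e1, e2, map_zero]
    exact hasFDerivAt_const a x
  | add p q hp hq =>
    have e1 : polyEval (p + q) = fun y => polyEval p y + polyEval q y :=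
      funext fun y => polyEval_add p q y
    rw [e1, polyGrad_add, map_add]
    exact hp.add hq
  | mul_X p i hp =>
    have e1 : polyEval (p * MvPolynomial.X i) = fun y => polyEval p y * y i := by
      funext y; simp [polyEval]
    have h2 : HasFDerivAt (fun y : Space d => y i) (EuclideanSpace.proj (𝕜 := ℝ) i) x :=
      (EuclideanSpace.proj (𝕜 := ℝ) i).hasFDerivAt
    rw [e1]
    refine (hp.mul h2).congr_fderiv ?_
    have e2 : polyGrad (p * MvPolynomial.X i) x
        = polyEval p x • EuclideanSpace.single i 1 + x i • polyGrad p x := by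
      ext j
      rcases eq_or_ne i j with rfl | hij
      · simp [polyGrad, polyEval]
      · simp [polyGrad, polyEval, hij.symm]
    ext y
    rw [e2]
    simp [EuclideanSpace.inner_single_left]

/-- The polynomial `x ↦ p (z + h x)`. -/
noncomputable def affineSubst (z : Space d) (h : ℝ) (p : MvPolynomial (Fin d) ℝ) :
    MvPolynomial (Fin d) ℝ :=
  MvPolynomial.bind₁ (fun i => MvPolynomial.C (z i) + MvPolynomial.C h * MvPolynomial.X i) p

lemma polyEval_affineSubst (z : Space d) (h : ℝ) (p : MvPolynomial (Fin d) ℝ) (x : Space d) :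
    polyEval (affineSubst z h p) x = polyEval p (z + h • x) := by
  simp only [polyEval, affineSubst, MvPolynomial.eval, MvPolynomial.eval₂Hom_bind₁]
  congr 2
  funext i
  simp

lemma totalDegree_affineSubst (z : Space d) (h : ℝ) (p : MvPolynomial (Fin d) ℝ) :
    (affineSubst z h p).totalDegree ≤ p.totalDegree := by
  rw [affineSubst, MvPolynomial.bind₁, MvPolynomial.aeval_def, MvPolynomial.eval₂_eq']
  refine MvPolynomial.totalDegree_finsetSum_le fun m hm => ?_
  refine (MvPolynomial.totalDegree_mul _ _).trans ?_
  rw [MvPolynomial.algebraMap_eq, MvPolynomial.totalDegree_C, zero_add]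
  refine (MvPolynomial.totalDegree_finsetProd _ _).trans ?_
  refine le_trans (Finset.sum_le_sum fun i _ => ?_) (b := ∑ i, m i) ?_
  · refine (MvPolynomial.totalDegree_pow _ _).trans ?_
    refine mul_le_of_le_one_right (Nat.zero_le _) ?_
    refine (MvPolynomial.totalDegree_add _ _).trans (max_le ?_ ?_)
    · simp
    · refine (MvPolynomial.totalDegree_mul _ _).trans ?_
      simp [MvPolynomial.totalDegree_X]
  · have := MvPolynomial.le_totalDegree hm
    rwa [Finsupp.sum_fintype _ _ (by simp)] at this

lemma polyGrad_affineSubst (z : Space d) (h : ℝ) (p : MvPolynomial (Fin d) ℝ) (x : Space d) :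
    polyGrad (affineSubst z h p) x = h • polyGrad p (z + h • x) := by
  have h1 := hasFDerivAt_polyEval (affineSubst z h p) x
  have e : polyEval (affineSubst z h p) = fun x => polyEval p (z + h • x) :=
    funext fun x => polyEval_affineSubst z h p x
  rw [e] at h1
  have h2 : HasFDerivAt (fun x : Space d => z + h • x) (h • ContinuousLinearMap.id ℝ (Space d)) x :=
    ((hasFDerivAt_id x).const_smul h).const_add z
  have h3 := h1.unique (HasFDerivAt.comp (g := polyEval p) x (hasFDerivAt_polyEval p (z + h • x)) h2)
  refine ext_inner_right ℝ fun y => ?_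
  have h4 := DFunLike.congr_fun h3 y
  simpa [real_inner_smul_left, real_inner_smul_right] using h4

/-- The ball contains a box, and a polynomial vanishing on a product of infinite sets is zero. -/
lemma eq_zero_of_polyEval_eq_zero_on_ball {p : MvPolynomial (Fin d) ℝ} {s : ℝ} (hs : 0 < s)
    (hp : ∀ x ∈ ball (0 : Space d) s, polyEval p x = 0) : p = 0 := by
  obtain ⟨ε, hε, hε'⟩ := Metric.isOpen_iff.1
    ((isOpen_ball (x := (0 : Space d)) (ε := s)).preimage (PiLp.continuous_toLp 2 fun _ : Fin d => ℝ))
    0 (by simpa using hs)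
  refine MvPolynomial.funext_set (fun _ => Ioo (-ε) ε)
    (fun _ => Ioo_infinite (by linarith)) fun x hx => ?_
  have hx' : x ∈ ball (0 : Fin d → ℝ) ε := by
    rw [mem_ball_zero_iff, pi_norm_lt_iff hε]
    intro i
    have := hx i (mem_univ i)
    rw [Real.norm_eq_abs, abs_lt]
    exact this
  have := hp _ (hε' hx')
  simpa [polyEval] using this

lemma integrableOn_ball_of_continuous {E : Type*} [NormedAddCommGroup E] {f : Space d → E}
    (hf : Continuous f) (z : Space d) (s : ℝ) : IntegrableOn f (ball z s) volume :=
  (hf.continuousOn.integrableOn_compact (isCompact_closedBall z s)).mono_set ball_subset_closedBall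

/-- Polynomials of degree at most r form a finite-dimensional space on which the L¹ norm over the
small ball is a norm. It therefore controls the coordinates in a basis, and with them values and
gradients on the unit ball. -/
lemma exists_unit_ball_bound (d r : ℕ) {s : ℝ} (hs : 0 < s) :
    ∃ C : ℝ, 0 < C ∧ ∀ p : MvPolynomial (Fin d) ℝ, p.totalDegree ≤ r →
      ∀ x ∈ closedBall (0 : Space d) 1,
        |polyEval p x| ≤ C * ∫ y in ball (0 : Space d) s, |polyEval p y| ∧
        ‖polyGrad p x‖ ≤ C * ∫ y in ball (0 : Space d) s, |polyEval p y| := by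
  set W := MvPolynomial.restrictTotalDegree (Fin d) ℝ r
  set b := Module.finBasis ℝ W
  set n := Module.finrank ℝ W
  have hint : ∀ p : MvPolynomial (Fin d) ℝ,
      Integrable (polyEval p) (volume.restrict (ball (0 : Space d) s)) :=
    fun p => integrableOn_ball_of_continuous (continuous_polyEval p) 0 s
  let L : W →ₗ[ℝ] Lp ℝ 1 (volume.restrict (ball (0 : Space d) s)) :=
    { toFun := fun p => (hint p).toL1 (polyEval (p : MvPolynomial (Fin d) ℝ))
      map_add' := fun p q => by
        rw [← Integrable.toL1_add]
        congr 1
        exact funext fun x => polyEval_add _ _ x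
      map_smul' := fun c p => by
        rw [RingHom.id_apply, ← Integrable.toL1_smul]
        congr 1
        exact funext fun x => polyEval_smul _ _ x }
  have hL : LinearMap.ker L = ⊥ := by
    rw [LinearMap.ker_eq_bot']
    intro p hp
    have h1 : polyEval (p : MvPolynomial (Fin d) ℝ) =ᵐ[volume.restrict (ball (0 : Space d) s)] 0 := by
      have h2 := (hint p).coeFn_toL1
      have h3 : (hint p).toL1 (polyEval (p : MvPolynomial (Fin d) ℝ)) = 0 := hp
      rw [h3] at h2
      exact h2.symm.trans (Lp.coeFn_zero _ _ _)
    have h2 := Measure.eqOn_open_of_ae_eq h1 isOpen_ball (continuous_polyEval _).continuousOn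
      continuousOn_const
    exact Subtype.ext (eq_zero_of_polyEval_eq_zero_on_ball hs h2)
  have hker : LinearMap.ker (L ∘ₗ b.equivFun.symm.toLinearMap) = ⊥ := by
    rw [LinearMap.ker_eq_bot] at hL ⊢
    exact hL.comp b.equivFun.symm.injective
  obtain ⟨K, hK, hanti⟩ := LinearMap.exists_antilipschitzWith _ hker
  have hbd : ∀ i, ∃ B, ∀ x ∈ closedBall (0 : Space d) 1,
      ‖polyEval (b i : MvPolynomial (Fin d) ℝ) x‖ ≤ B ∧ ‖polyGrad (b i : MvPolynomial (Fin d) ℝ) x‖ ≤ B := by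
    intro i
    obtain ⟨B₁, h₁⟩ := (isCompact_closedBall (0 : Space d) 1).exists_bound_of_continuousOn
      (continuous_polyEval (b i : MvPolynomial (Fin d) ℝ)).continuousOn
    obtain ⟨B₂, h₂⟩ := (isCompact_closedBall (0 : Space d) 1).exists_bound_of_continuousOn
      (continuous_polyGrad (b i : MvPolynomial (Fin d) ℝ)).continuousOn
    exact ⟨max B₁ B₂, fun x hx => ⟨(h₁ x hx).trans (le_max_left _ _), (h₂ x hx).trans (le_max_right _ _)⟩⟩
  choose B hB using hbd
  have hB0 : ∀ i, 0 ≤ B i := fun i =>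
    (norm_nonneg _).trans (hB i 0 (mem_closedBall_self zero_le_one)).1
  have hS : 0 ≤ ∑ i, B i := Finset.sum_nonneg fun i _ => hB0 i
  have hK' : (0 : ℝ) < K := hK
  refine ⟨(∑ i, B i + 1) * K, by positivity, fun p hp x hx => ?_⟩
  set w : W := ⟨p, (MvPolynomial.mem_restrictTotalDegree _ _ _).2 hp⟩
  set c := b.equivFun w
  have hc : ‖c‖ ≤ K * ∫ y in ball (0 : Space d) s, |polyEval p y| := by
    have h1 := hanti.le_mul_dist c 0
    rw [dist_zero_right, map_zero, dist_zero_right, LinearMap.comp_apply] at h1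
    have h2 : b.equivFun.symm.toLinearMap c = w := b.equivFun.symm_apply_apply w
    rw [h2] at h1
    have h3 : ‖L w‖ = ∫ y in ball (0 : Space d) s, |polyEval p y| :=
      L1.norm_of_fun_eq_integral_norm (hint p)
    rwa [h3] at h1
  have hw : p = ∑ i, c i • (b i : MvPolynomial (Fin d) ℝ) := by
    have := congrArg Subtype.val (b.sum_equivFun w)
    rw [show (w : MvPolynomial (Fin d) ℝ) = p from rfl] at this
    refine this.symm.trans ?_
    simp only [Submodule.coe_sum, Submodule.coe_smul, c]
  have key : ∀ {E : Type} [NormedAddCommGroup E] [NormedSpace ℝ E] (f : Fin n → E),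
      (∀ i, ‖f i‖ ≤ B i) → ‖∑ i, c i • f i‖ ≤
        (∑ i, B i + 1) * K * ∫ y in ball (0 : Space d) s, |polyEval p y| := by
    intro E _ _ f hf
    have h1 : ‖∑ i, c i • f i‖ ≤ ∑ i, ‖c‖ * B i := by
      refine (norm_sum_le _ _).trans (Finset.sum_le_sum fun i _ => ?_)
      rw [norm_smul]
      exact mul_le_mul (norm_le_pi_norm c i) (hf i) (norm_nonneg _) (norm_nonneg _)
    rw [← Finset.mul_sum] at h1
    have h2 := mul_le_mul_of_nonneg_right hc (by positivity : 0 ≤ ∑ i, B i + 1)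
    have h3 := norm_nonneg c
    nlinarith
  constructor
  · have e : polyEval p x = ∑ i, c i • polyEval (b i : MvPolynomial (Fin d) ℝ) x := by
      nth_rewrite 1 [hw]
      simp [polyEval]
    rw [e, ← Real.norm_eq_abs]
    exact key _ fun i => (hB i x hx).1
  · have e : polyGrad p x = ∑ i, c i • polyGrad (b i : MvPolynomial (Fin d) ℝ) x := by
      nth_rewrite 1 [hw]
      ext j
      simp [polyGrad, polyEval]
    rw [e]
    exact key _ fun i => (hB i x hx).2

lemma setIntegral_ball_comp_affine (f : Space d → ℝ) (z : Space d) {h s : ℝ} (hh : 0 < h) :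
    ∫ y in ball (0 : Space d) s, f (z + h • y) = (h ^ d)⁻¹ * ∫ y in ball z (s * h), f y := by
  rw [← integral_indicator measurableSet_ball, ← integral_indicator measurableSet_ball]
  have e : (fun y => (ball (0 : Space d) s).indicator (fun y => f (z + h • y)) y)
      = fun y => (fun y => (ball z (s * h)).indicator f (z + y)) (h • y) := by
    funext y
    have hm : z + h • y ∈ ball z (s * h) ↔ y ∈ ball (0 : Space d) s := by
      rw [mem_ball, mem_ball_zero_iff, dist_eq_norm, add_sub_cancel_left, norm_smul,
        Real.norm_of_nonneg hh.le, mul_comm s h]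
      exact mul_lt_mul_iff_right₀ hh
    by_cases hy : y ∈ ball (0 : Space d) s
    · simp only [indicator_of_mem hy, indicator_of_mem (hm.2 hy)]
    · simp only [indicator_of_notMem hy, indicator_of_notMem (mt hm.1 hy)]
  rw [e, Measure.integral_comp_smul volume (fun y => (ball z (s * h)).indicator f (z + y)) h,
    finrank_euclideanSpace_fin, abs_of_pos (by positivity),
    smul_eq_mul]
  congr 1
  exact integral_add_left_eq_self (fun y => (ball z (s * h)).indicator f y) z

/-- Inverse estimates for polynomials of bounded degree, on balls of comparable radii. -/
lemma exists_ball_bound (d r : ℕ) {s : ℝ} (hs : 0 < s) :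
    ∃ C : ℝ, 0 < C ∧ ∀ p : MvPolynomial (Fin d) ℝ, p.totalDegree ≤ r →
      ∀ (z : Space d) (h : ℝ), 0 < h → ∀ x ∈ closedBall z h,
        |polyEval p x| ≤ C * ((h ^ d)⁻¹ * ∫ y in ball z (s * h), |polyEval p y|) ∧
        h * ‖polyGrad p x‖ ≤ C * ((h ^ d)⁻¹ * ∫ y in ball z (s * h), |polyEval p y|) := by
  obtain ⟨C, hC, hb⟩ := exists_unit_ball_bound d r hs
  refine ⟨C, hC, fun p hp z h hh x hx => ?_⟩
  -- The ball of radius h about z is pulled back to the unit ball; the chain rule supplies the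
  -- factor h in front of the gradient.
  have h1 := hb (affineSubst z h p) ((totalDegree_affineSubst z h p).trans hp) (h⁻¹ • (x - z)) (by
    rw [mem_closedBall_zero_iff, norm_smul, norm_inv, Real.norm_of_nonneg hh.le, inv_mul_le_iff₀ hh,
      mul_one, ← dist_eq_norm]
    exact hx)
  rw [polyGrad_affineSubst, smul_smul, mul_inv_cancel₀ hh.ne', one_smul, add_sub_cancel, norm_smul,
    Real.norm_of_nonneg hh.le] at h1
  simp only [polyEval_affineSubst] at h1
  rw [setIntegral_ball_comp_affine (fun y => |polyEval p y|) z hh, smul_smul,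
    mul_inv_cancel₀ hh.ne', one_smul, add_sub_cancel] at h1
  exact h1

end Forchheimer

namespace Forchheimer

open Metric

variable {d : ℕ}

/-! ### Polynomial estimates on a cell -/

lemma totalDegree_pderiv_le (p : MvPolynomial (Fin d) ℝ) (i : Fin d) :
    (MvPolynomial.pderiv i p).totalDegree ≤ p.totalDegree := by
  nth_rewrite 1 [p.as_sum]
  rw [map_sum]
  refine MvPolynomial.totalDegree_finsetSum_le fun m hm => ?_
  rw [MvPolynomial.pderiv_monomial]
  refine (MvPolynomial.totalDegree_monomial_le _ _).trans (le_trans ?_ (MvPolynomial.le_totalDegree hm))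
  rw [Finsupp.sum_fintype _ _ (by simp), Finsupp.sum_fintype _ _ (by simp)]
  exact Finset.sum_le_sum fun j _ => by simp

lemma memLp_restrict_of_continuous {E : Type*} [NormedAddCommGroup E] {f : Space d → E}
    (hf : Continuous f) {T : Set (Space d)} (hT : Bornology.IsBounded T) (hTm : MeasurableSet T)
    (p : ENNReal) : MemLp f p (volume.restrict T) := by
  have hfin : IsFiniteMeasure (volume.restrict T) :=
    ⟨by rw [Measure.restrict_apply_univ]; exact hT.measure_lt_top⟩
  obtain ⟨B, hB⟩ := hT.isCompact_closure.exists_bound_of_continuousOn hf.continuousOn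
  refine MemLp.of_bound hf.aestronglyMeasurable B ?_
  filter_upwards [ae_restrict_mem hTm] with x hx using hB x (subset_closure hx)

lemma integrableOn_of_continuous {E : Type*} [NormedAddCommGroup E] {f : Space d → E}
    (hf : Continuous f) {T : Set (Space d)} (hT : Bornology.IsBounded T) (hTm : MeasurableSet T) :
    IntegrableOn f T volume :=
  memLp_one_iff_integrable.1 (memLp_restrict_of_continuous hf hT hTm 1)

/-- Hölder's inequality against the constant function `1`. -/
lemma setIntegral_le_rpow_mul {f : Space d → ℝ} (hf : Continuous f) (hf0 : ∀ x, 0 ≤ f x)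
    {T : Set (Space d)} (hT : Bornology.IsBounded T) (hTm : MeasurableSet T) {p : ℝ} (hp : 1 < p) :
    ∫ x in T, f x ≤ volume.real T ^ (1 - 1 / p) * (∫ x in T, f x ^ p) ^ (1 / p) := by
  have hpq := Real.HolderConjugate.conjExponent hp
  have h := integral_mul_le_Lp_mul_Lq_of_nonneg (μ := volume.restrict T) hpq
    (Filter.Eventually.of_forall hf0) (Filter.Eventually.of_forall fun _ => zero_le_one)
    (memLp_restrict_of_continuous hf hT hTm _)
    (memLp_restrict_of_continuous (f := fun _ => (1 : ℝ)) continuous_const hT hTm _)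
  have e : 1 - 1 / p = 1 / p.conjExponent := by
    have := hpq.inv_add_inv_eq_one
    simp only [one_div]
    linarith
  simp only [mul_one, Real.one_rpow, integral_const, measureReal_restrict_apply_univ,
    smul_eq_mul] at h
  rw [e, mul_comm]
  exact h

lemma sq_setIntegral_le {f : Space d → ℝ} (hf : Continuous f) (hf0 : ∀ x, 0 ≤ f x)
    {T : Set (Space d)} (hT : Bornology.IsBounded T) (hTm : MeasurableSet T) :
    (∫ x in T, f x) ^ 2 ≤ volume.real T * ∫ x in T, f x ^ 2 := by
  have h := setIntegral_le_rpow_mul hf hf0 hT hTm one_lt_two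
  have h0 : 0 ≤ ∫ x in T, f x ^ 2 := integral_nonneg fun _ => sq_nonneg _
  have h1 := pow_le_pow_left₀ (integral_nonneg hf0) h 2
  simp only [Real.rpow_two] at h1
  refine h1.trans_eq ?_
  rw [mul_pow, show (1 : ℝ) - 1 / 2 = 1 / 2 by norm_num, ← Real.sqrt_eq_rpow, ← Real.sqrt_eq_rpow,
    Real.sq_sqrt measureReal_nonneg, Real.sq_sqrt h0]

/-- The volume of the unit ball. -/
noncomputable def unitVol (d : ℕ) : ℝ := volume.real (ball (0 : Space d) 1)

lemma unitVol_pos (d : ℕ) : 0 < unitVol d :=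
  ENNReal.toReal_pos (measure_ball_pos _ _ one_pos).ne' measure_ball_lt_top.ne

lemma volume_real_le {T : Set (Space d)} {z : Space d} {h : ℝ} (hh : 0 < h)
    (hT : T ⊆ closedBall z h) : volume.real T ≤ unitVol d * h ^ d := by
  refine (measureReal_mono hT (measure_closedBall_lt_top).ne).trans_eq ?_
  rw [Measure.addHaar_real_closedBall _ _ hh.le, finrank_euclideanSpace_fin, mul_comm]
  rfl

/-- The inverse inequality `‖∇p‖ ≤ C h⁻¹ ‖p‖` on a cell. -/
lemma exists_inverse_bound (d r : ℕ) {σ : ℝ} (hσ : 0 < σ) :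
    ∃ C : ℝ, 0 < C ∧ ∀ p : MvPolynomial (Fin d) ℝ, p.totalDegree ≤ r →
      ∀ (z : Space d) (h : ℝ) (T : Set (Space d)), 0 < h → IsOpen T → ball z (σ * h) ⊆ T →
        T ⊆ closedBall z h →
        ∫ x in T, ‖polyGrad p x‖ ^ 2 ≤ C * (h ^ 2)⁻¹ * ∫ x in T, polyEval p x ^ 2 := by
  obtain ⟨C, hC, hb⟩ := exists_ball_bound d r hσ
  have hω := unitVol_pos d
  refine ⟨(C * unitVol d) ^ 2, by positivity, fun p hp z h T hh hTo hbT hTb => ?_⟩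
  have hT : Bornology.IsBounded T := isBounded_closedBall.subset hTb
  have hTm := hTo.measurableSet
  set I := ∫ x in T, |polyEval p x| with hI
  set I₂ := ∫ x in T, polyEval p x ^ 2 with hI₂
  have hI0 : 0 ≤ I := integral_nonneg fun _ => abs_nonneg _
  have hI₂0 : 0 ≤ I₂ := integral_nonneg fun _ => sq_nonneg _
  have hint := integrableOn_of_continuous (continuous_polyEval p).abs hT hTm
  have h1 : ∫ y in ball z (σ * h), |polyEval p y| ≤ I :=
    setIntegral_mono_set hint (Filter.Eventually.of_forall fun _ => abs_nonneg _)
      hbT.eventuallyLE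
  have h2 : I ^ 2 ≤ unitVol d * h ^ d * I₂ := by
    have := sq_setIntegral_le (continuous_polyEval p).abs (fun _ => abs_nonneg _) hT hTm
    simp only [sq_abs] at this
    exact this.trans (mul_le_mul_of_nonneg_right (volume_real_le hh hTb) hI₂0)
  -- The supremum is taken over the large ball containing the cell and the mean over the small ball
  -- inside it, so the shape of the cell plays no role.
  have h3 : ∀ x ∈ T, ‖polyGrad p x‖ ^ 2 ≤ (h⁻¹ * (C * ((h ^ d)⁻¹ * I))) ^ 2 := by
    intro x hx
    refine pow_le_pow_left₀ (norm_nonneg _) ?_ 2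
    rw [le_inv_mul_iff₀ hh]
    refine (hb p hp z h hh x (hTb hx)).2.trans ?_
    gcongr
  have h4 : ∫ x in T, ‖polyGrad p x‖ ^ 2 ≤ ∫ _ in T, (h⁻¹ * (C * ((h ^ d)⁻¹ * I))) ^ 2 :=
    setIntegral_mono_on (integrableOn_of_continuous ((continuous_polyGrad p).norm.pow 2) hT hTm)
      (integrableOn_of_continuous continuous_const hT hTm) hTm h3
  rw [setIntegral_const, smul_eq_mul] at h4
  calc _ ≤ _ := h4
    _ ≤ unitVol d * h ^ d * (h⁻¹ * (C * ((h ^ d)⁻¹ * I))) ^ 2 :=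
        mul_le_mul_of_nonneg_right (volume_real_le hh hTb) (sq_nonneg _)
    _ = unitVol d * (h ^ 2)⁻¹ * C ^ 2 * (h ^ d)⁻¹ * I ^ 2 := by field_simp
    _ ≤ unitVol d * (h ^ 2)⁻¹ * C ^ 2 * (h ^ d)⁻¹ * (unitVol d * h ^ d * I₂) := by gcongr
    _ = _ := by field_simp

/-- A scaled Sobolev-Poincaré inequality for polynomials on a cell. -/
lemma exists_oscillation_bound (d r : ℕ) {σ β R : ℝ} (hσ : 0 < σ) (hβ : 1 < β)
    (hdeg : 2 * d / β ≤ d + 2) (hR : 0 < R) :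
    ∃ C : ℝ, 0 < C ∧ ∀ p : MvPolynomial (Fin d) ℝ, p.totalDegree ≤ r →
      ∀ (z : Space d) (h : ℝ) (T : Set (Space d)), 0 < h → h ≤ R → IsOpen T →
        ball z (σ * h) ⊆ T → T ⊆ closedBall z h →
        ∫ x in T, (polyEval p x - polyEval p z) ^ 2
          ≤ C * (∫ x in T, ‖polyGrad p x‖ ^ β) ^ (2 / β) := by
  obtain ⟨C, hC, hb⟩ := exists_ball_bound d r hσ
  have hω := unitVol_pos d
  have hβ0 : 0 < β := by linarith
  -- This is the power of h left over by scaling. As it is nonnegative, h^e ≤ R^e and the constant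
  -- does not depend on h.
  set e : ℝ := d + 2 - 2 * d / β with he
  have he0 : 0 ≤ e := by linarith
  refine ⟨unitVol d * (d * C + 1) ^ 2 * unitVol d ^ (2 * (1 - 1 / β)) * R ^ e, by positivity,
    fun p hp z h T hh hhR hTo hbT hTb => ?_⟩
  have hT : Bornology.IsBounded T := isBounded_closedBall.subset hTb
  have hTm := hTo.measurableSet
  set I := ∫ x in T, ‖polyGrad p x‖ with hI
  set J := ∫ x in T, ‖polyGrad p x‖ ^ β with hJ
  have hI0 : 0 ≤ I := integral_nonneg fun _ => norm_nonneg _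
  have hJ0 : 0 ≤ J := integral_nonneg fun _ => Real.rpow_nonneg (norm_nonneg _) _
  have hgi := integrableOn_of_continuous (continuous_polyGrad p).norm hT hTm
  have h1 : ∀ x ∈ closedBall z h, ‖polyGrad p x‖ ≤ (d * C + 1) * ((h ^ d)⁻¹ * I) := by
    intro x hx
    -- Each partial derivative is again a polynomial of degree at most r, so its supremum is
    -- controlled by its own mean, without loss of a power of h.
    have h2 : ∀ i, |polyGrad p x i| ≤ C * ((h ^ d)⁻¹ * I) := by
      intro i
      refine (hb (MvPolynomial.pderiv i p) ((totalDegree_pderiv_le p i).trans hp) z h hh x hx).1.trans ?_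
      have h3 : ∫ y in ball z (σ * h), |polyEval (MvPolynomial.pderiv i p) y| ≤ I := by
        refine le_trans (setIntegral_mono
          (integrableOn_ball_of_continuous (continuous_polyEval _).abs z _)
          (integrableOn_ball_of_continuous (continuous_polyGrad p).norm z _) fun y => ?_)
          (setIntegral_mono_set hgi (Filter.Eventually.of_forall fun _ => norm_nonneg _)
            hbT.eventuallyLE)
        exact PiLp.norm_apply_le (polyGrad p y) i
      gcongr
    have h3 : ‖polyGrad p x‖ ≤ ∑ i, |polyGrad p x i| := by
      rw [EuclideanSpace.norm_eq]
      refine Real.sqrt_le_iff.2 ⟨Finset.sum_nonneg fun i _ => abs_nonneg _, ?_⟩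
      exact Finset.sum_sq_le_sq_sum_of_nonneg fun i _ => norm_nonneg _
    have h4 : ∑ i, |polyGrad p x i| ≤ d * (C * ((h ^ d)⁻¹ * I)) := by
      refine (Finset.sum_le_sum fun i _ => h2 i).trans_eq ?_
      simp
    have h5 : 0 ≤ (h ^ d)⁻¹ * I := by positivity
    nlinarith
  set m := (d * C + 1) * ((h ^ d)⁻¹ * I) with hm
  have hm0 : 0 ≤ m := by positivity
  have h2 : ∀ x ∈ T, (polyEval p x - polyEval p z) ^ 2 ≤ (m * h) ^ 2 := by
    intro x hx
    -- The mean value inequality is used on the convex ball around the cell, on which the gradient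
    -- bound holds too.
    have h3 := (convex_closedBall z h).norm_image_sub_le_of_norm_hasFDerivWithin_le
      (fun y _ => (hasFDerivAt_polyEval p y).hasFDerivWithinAt) (C := m) (fun y hy => by
        rw [innerSL_apply_norm]
        exact h1 y hy) (mem_closedBall_self hh.le) (hTb hx)
    have h4 : ‖x - z‖ ≤ h := by
      rw [← dist_eq_norm]; exact hTb hx
    rw [← sq_abs, ← Real.norm_eq_abs]
    exact pow_le_pow_left₀ (norm_nonneg _) (h3.trans (by gcongr)) 2
  have h3 : ∫ x in T, (polyEval p x - polyEval p z) ^ 2 ≤ ∫ _ in T, (m * h) ^ 2 :=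
    setIntegral_mono_on (integrableOn_of_continuous
      (((continuous_polyEval p).sub continuous_const).pow 2) hT hTm)
      (integrableOn_of_continuous continuous_const hT hTm) hTm h2
  rw [setIntegral_const, smul_eq_mul] at h3
  have hvol := volume_real_le hh hTb
  have hexp : 0 ≤ 1 - 1 / β := by
    have : 1 / β ≤ 1 := (div_le_one hβ0).2 hβ.le
    linarith
  have h4 : I ^ 2 ≤ unitVol d ^ (2 * (1 - 1 / β)) * h ^ (2 * d * (1 - 1 / β)) * J ^ (2 / β) := by
    have h5 : I ≤ (unitVol d * h ^ d) ^ (1 - 1 / β) * J ^ (1 / β) :=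
      (setIntegral_le_rpow_mul (continuous_polyGrad p).norm (fun _ => norm_nonneg _) hT hTm hβ).trans
        (by
          have := Real.rpow_le_rpow measureReal_nonneg hvol hexp
          gcongr)
    have h6 := pow_le_pow_left₀ hI0 h5 2
    refine h6.trans_eq ?_
    rw [Real.mul_rpow hω.le (by positivity), mul_pow, mul_pow]
    simp only [← Real.rpow_natCast]
    rw [← Real.rpow_mul hω.le, ← Real.rpow_mul hh.le, ← Real.rpow_mul hh.le, ← Real.rpow_mul hJ0,
      show (1 - 1 / β) * ((2 : ℕ) : ℝ) = 2 * (1 - 1 / β) by push_cast; ring,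
      show (d : ℝ) * (1 - 1 / β) * ((2 : ℕ) : ℝ) = 2 * d * (1 - 1 / β) by push_cast; ring,
      show 1 / β * ((2 : ℕ) : ℝ) = 2 / β by push_cast; ring]
  have h5 : h ^ 2 * (h ^ d)⁻¹ * h ^ (2 * d * (1 - 1 / β)) = h ^ e := by
    rw [← Real.rpow_natCast, ← Real.rpow_natCast, ← Real.rpow_neg hh.le, ← Real.rpow_add hh,
      ← Real.rpow_add hh]
    congr 1
    rw [he]
    push_cast
    field_simp
    ring
  calc _ ≤ _ := h3
    _ ≤ unitVol d * h ^ d * (m * h) ^ 2 := by gcongr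
    _ = unitVol d * (d * C + 1) ^ 2 * (h ^ 2 * (h ^ d)⁻¹) * I ^ 2 := by
        rw [hm]; field_simp
    _ ≤ unitVol d * (d * C + 1) ^ 2 * (h ^ 2 * (h ^ d)⁻¹)
        * (unitVol d ^ (2 * (1 - 1 / β)) * h ^ (2 * d * (1 - 1 / β)) * J ^ (2 / β)) := by gcongr
    _ = unitVol d * (d * C + 1) ^ 2 * unitVol d ^ (2 * (1 - 1 / β))
        * (h ^ 2 * (h ^ d)⁻¹ * h ^ (2 * d * (1 - 1 / β))) * J ^ (2 / β) := by ring
    _ = unitVol d * (d * C + 1) ^ 2 * unitVol d ^ (2 * (1 - 1 / β)) * h ^ e * J ^ (2 / β) := by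
        rw [h5]
    _ ≤ _ := by gcongr

end Forchheimer

namespace Forchheimer

open Metric
open scoped Convolution ENNReal

variable {d : ℕ} {Ω : Set (Space d)}

/-! ### Mollification of functions with a weak gradient -/

lemma sq_lintegral_le {α : Type*} [MeasurableSpace α] (μ : Measure α) [IsProbabilityMeasure μ]
    {f : α → ℝ≥0∞} (hf : AEMeasurable f μ) : (∫⁻ x, f x ∂μ) ^ 2 ≤ ∫⁻ x, f x ^ 2 ∂μ := by
  have h := ENNReal.lintegral_mul_le_Lp_mul_Lq μ Real.HolderConjugate.two_two hf
    (aemeasurable_const (b := (1 : ℝ≥0∞)))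
  simp only [Pi.mul_apply, mul_one, lintegral_const, measure_univ,
    ENNReal.rpow_two, one_pow, ENNReal.one_rpow] at h
  calc _ ≤ ((∫⁻ x, f x ^ 2 ∂μ) ^ (1 / 2 : ℝ)) ^ 2 := pow_le_pow_left' h 2
    _ = _ := by
      rw [← ENNReal.rpow_two, ← ENNReal.rpow_mul]
      norm_num

/-- The mollification of `u` extended by `0`. -/
noncomputable def mollify (η : ContDiffBump (0 : Space d)) (u : L2 Ω) : Space d → ℝ :=
  Ω.indicator u ⋆[ContinuousLinearMap.lsmul ℝ ℝ, volume] η.normed volume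

lemma memLp_indicator_L2 (hΩ : IsOpen Ω) (u : L2 Ω) : MemLp (Ω.indicator u) 2 volume :=
  (memLp_indicator_iff_restrict hΩ.measurableSet).2 (Lp.memLp u)

lemma locallyIntegrable_indicator_L2 (hΩ : IsOpen Ω) (u : L2 Ω) :
    LocallyIntegrable (Ω.indicator u) volume :=
  (memLp_indicator_L2 hΩ u).locallyIntegrable (by norm_num)

variable (η : ContDiffBump (0 : Space d))

lemma contDiff_mollify (hΩ : IsOpen Ω) (u : L2 Ω) : ContDiff ℝ 1 (mollify η u) :=
  HasCompactSupport.contDiff_convolution_right (n := 1) (ContinuousLinearMap.lsmul ℝ ℝ) η.hasCompactSupport_normed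
    (locallyIntegrable_indicator_L2 hΩ u) η.contDiff_normed

lemma fderiv_mollify_apply (hΩ : IsOpen Ω) (u : L2 Ω) (x w : Space d) :
    fderiv ℝ (mollify η u) x w = ∫ t in Ω, u t * fderiv ℝ (η.normed volume) (x - t) w := by
  have h1 := HasCompactSupport.hasFDerivAt_convolution_right
    (ContinuousLinearMap.lsmul ℝ ℝ) η.hasCompactSupport_normed
    (locallyIntegrable_indicator_L2 hΩ u) (η.contDiff_normed (μ := volume) (n := 1)) x
  have h2 := convolution_precompR_apply (ContinuousLinearMap.lsmul ℝ ℝ)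
    (locallyIntegrable_indicator_L2 hΩ u) (HasCompactSupport.fderiv (𝕜 := ℝ) (η.hasCompactSupport_normed (μ := volume)))
    ((η.contDiff_normed (μ := volume) (n := 1)).continuous_fderiv (by simp)) x w
  rw [mollify, h1.fderiv]
  refine h2.trans ?_
  rw [convolution_def, ← integral_indicator hΩ.measurableSet]
  refine integral_congr_ae (Filter.Eventually.of_forall fun t => ?_)
  by_cases ht : t ∈ Ω <;> simp [ht]

lemma isTestFunction_normed_sub {x : Space d} (hx : closedBall x η.rOut ⊆ Ω) :
    IsTestFunction Ω fun t => η.normed volume (x - t) := by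
  have hsupp : tsupport (fun t => η.normed volume (x - t)) ⊆ closedBall x η.rOut := by
    refine closure_minimal (fun t ht => ?_) isClosed_closedBall
    have h1 : x - t ∈ Function.support (η.normed volume) := ht
    rw [η.support_normed_eq, mem_ball_zero_iff, ← dist_eq_norm, dist_comm] at h1
    exact h1.le
  refine ⟨η.contDiff_normed.comp (contDiff_const.sub contDiff_id), ?_, hsupp.trans hx⟩
  exact (isCompact_closedBall x η.rOut).of_isClosed_subset (isClosed_tsupport _) hsupp

/-- The reflected kernel t ↦ η(x − t) is a test function on Ω when its ball lies inside Ω, so the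
derivative can be moved onto the weak gradient. Near the boundary this may fail, because the
extension by 0 may jump; hence the contracted cells used below. -/
lemma fderiv_mollify_eq (hΩ : IsOpen Ω) {u : L2 Ω} {G : L2Vec Ω} (hG : IsWeakGradient u G)
    {x : Space d} (hx : closedBall x η.rOut ⊆ Ω) (w : Space d) :
    fderiv ℝ (mollify η u) x w = ∫ t in Ω, inner ℝ (G t) w * η.normed volume (x - t) := by
  have htest := isTestFunction_normed_sub η hx
  have hbasis : ∀ i : Fin d, fderiv ℝ (mollify η u) x (EuclideanSpace.single i 1)
      = ∫ t in Ω, G t i * η.normed volume (x - t) := by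
    intro i
    have h := hG _ htest i
    have e : ∀ t, fderiv ℝ (fun t => η.normed volume (x - t)) t (EuclideanSpace.single i 1)
        = - fderiv ℝ (η.normed volume) (x - t) (EuclideanSpace.single i 1) := by
      intro t
      have h1 : HasFDerivAt (η.normed volume) (fderiv ℝ (η.normed volume) (x - t)) (x - t) :=
        ((η.contDiff_normed (μ := volume) (n := 1)).differentiable (by simp)).differentiableAt.hasFDerivAt
      have h2 : HasFDerivAt (fun t : Space d => x - t) (-ContinuousLinearMap.id ℝ (Space d)) t :=
        (hasFDerivAt_id t).const_sub x
      have h3 : HasFDerivAt (fun t => η.normed volume (x - t)) _ t :=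
        HasFDerivAt.comp (g := η.normed volume) t h1 h2
      rw [h3.fderiv]
      simp
    simp only [e, mul_neg, integral_neg, neg_inj] at h
    rw [fderiv_mollify_apply η hΩ, h]
  have hw : w = ∑ i, w i • EuclideanSpace.single i (1 : ℝ) := by
    ext j
    simp [Finset.sum_apply, Pi.single_apply]
  have hint : ∀ i ∈ Finset.univ, Integrable (fun t => w i * (G t i * η.normed volume (x - t)))
      (volume.restrict Ω) := fun i _ => (integrable_coord_mul htest G i).const_mul _
  nth_rewrite 1 [hw]
  simp only [map_sum, map_smul, hbasis, smul_eq_mul, ← integral_const_mul]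
  rw [← integral_finsetSum _ hint]
  refine integral_congr_ae (Filter.Eventually.of_forall fun t => ?_)
  simp only [PiLp.inner_apply, Finset.sum_mul]
  refine Finset.sum_congr rfl fun i _ => ?_
  simp
  ring

lemma isProbabilityMeasure_withDensity_normed (x : Space d) :
    IsProbabilityMeasure
      ((volume : Measure (Space d)).withDensity fun t => ENNReal.ofReal (η.normed volume (x - t))) := by
  constructor
  rw [withDensity_apply _ MeasurableSet.univ, Measure.restrict_univ,
    ← ofReal_integral_eq_lintegral_ofReal, integral_sub_left_eq_self, η.integral_normed,
    ENNReal.ofReal_one]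
  · exact η.integrable_normed.comp_sub_left x
  · exact Filter.Eventually.of_forall fun t => η.nonneg_normed _

/-- The squared gradient on `T`, extended by `0`. -/
noncomputable def gradSq (G : L2Vec Ω) (T : Set (Space d)) : Space d → ℝ≥0∞ :=
  T.indicator fun t => ‖G t‖ₑ ^ 2

lemma measurable_gradSq (G : L2Vec Ω) {T : Set (Space d)} (hT : MeasurableSet T) :
    Measurable (gradSq G T) :=
  ((Lp.stronglyMeasurable G).measurable.enorm.pow_const 2).indicator hT

/-- The mollified squared gradient. -/
noncomputable def gradSqMollify (G : L2Vec Ω) (T : Set (Space d)) (x : Space d) : ℝ≥0∞ :=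
  ∫⁻ t, ENNReal.ofReal (η.normed volume (x - t)) * gradSq G T t

lemma measurable_gradSqMollify_integrand (G : L2Vec Ω) {T : Set (Space d)} (hT : MeasurableSet T) :
    Measurable fun q : Space d × Space d =>
      ENNReal.ofReal (η.normed volume (q.1 - q.2)) * gradSq G T q.2 :=
  (η.continuous_normed.measurable.comp (measurable_fst.sub measurable_snd)).ennreal_ofReal.mul
    ((measurable_gradSq G hT).comp measurable_snd)

lemma measurable_gradSqMollify (G : L2Vec Ω) {T : Set (Space d)} (hT : MeasurableSet T) :
    Measurable (gradSqMollify η G T) :=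
  (measurable_gradSqMollify_integrand η G hT).lintegral_prod_right'

lemma lintegral_gradSqMollify (G : L2Vec Ω) {T : Set (Space d)} (hT : MeasurableSet T) :
    ∫⁻ x, gradSqMollify η G T x = ∫⁻ t, gradSq G T t := by
  simp only [gradSqMollify]
  rw [lintegral_lintegral_swap (measurable_gradSqMollify_integrand η G hT).aemeasurable]
  refine lintegral_congr fun t => ?_
  rw [lintegral_mul_const _ (by
    exact (η.continuous_normed.measurable.comp (measurable_id.sub_const t)).ennreal_ofReal),
    ← ofReal_integral_eq_lintegral_ofReal (η.integrable_normed.comp_sub_right t)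
      (Filter.Eventually.of_forall fun x => η.nonneg_normed _),
    integral_sub_right_eq_self (fun x => η.normed volume x), η.integral_normed, ENNReal.ofReal_one,
    one_mul]

/-- The kernel is a probability density supported in T, so Cauchy-Schwarz bounds the square of the
averaged gradient by the average of its square over T alone. -/
lemma enorm_fderiv_mollify_sq_le (hΩ : IsOpen Ω) {u : L2 Ω} {G : L2Vec Ω} (hG : IsWeakGradient u G)
    {T : Set (Space d)} (hT : MeasurableSet T) (hTΩ : T ⊆ Ω)
    {x : Space d} (hx : closedBall x η.rOut ⊆ T) (w : Space d) :
    ‖fderiv ℝ (mollify η u) x w‖ₑ ^ 2 ≤ ‖w‖ₑ ^ 2 * gradSqMollify η G T x := by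
  have hprob := isProbabilityMeasure_withDensity_normed η x
  have hηm : Measurable fun t => ENNReal.ofReal (η.normed volume (x - t)) :=
    (η.continuous_normed.measurable.comp (measurable_id.const_sub x)).ennreal_ofReal
  have hGm : Measurable fun t => ‖T.indicator G t‖ₑ :=
    ((Lp.stronglyMeasurable G).measurable.indicator hT).enorm
  have h1 : ‖fderiv ℝ (mollify η u) x w‖ₑ ≤
      ‖w‖ₑ * ∫⁻ t, ENNReal.ofReal (η.normed volume (x - t)) * ‖T.indicator G t‖ₑ := by
    rw [fderiv_mollify_eq η hΩ hG (hx.trans hTΩ)]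
    refine (enorm_integral_le_lintegral_enorm _).trans ?_
    rw [← lintegral_const_mul _ (by exact hηm.mul hGm)]
    refine (setLIntegral_le_lintegral _ _).trans (lintegral_mono fun t => ?_)
    by_cases ht : t ∈ T
    · rw [indicator_of_mem ht, enorm_mul, ← ofReal_norm (inner ℝ (G t) w),
        Real.enorm_of_nonneg (η.nonneg_normed _)]
      have h2 : ENNReal.ofReal ‖inner ℝ (G t) w‖ ≤ ‖G t‖ₑ * ‖w‖ₑ := by
        rw [← ofReal_norm (G t), ← ofReal_norm w, ← ENNReal.ofReal_mul (norm_nonneg _)]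
        exact ENNReal.ofReal_le_ofReal (norm_inner_le_norm _ _)
      calc _ ≤ ‖G t‖ₑ * ‖w‖ₑ * ENNReal.ofReal (η.normed volume (x - t)) := by gcongr
        _ = _ := by ring
    · have h3 : η.normed volume (x - t) = 0 := by
        by_contra h0
        have h4 : x - t ∈ Function.support (η.normed volume) := h0
        rw [η.support_normed_eq, mem_ball_zero_iff, ← dist_eq_norm, dist_comm] at h4
        exact ht (hx h4.le)
      simp [h3]
  have h2 := sq_lintegral_le
    ((volume : Measure (Space d)).withDensity fun t => ENNReal.ofReal (η.normed volume (x - t)))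
    hGm.aemeasurable
  rw [lintegral_withDensity_eq_lintegral_mul _ hηm hGm,
    lintegral_withDensity_eq_lintegral_mul _ hηm (hGm.pow_const 2)] at h2
  simp only [Pi.mul_apply] at h2
  have h3 : ∫⁻ t, ENNReal.ofReal (η.normed volume (x - t)) * ‖T.indicator G t‖ₑ ^ 2
      = gradSqMollify η G T x := by
    refine lintegral_congr fun t => ?_
    by_cases ht : t ∈ T <;> simp [gradSq, ht]
  rw [h3] at h2
  calc _ ≤ _ := pow_le_pow_left' h1 2
    _ = _ := mul_pow _ _ _
    _ ≤ _ := by gcongr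

end Forchheimer

namespace Forchheimer

open Metric
open scoped Convolution ENNReal

variable {d : ℕ} {Ω : Set (Space d)}

/-! ### The Poincaré inequality on a star-shaped cell -/

lemma enorm_sub_sq_le_lintegral {v : Space d → ℝ} (hv : ContDiff ℝ 1 v) (x y : Space d) :
    ‖v x - v y‖ₑ ^ 2 ≤ ∫⁻ s in Ioc (0 : ℝ) 1, ‖fderiv ℝ v (y + s • (x - y)) (x - y)‖ₑ ^ 2 := by
  have hγ : ∀ s : ℝ, HasDerivAt (fun s : ℝ => y + s • (x - y)) (x - y) s := by
    intro s
    simpa using ((hasDerivAt_id s).smul_const (x - y)).const_add y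
  have hd : ∀ s : ℝ, HasDerivAt (fun s : ℝ => v (y + s • (x - y)))
      (fderiv ℝ v (y + s • (x - y)) (x - y)) s := fun s =>
    HasFDerivAt.comp_hasDerivAt s
      (hv.differentiable (by simp)).differentiableAt.hasFDerivAt (hγ s)
  have hc : Continuous fun s : ℝ => fderiv ℝ v (y + s • (x - y)) (x - y) :=
    ((hv.continuous_fderiv (by simp)).comp (by fun_prop)).clm_apply continuous_const
  have e := intervalIntegral.integral_eq_sub_of_hasDerivAt (fun s _ => hd s)
    (hc.intervalIntegrable 0 1)
  simp only [one_smul, zero_smul, add_zero, add_sub_cancel] at e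
  have hprob : IsProbabilityMeasure (volume.restrict (Ioc (0 : ℝ) 1)) := ⟨by simp⟩
  rw [← e, intervalIntegral.integral_of_le zero_le_one]
  exact (pow_le_pow_left' (enorm_integral_le_lintegral_enorm _) 2).trans
    (sq_lintegral_le _ hc.measurable.enorm.aemeasurable)

/-- The change of variables has Jacobian factor k^(−d), at most 2^d when k ≥ 1/2. -/
lemma lintegral_comp_affine_le {m : Space d → ℝ≥0∞} (hm : Measurable m) {k : ℝ} (hk : 1 / 2 ≤ k)
    (c : Space d) : ∫⁻ x, m (c + k • x) ≤ 2 ^ d * ∫⁻ x, m x := by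
  have hk0 : 0 < k := by linarith
  have h1 : ∫⁻ x, m (c + k • x) = ∫⁻ x, m (c + x) ∂(Measure.map (k • ·) volume) :=
    (lintegral_map (f := fun x => m (c + x)) (hm.comp (measurable_const_add c))
      (measurable_const_smul k)).symm
  rw [h1, Measure.map_addHaar_smul _ hk0.ne', lintegral_smul_measure, lintegral_add_left_eq_self,
    finrank_euclideanSpace_fin, smul_eq_mul]
  gcongr
  rw [abs_of_pos (by positivity), ← inv_pow]
  have h2 : k⁻¹ ≤ 2 := by
    rw [inv_le_comm₀ hk0 two_pos]
    linarith
  calc ENNReal.ofReal (k⁻¹ ^ d) ≤ ENNReal.ofReal (2 ^ d) :=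
        ENNReal.ofReal_le_ofReal (pow_le_pow_left₀ (inv_nonneg.2 hk0.le) h2 d)
    _ = 2 ^ d := by rw [ENNReal.ofReal_pow two_pos.le]; simp

/-- Averages over the segments joining the points of two sets. -/
lemma lintegral_segment_le {m : Space d → ℝ≥0∞} (hm : Measurable m) {B T : Set (Space d)}
    (hBT : B ⊆ T) :
    ∫⁻ y in B, ∫⁻ x in T, ∫⁻ s in Ioc (0 : ℝ) 1, m (y + s • (x - y))
      ≤ 2 ^ d * volume T * ∫⁻ x, m x := by
  have hm2 : Measurable fun q : Space d × ℝ => ∫⁻ x in T, m (q.1 + q.2 • (x - q.1)) := by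
    refine Measurable.lintegral_prod_right' (f := fun q : (Space d × ℝ) × Space d =>
      m (q.1.1 + q.1.2 • (q.2 - q.1.1))) (hm.comp (by fun_prop))
  have e1 : ∫⁻ y in B, ∫⁻ x in T, ∫⁻ s in Ioc (0 : ℝ) 1, m (y + s • (x - y))
      = ∫⁻ s in Ioc (0 : ℝ) 1, ∫⁻ y in B, ∫⁻ x in T, m (y + s • (x - y)) := by
    rw [← lintegral_lintegral_swap (f := fun (y : Space d) (s : ℝ) =>
      ∫⁻ x in T, m (y + s • (x - y))) hm2.aemeasurable]
    refine lintegral_congr fun y => ?_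
    exact lintegral_lintegral_swap (f := fun (x : Space d) (s : ℝ) => m (y + s • (x - y)))
      (Measurable.aemeasurable (hm.comp (by fun_prop)))
  rw [e1]
  have key : ∀ s ∈ Ioc (0 : ℝ) 1, ∫⁻ y in B, ∫⁻ x in T, m (y + s • (x - y))
      ≤ 2 ^ d * volume T * ∫⁻ x, m x := by
    intro s hs
    -- The substitution is made in the endpoint that carries weight at least 1/2, that is x for s ≥
    -- 1/2 and y for s ≤ 1/2, which keeps the Jacobian factor bounded for all s.
    rcases le_total (1 / 2) s with h | h
    · have h1 : ∀ y, ∫⁻ x in T, m (y + s • (x - y)) ≤ 2 ^ d * ∫⁻ x, m x := by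
        intro y
        refine (setLIntegral_le_lintegral _ _).trans ?_
        have e : ∀ x, y + s • (x - y) = (y - s • y) + s • x := fun x => by
          rw [smul_sub]; abel
        simp only [e]
        exact lintegral_comp_affine_le hm h _
      refine (lintegral_mono h1).trans ?_
      rw [lintegral_const, Measure.restrict_apply_univ]
      calc _ ≤ 2 ^ d * (∫⁻ x, m x) * volume T := by gcongr
        _ = _ := by ring
    · rw [lintegral_lintegral_swap (f := fun (y x : Space d) => m (y + s • (x - y)))
        (Measurable.aemeasurable (hm.comp (by fun_prop)))]
      have h1 : ∀ x, ∫⁻ y in B, m (y + s • (x - y)) ≤ 2 ^ d * ∫⁻ x, m x := by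
        intro x
        refine (setLIntegral_le_lintegral _ _).trans ?_
        have e : ∀ y, y + s • (x - y) = s • x + (1 - s) • y := fun y => by
          rw [smul_sub, sub_smul, one_smul]; abel
        simp only [e]
        exact lintegral_comp_affine_le hm (by linarith) _
      refine (lintegral_mono h1).trans ?_
      rw [lintegral_const, Measure.restrict_apply_univ]
      exact le_of_eq (by ring)
  calc _ ≤ ∫⁻ _ in Ioc (0 : ℝ) 1, 2 ^ d * volume T * ∫⁻ x, m x :=
        setLIntegral_mono' measurableSet_Ioc key
    _ = _ := by simp

/-- The set `T` contracted towards `z` by the factor `θ`. -/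
def contract (z : Space d) (θ : ℝ) (T : Set (Space d)) : Set (Space d) :=
  {x | z + θ⁻¹ • (x - z) ∈ T}

lemma measurableSet_contract (z : Space d) (θ : ℝ) {T : Set (Space d)} (hT : MeasurableSet T) :
    MeasurableSet (contract z θ T) :=
  hT.preimage (by fun_prop : Measurable fun x : Space d => z + θ⁻¹ • (x - z))

/-- `T` is star-shaped with respect to every point of the ball of radius `s` about `z`. -/
def IsStarShaped (z : Space d) (s : ℝ) (T : Set (Space d)) : Prop :=
  ball z s ⊆ T ∧ ∀ y ∈ ball z s, StarConvex ℝ y T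

/-- A point x of the contracted set is (1 − θ) z + θ x' with x' in T. A nearby q is (1 − θ) y + θ x'
with y = z + (q − x)/(1 − θ), which still lies in the ball of star centres. -/
lemma IsStarShaped.closedBall_subset {z : Space d} {s : ℝ} {T : Set (Space d)}
    (hT : IsStarShaped z s T) {θ ε : ℝ} (hθ0 : 0 < θ) (hθ1 : θ < 1) (hε : ε < (1 - θ) * s)
    {x : Space d} (hx : x ∈ contract z θ T) : closedBall x ε ⊆ T := by
  intro q hq
  have h1 : 0 < 1 - θ := by linarith
  have hy : z + (1 - θ)⁻¹ • (q - x) ∈ ball z s := by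
    rw [mem_ball, dist_eq_norm, add_sub_cancel_left, norm_smul, norm_inv, Real.norm_of_nonneg h1.le,
      inv_mul_lt_iff₀ h1, ← dist_eq_norm]
    exact lt_of_le_of_lt hq hε
  have h2 := (hT.2 _ hy) hx h1.le hθ0.le (by ring)
  have e : (1 - θ) • (z + (1 - θ)⁻¹ • (q - x)) + θ • (z + θ⁻¹ • (x - z)) = q := by
    rw [smul_add, smul_add, smul_inv_smul₀ h1.ne', smul_inv_smul₀ hθ0.ne', sub_smul, one_smul]
    abel
  rwa [e] at h2

/-- Dilation about z maps segments to segments, so the contracted cell is star-shaped with respect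
to the contracted ball. -/
lemma IsStarShaped.segment_mem {z : Space d} {s : ℝ} {T : Set (Space d)}
    (hT : IsStarShaped z s T) {θ : ℝ} {x y : Space d} (hx : x ∈ contract z θ T)
    (hy : y ∈ contract z θ (ball z s)) {k : ℝ} (hk0 : 0 ≤ k) (hk1 : k ≤ 1) :
    y + k • (x - y) ∈ contract z θ T := by
  have h := hT.2 _ hy hx (sub_nonneg.2 hk1) hk0 (by ring)
  have e : (1 - k) • (z + θ⁻¹ • (y - z)) + k • (z + θ⁻¹ • (x - z))
      = z + θ⁻¹ • (y + k • (x - y) - z) := by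
    module
  rw [e] at h
  exact h

lemma contract_subset {z : Space d} {s : ℝ} {T : Set (Space d)}
    (hT : IsStarShaped z s T) (hs : 0 < s) {θ : ℝ} (hθ0 : 0 < θ) (hθ1 : θ < 1) :
    contract z θ T ⊆ T := fun x hx =>
  hT.closedBall_subset hθ0 hθ1 (ε := 0) (mul_pos (by linarith) hs) hx (mem_closedBall_self le_rfl)

/-- The Poincaré inequality for a mollified function on the contracted cell. -/
lemma lintegral_mollify_sub_sq_le (η : ContDiffBump (0 : Space d)) (hΩ : IsOpen Ω) {u : L2 Ω}
    {G : L2Vec Ω} (hG : IsWeakGradient u G) {T : Set (Space d)} (hTo : IsOpen T) (hTΩ : T ⊆ Ω)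
    {z : Space d} {s h : ℝ} (hs : 0 < s) (hT : IsStarShaped z s T)
    (hdist : ∀ x ∈ T, ∀ y ∈ T, dist x y ≤ h) {θ : ℝ} (hθ0 : 0 < θ) (hθ1 : θ < 1)
    (hη : η.rOut < (1 - θ) * s) :
    ∫⁻ y in contract z θ (ball z s), ∫⁻ x in contract z θ T, ‖mollify η u x - mollify η u y‖ₑ ^ 2
      ≤ ENNReal.ofReal (h ^ 2) * (2 ^ d * volume T * ∫⁻ x, gradSq G T x) := by
  have hTm := hTo.measurableSet
  set T' := contract z θ T with hT'
  set B' := contract z θ (ball z s) with hB'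
  have hT'm : MeasurableSet T' := measurableSet_contract z θ hTm
  have hB'm : MeasurableSet B' := measurableSet_contract z θ measurableSet_ball
  have hBT : B' ⊆ T' := fun x hx => hT.1 hx
  have hT'T : T' ⊆ T := contract_subset hT hs hθ0 hθ1
  set m := T'.indicator (gradSqMollify η G T) with hm
  have hmm : Measurable m := (measurable_gradSqMollify η G hTm).indicator hT'm
  have hpt : ∀ y ∈ B', ∀ x ∈ T', ‖mollify η u x - mollify η u y‖ₑ ^ 2
      ≤ ENNReal.ofReal (h ^ 2) * ∫⁻ k in Ioc (0 : ℝ) 1, m (y + k • (x - y)) := by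
    intro y hy x hx
    refine (enorm_sub_sq_le_lintegral (contDiff_mollify η hΩ u) x y).trans ?_
    have hline : Measurable fun k : ℝ => m (y + k • (x - y)) := hmm.comp (by fun_prop)
    rw [← lintegral_const_mul _ hline]
    refine setLIntegral_mono' measurableSet_Ioc fun k hk => ?_
    have hmem := hT.segment_mem hx hy hk.1.le hk.2
    refine (enorm_fderiv_mollify_sq_le η hΩ hG hTm hTΩ
      (hT.closedBall_subset hθ0 hθ1 hη hmem) (x - y)).trans ?_
    rw [hm, indicator_of_mem hmem]
    gcongr
    rw [← ofReal_norm, ← ENNReal.ofReal_pow (norm_nonneg _), ← dist_eq_norm]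
    exact ENNReal.ofReal_le_ofReal
      (pow_le_pow_left₀ dist_nonneg (hdist x (hT'T hx) y (hT'T (hBT hy))) 2)
  calc _ ≤ ∫⁻ y in B', ∫⁻ x in T', ENNReal.ofReal (h ^ 2)
          * ∫⁻ k in Ioc (0 : ℝ) 1, m (y + k • (x - y)) :=
        setLIntegral_mono' hB'm fun y hy => setLIntegral_mono' hT'm (hpt y hy)
    _ = ENNReal.ofReal (h ^ 2) * ∫⁻ y in B', ∫⁻ x in T', ∫⁻ k in Ioc (0 : ℝ) 1, m (y + k • (x - y)) := by
        have hin : ∀ y, ∫⁻ x in T', ENNReal.ofReal (h ^ 2)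
              * ∫⁻ k in Ioc (0 : ℝ) 1, m (y + k • (x - y))
            = ENNReal.ofReal (h ^ 2) * ∫⁻ x in T', ∫⁻ k in Ioc (0 : ℝ) 1, m (y + k • (x - y)) :=
          fun y => lintegral_const_mul' _ _ ENNReal.ofReal_ne_top
        simp only [hin]
        exact lintegral_const_mul' _ _ ENNReal.ofReal_ne_top
    _ ≤ ENNReal.ofReal (h ^ 2) * (2 ^ d * volume T * ∫⁻ x, gradSq G T x) := by
        gcongr
        refine (lintegral_segment_le hmm hBT).trans ?_
        rw [← lintegral_gradSqMollify η G hTm]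
        exact mul_le_mul' (mul_le_mul_right (measure_mono hT'T) _)
          (lintegral_mono fun x => indicator_le_self _ _ x)

end Forchheimer

/-! ### Removal of the mollification -/

namespace Forchheimer

open Metric Filter
open scoped Convolution ENNReal Topology

variable {d : ℕ} {Ω : Set (Space d)}

lemma mollify_eq_convolution (η : ContDiffBump (0 : Space d)) (u : L2 Ω) (x : Space d) :
    mollify η u x =
      (η.normed volume ⋆[ContinuousLinearMap.lsmul ℝ ℝ, volume] Ω.indicator u) x := by
  rw [mollify, convolution_eq_swap, convolution_def]
  exact integral_congr_ae (Eventually.of_forall fun t => by simp [mul_comm])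

/-- The two-point form of the Poincaré inequality. -/
lemma lintegral_sub_sq_le (hΩ : IsOpen Ω) {u : L2 Ω}
    {G : L2Vec Ω} (hG : IsWeakGradient u G) {T : Set (Space d)} (hTo : IsOpen T) (hTΩ : T ⊆ Ω)
    {z : Space d} {s h : ℝ} (hs : 0 < s) (hT : IsStarShaped z s T)
    (hdist : ∀ x ∈ T, ∀ y ∈ T, dist x y ≤ h) :
    ∫⁻ y in ball z s, ∫⁻ x in T, ‖u x - u y‖ₑ ^ 2
      ≤ ENNReal.ofReal (h ^ 2) * (2 ^ d * volume T * ∫⁻ x, gradSq G T x) := by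
  have hTm := hTo.measurableSet
  set A := ENNReal.ofReal (h ^ 2) * (2 ^ d * volume T * ∫⁻ x, gradSq G T x) with hA
  -- The shift by 2 keeps `τ n`, and hence the contraction factor 1 − τ n, strictly between 0 and 1
  -- for every n, including 0.
  set τ : ℕ → ℝ := fun n => 1 / ((n : ℝ) + 2) with hτ
  have hτ0 : ∀ n, 0 < τ n := fun n => by positivity
  have hτ1 : ∀ n, τ n < 1 := fun n => by
    rw [hτ, div_lt_one (by positivity)]
    linarith [(Nat.cast_nonneg n : (0 : ℝ) ≤ n)]
  have hτlim : Tendsto τ atTop (𝓝 0) :=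
    tendsto_const_nhds.div_atTop (tendsto_atTop_add_const_right _ _ tendsto_natCast_atTop_atTop)
  set θ : ℕ → ℝ := fun n => 1 - τ n with hθ
  have hθ0 : ∀ n, 0 < θ n := fun n => sub_pos.2 (hτ1 n)
  have hθ1 : ∀ n, θ n < 1 := fun n => by linarith [hτ0 n, show θ n = 1 - τ n from rfl]
  have hθlim : Tendsto θ atTop (𝓝 1) := by simpa using hτlim.const_sub 1
  -- The outer radius τ s / 2 is below (1 − θ) s = τ s, as the contracted estimate requires. The
  -- bounded ratio of outer to inner radius gives convergence of the mollifications almost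
  -- everywhere.
  let η : ℕ → ContDiffBump (0 : Space d) := fun n =>
    ⟨τ n * s / 4, τ n * s / 2, by have := hτ0 n; positivity, by
      have := mul_pos (hτ0 n) hs; linarith⟩
  have hη : ∀ n, (η n).rOut < (1 - θ n) * s := fun n => by
    have := mul_pos (hτ0 n) hs
    change τ n * s / 2 < (1 - (1 - τ n)) * s
    linarith
  have hηlim : Tendsto (fun n => (η n).rOut) atTop (𝓝 0) := by
    have := (hτlim.mul_const s).div_const 2
    simpa using this
  have hae : ∀ᵐ x ∂(volume : Measure (Space d)),
      Tendsto (fun n => mollify (η n) u x) atTop (𝓝 (Ω.indicator u x)) := by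
    have := ContDiffBump.ae_convolution_tendsto_right_of_locallyIntegrable (φ := η) (K := 2) hηlim
      (Eventually.of_forall fun n => by
        change τ n * s / 2 ≤ 2 * (τ n * s / 4)
        linarith) (locallyIntegrable_indicator_L2 hΩ u)
    simpa only [mollify_eq_convolution] using this
  set W : ℕ → Set (Space d × Space d) :=
    fun n => contract z (θ n) (ball z s) ×ˢ contract z (θ n) T with hW
  have hWm : ∀ n, MeasurableSet (W n) := fun n =>
    (measurableSet_contract z _ measurableSet_ball).prod (measurableSet_contract z _ hTm)
  have hcm : ∀ n, Measurable fun q : Space d × Space d =>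
      ‖mollify (η n) u q.2 - mollify (η n) u q.1‖ₑ ^ 2 := fun n => by
    have hc := (contDiff_mollify (η n) hΩ u).continuous
    exact ((hc.comp continuous_snd).sub (hc.comp continuous_fst)).measurable.enorm.pow_const 2
  set F : ℕ → Space d × Space d → ℝ≥0∞ := fun n =>
    (W n).indicator fun q => ‖mollify (η n) u q.2 - mollify (η n) u q.1‖ₑ ^ 2 with hF
  have hFm : ∀ n, Measurable (F n) := fun n => (hcm n).indicator (hWm n)
  have hFint : ∀ n, ∫⁻ q, F n q ∂(volume.prod volume) ≤ A := by
    intro n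
    rw [hF, lintegral_indicator (hWm n), hW, ← Measure.prod_restrict,
      lintegral_prod _ (hcm n).aemeasurable]
    exact lintegral_mollify_sub_sq_le (η n) hΩ hG hTo hTΩ hs hT hdist (hθ0 n) (hθ1 n) (hη n)
  have hmem : ∀ {S : Set (Space d)}, IsOpen S → ∀ x ∈ S, ∀ᶠ n in atTop, x ∈ contract z (θ n) S := by
    intro S hS x hx
    have h1 : Tendsto (fun n => z + (θ n)⁻¹ • (x - z)) atTop (𝓝 (z + (1 : ℝ)⁻¹ • (x - z))) :=
      ((hθlim.inv₀ one_ne_zero).smul_const _).const_add z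
    rw [inv_one, one_smul, add_sub_cancel] at h1
    exact h1.eventually (hS.mem_nhds hx)
  -- The ball and the cell are open, so each pair of points eventually lies in the contracted sets
  -- and the integrands converge almost everywhere. Fatou's lemma then carries over the uniform
  -- bound.
  have hle : ∀ᵐ q ∂((volume : Measure (Space d)).prod volume),
      (ball z s ×ˢ T).indicator (fun q => ‖u q.2 - u q.1‖ₑ ^ 2) q
        ≤ liminf (fun n => F n q) atTop := by
    filter_upwards [Measure.quasiMeasurePreserving_fst.ae hae,
      Measure.quasiMeasurePreserving_snd.ae hae] with q h1 h2
    by_cases hq : q ∈ ball z s ×ˢ T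
    · rw [indicator_of_mem hq]
      rw [indicator_of_mem (hTΩ (hT.1 hq.1))] at h1
      rw [indicator_of_mem (hTΩ hq.2)] at h2
      have h3 : Tendsto (fun n => F n q) atTop (𝓝 (‖u q.2 - u q.1‖ₑ ^ 2)) := by
        refine ((ENNReal.continuous_pow 2).tendsto _ |>.comp (h2.sub h1).enorm).congr' ?_
        filter_upwards [hmem isOpen_ball q.1 hq.1, hmem hTo q.2 hq.2] with n h4 h5
        have h6 : q ∈ W n := ⟨h4, h5⟩
        simp only [hF, indicator_of_mem h6, Function.comp_apply]
      exact h3.liminf_eq.ge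
    · rw [indicator_of_notMem hq]
      exact zero_le
  have hum : Measurable fun q : Space d × Space d => ‖u q.2 - u q.1‖ₑ ^ 2 := by
    have h0 := (Lp.stronglyMeasurable u).measurable
    exact ((h0.comp measurable_snd).sub (h0.comp measurable_fst)).enorm.pow_const 2
  calc _ = ∫⁻ q, (ball z s ×ˢ T).indicator (fun q => ‖u q.2 - u q.1‖ₑ ^ 2) q
          ∂((volume : Measure (Space d)).prod volume) := by
        rw [lintegral_indicator (measurableSet_ball.prod hTm), ← Measure.prod_restrict,
          lintegral_prod _ hum.aemeasurable]
    _ ≤ ∫⁻ q, liminf (fun n => F n q) atTop ∂((volume : Measure (Space d)).prod volume) :=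
        lintegral_mono_ae hle
    _ ≤ liminf (fun n => ∫⁻ q, F n q ∂((volume : Measure (Space d)).prod volume)) atTop :=
        lintegral_liminf_le hFm
    _ ≤ A := by
        refine (liminf_le_liminf (Eventually.of_forall hFint)).trans ?_
        simp

/-- The Poincaré inequality on a cell that is star-shaped with respect to a ball. -/
lemma exists_poincare_cell (d : ℕ) {σ : ℝ} (hσ : 0 < σ) :
    ∃ C : ℝ, 0 < C ∧ ∀ (Ω : Set (Space d)), IsOpen Ω → ∀ (u : L2 Ω) (G : L2Vec Ω),
      IsWeakGradient u G → ∀ (T : Set (Space d)) (z : Space d) (h : ℝ), 0 < h → IsOpen T → T ⊆ Ω →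
        IsStarShaped z (σ * h) T → (∀ x ∈ T, ∀ y ∈ T, dist x y ≤ h) →
        ∃ c : ℝ, ∫ x in T, (u x - c) ^ 2 ≤ C * h ^ 2 * ∫ x in T, ‖G x‖ ^ 2 := by
  refine ⟨2 ^ d * (σ ^ d)⁻¹, by positivity, fun Ω hΩ u G hG T z h hh hTo hTΩ hT hdist => ?_⟩
  have hTm := hTo.measurableSet
  have hs : 0 < σ * h := by positivity
  have hzT : z ∈ T := hT.1 (mem_ball_self hs)
  have hTb : T ⊆ closedBall z h := fun x hx => hdist x hx z hzT
  have hTfin : volume T ≠ ⊤ := (isBounded_closedBall.subset hTb).measure_lt_top.ne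
  have hB0 : volume (ball z (σ * h)) ≠ 0 := (measure_ball_pos _ _ hs).ne'
  have hum : Measurable fun q : Space d × Space d => ‖u q.2 - u q.1‖ₑ ^ 2 := by
    have h0 := (Lp.stronglyMeasurable u).measurable
    exact ((h0.comp measurable_snd).sub (h0.comp measurable_fst)).enorm.pow_const 2
  -- Some y in the ball does at least as well as the average over the ball, and u(y) serves as the
  -- constant. Dividing by the volume of the ball produces the factor σ^(−d).
  obtain ⟨y, hy, hle⟩ := exists_le_setLAverage (μ := volume) hB0 measure_ball_lt_top.ne
    (f := fun y => ∫⁻ x in T, ‖u x - u y‖ₑ ^ 2) hum.lintegral_prod_right'.aemeasurable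
  refine ⟨u y, ?_⟩
  have hle2 := hle.trans ((setLAverage_eq _ _ _).trans_le (ENNReal.div_le_div_right
    (lintegral_sub_sq_le hΩ hG hTo hTΩ hs hT hdist) _))
  have hGint : Integrable (fun x => ‖G x‖ ^ 2) (volume.restrict T) :=
    ((Lp.memLp G).integrable_norm_pow (by norm_num)).mono_measure (Measure.restrict_mono hTΩ le_rfl)
  have hGeq : ∫⁻ x, gradSq G T x = ENNReal.ofReal (∫ x in T, ‖G x‖ ^ 2) := by
    rw [ofReal_integral_eq_lintegral_ofReal hGint (Eventually.of_forall fun _ => sq_nonneg _),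
      gradSq, lintegral_indicator hTm]
    refine lintegral_congr fun x => ?_
    rw [ENNReal.ofReal_pow (norm_nonneg _), ofReal_norm]
  have huint : Integrable (fun x => (u x - u y) ^ 2) (volume.restrict T) := by
    have hfin : IsFiniteMeasure (volume.restrict T) := ⟨by simpa using hTfin.lt_top⟩
    have h1 : MemLp (fun x => u x - u y) 2 (volume.restrict T) :=
      ((Lp.memLp u).mono_measure (Measure.restrict_mono hTΩ le_rfl)).sub (memLp_const _)
    exact h1.integrable_sq
  have hueq : ∫⁻ x in T, ‖u x - u y‖ₑ ^ 2 = ENNReal.ofReal (∫ x in T, (u x - u y) ^ 2) := by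
    rw [ofReal_integral_eq_lintegral_ofReal huint (Eventually.of_forall fun _ => sq_nonneg _)]
    refine lintegral_congr fun x => ?_
    rw [← sq_abs, ENNReal.ofReal_pow (abs_nonneg _), ← Real.norm_eq_abs, ofReal_norm]
  have hI0 : 0 ≤ ∫ x in T, ‖G x‖ ^ 2 := integral_nonneg fun _ => sq_nonneg _
  set I := ∫ x in T, ‖G x‖ ^ 2
  rw [hueq, hGeq] at hle2
  have hvT : volume T = ENNReal.ofReal (volume.real T) := (ofReal_measureReal hTfin).symm
  have hvB : volume (ball z (σ * h)) = ENNReal.ofReal ((σ * h) ^ d * unitVol d) := by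
    rw [Measure.addHaar_ball_of_pos _ _ hs, finrank_euclideanSpace_fin,
      ENNReal.ofReal_mul (by positivity), unitVol, ofReal_measureReal measure_ball_lt_top.ne]
  have hω := unitVol_pos d
  have h2d : (2 : ℝ≥0∞) ^ d = ENNReal.ofReal (2 ^ d) := by
    rw [ENNReal.ofReal_pow two_pos.le]; simp
  rw [hvT, hvB, h2d, ← ENNReal.ofReal_mul (by positivity), ← ENNReal.ofReal_mul (by positivity),
    ← ENNReal.ofReal_mul (by positivity), ← ENNReal.ofReal_div_of_pos (by positivity),
    ENNReal.ofReal_le_ofReal_iff (by positivity)] at hle2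
  refine hle2.trans ?_
  rw [div_le_iff₀ (by positivity)]
  calc h ^ 2 * (2 ^ d * volume.real T * I) ≤ h ^ 2 * (2 ^ d * (unitVol d * h ^ d) * I) := by
        have := volume_real_le hh hTb
        gcongr
    _ = _ := by
        rw [mul_pow]
        field_simp

end Forchheimer

/-! ### Estimates on the whole mesh, uniform in its size -/

namespace Forchheimer

open Metric

variable {d : ℕ}

/-- Write y^q = y · y^(q − 1) and bound the second factor by the same power of the sum. It adds up
cell estimates whatever the number of cells. -/
lemma sum_rpow_le_rpow_sum {ι : Type*} (s : Finset ι) {x : ι → ℝ} (hx : ∀ i ∈ s, 0 ≤ x i) {q : ℝ}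
    (hq : 1 ≤ q) : ∑ i ∈ s, x i ^ q ≤ (∑ i ∈ s, x i) ^ q := by
  have hS : 0 ≤ ∑ i ∈ s, x i := Finset.sum_nonneg hx
  have e : ∀ y : ℝ, 0 ≤ y → y ^ q = y * y ^ (q - 1) := fun y hy => by
    have := Real.rpow_one_add' hy (y := q - 1) (by linarith)
    rwa [add_sub_cancel] at this
  rw [e _ hS, Finset.sum_mul]
  refine Finset.sum_le_sum fun i hi => ?_
  rw [e _ (hx i hi)]
  exact mul_le_mul_of_nonneg_left (Real.rpow_le_rpow (hx i hi) (Finset.single_le_sum hx hi)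
    (by linarith)) (hx i hi)

namespace Mesh

variable {Ω : Set (Space d)} {σ h : ℝ} (M : Mesh Ω σ h) {r : ℕ}

/-- The centre of a cell. -/
noncomputable def center (T : Fin M.card) : Space d := (M.star T).choose

lemma isStarShaped (T : Fin M.card) : IsStarShaped (M.center T) (σ * h) (M.cell T) :=
  (M.star T).choose_spec

lemma cell_subset_closedBall (hσ : 0 < σ) (hh : 0 < h) (T : Fin M.card) :
    M.cell T ⊆ closedBall (M.center T) h := fun x hx =>
  M.dist_le T x hx _ ((M.isStarShaped T).1 (mem_ball_self (by positivity)))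

lemma measurableSet_cell (T : Fin M.card) : MeasurableSet (M.cell T) :=
  (M.isOpen_cell T).measurableSet

lemma eval_of_mem (v : M.PolySpace r) {T : Fin M.card} {x : Space d} (hx : x ∈ M.cell T) :
    M.eval v x = polyEval (v T : MvPolynomial (Fin d) ℝ) x := by
  rw [eval, Finset.sum_eq_single T, indicator_of_mem hx]
  · intro T' _ hne
    exact indicator_of_notMem (fun h' => (M.disjoint_cell hne).le_bot ⟨h', hx⟩) _
  · simp

lemma grad_of_mem (v : M.PolySpace r) {T : Fin M.card} {x : Space d} (hx : x ∈ M.cell T) :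
    M.grad v x = polyGrad (v T : MvPolynomial (Fin d) ℝ) x := by
  rw [grad, Finset.sum_eq_single T, indicator_of_mem hx]
  · intro T' _ hne
    exact indicator_of_notMem (fun h' => (M.disjoint_cell hne).le_bot ⟨h', hx⟩) _
  · simp

lemma iUnion_cell_ae_eq : (⋃ T, M.cell T) =ᵐ[volume] Ω := by
  refine Filter.EventuallyLE.antisymm (iUnion_subset M.cell_subset).eventuallyLE ?_
  exact ae_le_set.2 M.cover

lemma integrableOn_of_cells {E : Type*} [NormedAddCommGroup E] {f : Space d → E}
    (hf : ∀ T, IntegrableOn f (M.cell T) volume) : Integrable f (volume.restrict Ω) := by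
  have h1 : IntegrableOn f (⋃ T, M.cell T) volume := integrableOn_finite_iUnion.2 hf
  rwa [IntegrableOn, Measure.restrict_congr_set M.iUnion_cell_ae_eq] at h1

lemma integral_eq_sum {f : Space d → ℝ} (hf : ∀ T, IntegrableOn f (M.cell T) volume) :
    ∫ x in Ω, f x = ∑ T, ∫ x in M.cell T, f x := by
  rw [← setIntegral_congr_set M.iUnion_cell_ae_eq]
  exact integral_iUnion_fintype M.measurableSet_cell M.disjoint_cell hf

/-- Integrals over `Ω` of functions which agree with continuous functions on the cells. -/
lemma integral_eq_sum_of_eq {f : Space d → ℝ} {g : Fin M.card → Space d → ℝ}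
    (hg : ∀ T, Continuous (g T)) (hfg : ∀ T, ∀ x ∈ M.cell T, f x = g T x) :
    Integrable f (volume.restrict Ω) ∧ ∫ x in Ω, f x = ∑ T, ∫ x in M.cell T, g T x := by
  have hint : ∀ T, IntegrableOn f (M.cell T) volume := fun T =>
    (integrableOn_of_continuous (hg T) (M.isBounded_cell T) (M.measurableSet_cell T)).congr_fun
      (fun x hx => (hfg T x hx).symm) (M.measurableSet_cell T)
  refine ⟨M.integrableOn_of_cells hint, ?_⟩
  rw [M.integral_eq_sum hint]
  exact Finset.sum_congr rfl fun T _ => setIntegral_congr_fun (M.measurableSet_cell T) (hfg T)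

lemma memLp_grad (v : M.PolySpace r) : MemLp (M.grad v) 2 (volume.restrict Ω) := by
  refine memLp_finsetSum _ fun T _ => ?_
  rw [memLp_indicator_iff_restrict (M.measurableSet_cell T)]
  exact (memLp_restrict_of_continuous (continuous_polyGrad _) (M.isBounded_cell T)
    (M.measurableSet_cell T) 2).mono_measure
      (Measure.restrict_mono_measure Measure.restrict_le_self _)

lemma grad_add (v w : M.PolySpace r) : M.grad (v + w) = M.grad v + M.grad w := by
  funext x
  simp only [grad, Pi.add_apply, ← Finset.sum_add_distrib]
  refine Finset.sum_congr rfl fun T _ => ?_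
  by_cases hx : x ∈ M.cell T <;> simp [hx, polyGrad_add]

lemma grad_smul (c : ℝ) (v : M.PolySpace r) : M.grad (c • v) = c • M.grad v := by
  funext x
  simp only [grad, Pi.smul_apply, Finset.smul_sum]
  refine Finset.sum_congr rfl fun T _ => ?_
  by_cases hx : x ∈ M.cell T <;> simp [hx, polyGrad_smul]

/-- The elementwise gradient of a piecewise polynomial as an element of `(L²(Ω))ᵈ`. -/
noncomputable def gradL2 (r : ℕ) : M.PolySpace r →ₗ[ℝ] L2Vec Ω where
  toFun v := (M.memLp_grad v).toLp (M.grad v)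
  map_add' v w := by
    rw [← MemLp.toLp_add]
    congr 1
    exact M.grad_add v w
  map_smul' c v := by
    rw [RingHom.id_apply, ← MemLp.toLp_const_smul]
    congr 1
    exact M.grad_smul c v

lemma coeFn_toL2 (v : M.PolySpace r) : M.toL2 r v =ᵐ[volume.restrict Ω] M.eval v :=
  (M.memLp_eval v).coeFn_toLp

lemma coeFn_gradL2 (v : M.PolySpace r) : M.gradL2 r v =ᵐ[volume.restrict Ω] M.grad v :=
  (M.memLp_grad v).coeFn_toLp

lemma norm_toL2_sq (v : M.PolySpace r) :
    ‖M.toL2 r v‖ ^ 2 = ∑ T, ∫ x in M.cell T, polyEval (v T : MvPolynomial (Fin d) ℝ) x ^ 2 := by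
  rw [← (M.integral_eq_sum_of_eq (f := fun x => M.eval v x ^ 2)
    (g := fun T x => polyEval (v T : MvPolynomial (Fin d) ℝ) x ^ 2)
    (fun T => (continuous_polyEval (v T : MvPolynomial (Fin d) ℝ)).pow 2)
    fun T x hx => by rw [M.eval_of_mem v hx]).2, ← real_inner_self_eq_norm_sq, L2.inner_def]
  refine integral_congr_ae ?_
  filter_upwards [M.coeFn_toL2 v] with x hx
  rw [hx, real_inner_self_eq_norm_sq, Real.norm_eq_abs, sq_abs]

lemma norm_gradL2_sq (v : M.PolySpace r) :
    ‖M.gradL2 r v‖ ^ 2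
      = ∑ T, ∫ x in M.cell T, ‖polyGrad (v T : MvPolynomial (Fin d) ℝ) x‖ ^ 2 := by
  rw [← (M.integral_eq_sum_of_eq (f := fun x => ‖M.grad v x‖ ^ 2)
    (g := fun T x => ‖polyGrad (v T : MvPolynomial (Fin d) ℝ) x‖ ^ 2)
    (fun T => (continuous_polyGrad (v T : MvPolynomial (Fin d) ℝ)).norm.pow 2)
    fun T x hx => by rw [M.grad_of_mem v hx]).2, ← real_inner_self_eq_norm_sq, L2.inner_def]
  refine integral_congr_ae ?_
  filter_upwards [M.coeFn_gradL2 v] with x hx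
  rw [hx, real_inner_self_eq_norm_sq]

/-- The piecewise constant function with the values `c T`. -/
noncomputable def piecewiseConst (r : ℕ) (c : Fin M.card → ℝ) : M.PolySpace r := fun T =>
  ⟨MvPolynomial.C (c T), by simp [MvPolynomial.mem_restrictTotalDegree]⟩

lemma gradL2_piecewiseConst (c : Fin M.card → ℝ) : M.gradL2 r (M.piecewiseConst r c) = 0 := by
  rw [← norm_eq_zero, ← sq_eq_zero_iff, norm_gradL2_sq]
  refine Finset.sum_eq_zero fun T _ => ?_
  have e : ∀ x : Space d, polyGrad (MvPolynomial.C (c T)) x = 0 := fun x => by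
    ext i; simp [polyGrad, polyEval]
  simp [piecewiseConst, e]

lemma toL2_proj (w : L2 Ω) : M.toL2 r (M.proj r w) = (M.toL2 r).range.starProjection w := by
  refine (Submodule.eq_starProjection_of_mem_of_inner_eq_zero
    (LinearMap.mem_range_self (M.toL2 r) _) ?_).symm
  rintro _ ⟨v, rfl⟩
  rw [inner_sub_left, M.proj_spec, sub_self]

lemma norm_toL2_proj_le (w : L2 Ω) : ‖M.toL2 r (M.proj r w)‖ ≤ ‖w‖ := by
  rw [toL2_proj]
  exact Submodule.norm_starProjection_apply_le _ _

lemma totalDegree_le (v : M.PolySpace r) (T : Fin M.card) :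
    (v T : MvPolynomial (Fin d) ℝ).totalDegree ≤ r :=
  (MvPolynomial.mem_restrictTotalDegree _ _ _).1 (v T).2

end Mesh

/-- The inverse inequality on `W_h`. -/
lemma exists_norm_gradL2_le (d r : ℕ) {σ : ℝ} (hσ : 0 < σ) :
    ∃ C : ℝ, 0 < C ∧ ∀ (Ω : Set (Space d)) (h : ℝ), 0 < h → ∀ (M : Mesh Ω σ h) (v : M.PolySpace r),
      ‖M.gradL2 r v‖ ^ 2 ≤ C * (h ^ 2)⁻¹ * ‖M.toL2 r v‖ ^ 2 := by
  obtain ⟨C, hC, hb⟩ := exists_inverse_bound d r hσ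
  refine ⟨C, hC, fun Ω h hh M v => ?_⟩
  rw [M.norm_gradL2_sq, M.norm_toL2_sq, Finset.mul_sum]
  exact Finset.sum_le_sum fun T _ => hb _ (M.totalDegree_le v T) (M.center T) h _ hh
    (M.isOpen_cell T) (M.isStarShaped T).1 (M.cell_subset_closedBall hσ hh T)

/-- The `L²`-projection onto `W_h` is stable in `H¹`. -/
lemma exists_norm_gradL2_proj_le (d r : ℕ) {σ : ℝ} (hσ : 0 < σ) :
    ∃ C : ℝ, 0 < C ∧ ∀ (Ω : Set (Space d)), IsOpen Ω → ∀ (h : ℝ), 0 < h →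
      ∀ (M : Mesh Ω σ h) (φ : H1 Ω), ‖M.gradL2 r (M.proj r (H1.fn φ))‖ ^ 2 ≤ C * ‖φ‖ ^ 2 := by
  obtain ⟨C, hC, hinv⟩ := exists_norm_gradL2_le d r hσ
  obtain ⟨K, hK, hP⟩ := exists_poincare_cell d hσ
  refine ⟨C * K, by positivity, fun Ω hΩ h hh M φ => ?_⟩
  set u : L2 Ω := H1.fn φ
  set G : L2Vec Ω := (φ : WithLp 2 (L2 Ω × L2Vec Ω)).snd
  have hG : IsWeakGradient u G := φ.2
  have hcell := fun T => hP Ω hΩ u G hG (M.cell T) (M.center T) h hh (M.isOpen_cell T)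
    (M.cell_subset T) (M.isStarShaped T) (M.dist_le T)
  choose c hc using hcell
  set q := M.piecewiseConst r c with hq
  have hGint : Integrable (fun x => ‖G x‖ ^ 2) (volume.restrict Ω) :=
    (Lp.memLp G).integrable_norm_pow (by norm_num)
  have hGT : ∀ T, IntegrableOn (fun x => ‖G x‖ ^ 2) (M.cell T) volume := fun T =>
    hGint.mono_measure (Measure.restrict_mono (M.cell_subset T) le_rfl)
  have hGn : ‖G‖ ^ 2 = ∑ T, ∫ x in M.cell T, ‖G x‖ ^ 2 := by
    rw [← M.integral_eq_sum hGT, ← real_inner_self_eq_norm_sq, L2.inner_def]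
    simp only [real_inner_self_eq_norm_sq]
  have hdint : Integrable (fun x => (u x - M.eval q x) ^ 2) (volume.restrict Ω) :=
    ((Lp.memLp u).sub (M.memLp_eval q)).integrable_sq
  have hdn : ‖u - M.toL2 r q‖ ^ 2 = ∑ T, ∫ x in M.cell T, (u x - c T) ^ 2 := by
    have h1 : ‖u - M.toL2 r q‖ ^ 2 = ∫ x in Ω, (u x - M.eval q x) ^ 2 := by
      rw [← real_inner_self_eq_norm_sq, L2.inner_def]
      refine integral_congr_ae ?_
      filter_upwards [Lp.coeFn_sub u (M.toL2 r q), M.coeFn_toL2 q] with x hx1 hx2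
      rw [hx1, Pi.sub_apply, hx2, real_inner_self_eq_norm_sq, Real.norm_eq_abs, sq_abs]
    rw [h1, M.integral_eq_sum fun T =>
      hdint.mono_measure (Measure.restrict_mono (M.cell_subset T) le_rfl)]
    refine Finset.sum_congr rfl fun T _ => setIntegral_congr_fun (M.measurableSet_cell T) ?_
    intro x hx
    simp only [M.eval_of_mem q hx]
    simp [hq, Mesh.piecewiseConst, polyEval]
  have h1 : ‖u - M.toL2 r q‖ ^ 2 ≤ K * h ^ 2 * ‖G‖ ^ 2 := by
    rw [hdn, hGn, Finset.mul_sum]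
    exact Finset.sum_le_sum fun T _ => hc T
  -- The piecewise constant `q` has no gradient and is fixed by π, so the inverse inequality can be
  -- applied to π(u − q). Its factor h⁻² cancels the h² from the Poincaré inequality for u − q on
  -- the cells.
  have h2 : M.gradL2 r (M.proj r u) = M.gradL2 r (M.proj r u - q) := by
    rw [map_sub, hq, M.gradL2_piecewiseConst, sub_zero]
  have h3 : ‖M.toL2 r (M.proj r u - q)‖ ≤ ‖u - M.toL2 r q‖ := by
    have e : M.toL2 r (M.proj r u - q) = (M.toL2 r).range.starProjection (u - M.toL2 r q) := by
      rw [map_sub, map_sub, M.toL2_proj,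
        (Submodule.starProjection_eq_self_iff (v := M.toL2 r q)).2 (LinearMap.mem_range_self (M.toL2 r) q)]
    rw [e]
    exact Submodule.norm_starProjection_apply_le _ _
  have h4 : ‖G‖ ^ 2 ≤ ‖φ‖ ^ 2 := by
    have : ‖φ‖ ^ 2 = ‖u‖ ^ 2 + ‖G‖ ^ 2 := WithLp.prod_norm_sq_eq_of_L2 _
    linarith [sq_nonneg ‖u‖]
  have h5 := hinv Ω h hh M (M.proj r u - q)
  rw [h2]
  calc _ ≤ _ := h5
    _ ≤ C * (h ^ 2)⁻¹ * (K * h ^ 2 * ‖φ‖ ^ 2) := by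
        have h6 := (pow_le_pow_left₀ (norm_nonneg _) h3 2).trans h1
        have h7 : K * h ^ 2 * ‖G‖ ^ 2 ≤ K * h ^ 2 * ‖φ‖ ^ 2 := by gcongr
        exact mul_le_mul_of_nonneg_left (h6.trans h7) (by positivity)
    _ = _ := by field_simp

/-- Ω contains a ball of radius σh, so its diameter limits h. This supplies a radius R that makes
the oscillation bound uniform over all meshes. -/
lemma Mesh.size_le {Ω : Set (Space d)} {σ h D : ℝ} (hd : 0 < d) (hσ : 0 < σ) (hh : 0 < h)
    (hD : ∀ x ∈ Ω, ∀ y ∈ Ω, dist x y ≤ D) (M : Mesh Ω σ h) (T : Fin M.card) : h ≤ 2 * D / σ := by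
  have hs : 0 < σ * h := by positivity
  set e : Space d := EuclideanSpace.single ⟨0, hd⟩ (σ * h / 2) with he
  have hen : ‖e‖ = σ * h / 2 := by
    rw [he, PiLp.norm_single, Real.norm_of_nonneg (by positivity)]
  have hsub := (M.isStarShaped T).1.trans (M.cell_subset T)
  have h1 := hD (M.center T + e) (hsub (by
    rw [mem_ball, dist_eq_norm, add_sub_cancel_left, hen]; linarith)) (M.center T)
    (hsub (mem_ball_self hs))
  rw [dist_eq_norm, add_sub_cancel_left, hen] at h1
  rw [le_div_iff₀ hσ]
  linarith

/-- The broken Sobolev-Poincaré inequality on `W_h`. -/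
lemma exists_norm_sub_piecewiseConst_le {d : ℕ} (hd : 0 < d) (r : ℕ) {σ β : ℝ} (hσ : 0 < σ)
    (hβ : 1 < β) (hβ2 : β ≤ 2) (hdeg : 2 * d / β ≤ d + 2) {Ω : Set (Space d)}
    (hΩ : Bornology.IsBounded Ω) :
    ∃ C : ℝ, 0 < C ∧ ∀ (h : ℝ), 0 < h → ∀ (M : Mesh Ω σ h) (v : M.PolySpace r),
      Integrable (fun x => ‖M.grad v x‖ ^ β) (volume.restrict Ω) ∧
      ∃ c : Fin M.card → ℝ, ‖M.toL2 r v - M.toL2 r (M.piecewiseConst r c)‖ ^ 2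
        ≤ C * (∫ x in Ω, ‖M.grad v x‖ ^ β) ^ (2 / β) := by
  obtain ⟨D, hD⟩ := Metric.isBounded_iff.1 hΩ
  have hβ0 : 0 < β := by linarith
  obtain ⟨C, hC, hb⟩ := exists_oscillation_bound d r (R := max (2 * D / σ) 1) hσ hβ hdeg
    (lt_max_of_lt_right one_pos)
  refine ⟨C, hC, fun h hh M v => ?_⟩
  obtain ⟨hint, hsum⟩ := M.integral_eq_sum_of_eq (f := fun x => ‖M.grad v x‖ ^ β)
    (g := fun T x => ‖polyGrad (v T : MvPolynomial (Fin d) ℝ) x‖ ^ β)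
    (fun T => (continuous_polyGrad _).norm.rpow_const fun _ => Or.inr hβ0.le)
    (fun T x hx => by rw [M.grad_of_mem v hx])
  refine ⟨hint, fun T => polyEval (v T : MvPolynomial (Fin d) ℝ) (M.center T), ?_⟩
  rw [← map_sub, M.norm_toL2_sq, hsum]
  -- On each cell the constant is the value at the centre. The cell bounds carry the exponent 2/β ≥
  -- 1, so their sum is at most the power of the sum.
  have h1 := sum_rpow_le_rpow_sum Finset.univ
    (x := fun T => ∫ x in M.cell T, ‖polyGrad (v T : MvPolynomial (Fin d) ℝ) x‖ ^ β)
    (fun T _ => integral_nonneg fun x => Real.rpow_nonneg (norm_nonneg _) _) (q := 2 / β)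
    ((one_le_div hβ0).2 hβ2)
  refine le_trans ?_ (mul_le_mul_of_nonneg_left h1 hC.le)
  rw [Finset.mul_sum]
  refine Finset.sum_le_sum fun T _ => ?_
  have h2 := hb _ (M.totalDegree_le v T) (M.center T) h (M.cell T) hh
    ((M.size_le hd hσ hh (fun x hx y hy => hD hx hy) T).trans (le_max_left _ _)) (M.isOpen_cell T)
    (M.isStarShaped T).1 (M.cell_subset_closedBall hσ hh T)
  refine le_trans (le_of_eq ?_) h2
  refine integral_congr_ae (Filter.Eventually.of_forall fun x => ?_)
  simp [Mesh.piecewiseConst, polyEval]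

end Forchheimer

namespace Forchheimer

/-! ### The nonlinearity on `L²` -/

namespace GenPoly

variable (P : GenPoly) {α E : Type*} [MeasurableSpace α] {μ : Measure α}
  [NormedAddCommGroup E] [InnerProductSpace ℝ E]

/-- The vector field `p ↦ K(|p|) p` acting on `L²`. -/
noncomputable def fieldLp (G : Lp E 2 μ) : Lp E 2 μ := P.field_lipschitz.compLp P.field_zero G

/-- The potential of `fieldLp`. -/
noncomputable def potentialLp (G : Lp E 2 μ) : ℝ := ∫ x, P.potential (G x) ∂μ

lemma coeFn_fieldLp (G : Lp E 2 μ) : P.fieldLp G =ᵐ[μ] fun x => P.field (G x) :=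
  P.field_lipschitz.coeFn_compLp P.field_zero G

lemma inner_fieldLp (G H : Lp E 2 μ) :
    inner ℝ (P.fieldLp G) H = ∫ x, inner ℝ (P.field (G x)) (H x) ∂μ := by
  rw [L2.inner_def]
  refine integral_congr_ae ?_
  filter_upwards [P.coeFn_fieldLp G] with x hx
  rw [hx]

lemma integrable_inner_field (G H : Lp E 2 μ) :
    Integrable (fun x => inner ℝ (P.field (G x)) (H x)) μ := by
  refine (L2.integrable_inner (𝕜 := ℝ) (P.fieldLp G) H).congr ?_
  filter_upwards [P.coeFn_fieldLp G] with x hx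
  rw [hx]

lemma integrable_potential (G : Lp E 2 μ) : Integrable (fun x => P.potential (G x)) μ := by
  refine (P.integrable_inner_field G G).mono'
    (P.continuous_potential.comp_aestronglyMeasurable (Lp.aestronglyMeasurable G)) ?_
  refine Filter.Eventually.of_forall fun x => ?_
  rw [Real.norm_of_nonneg (P.potential_nonneg _), inner_field_self]
  exact P.potential_le _

lemma fieldLp_zero : P.fieldLp (0 : Lp E 2 μ) = 0 := by
  refine Lp.ext ?_
  filter_upwards [P.coeFn_fieldLp (0 : Lp E 2 μ), Lp.coeFn_zero E 2 μ] with x h1 h2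
  rw [h1, h2, Pi.zero_apply, field_zero]

lemma fieldLp_cocoercive (G H : Lp E 2 μ) :
    P.coeff 0 * ‖P.fieldLp G - P.fieldLp H‖ ^ 2 ≤ inner ℝ (P.fieldLp G - P.fieldLp H) (G - H) := by
  rw [← real_inner_self_eq_norm_sq, L2.inner_def, L2.inner_def, ← integral_const_mul]
  refine integral_mono_ae ((L2.integrable_inner _ _).const_mul _) (L2.integrable_inner _ _) ?_
  filter_upwards [Lp.coeFn_sub (P.fieldLp G) (P.fieldLp H), Lp.coeFn_sub G H, P.coeFn_fieldLp G,
    P.coeFn_fieldLp H] with x h1 h2 h3 h4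
  simp only [h1, h2, Pi.sub_apply, h3, h4, real_inner_self_eq_norm_sq]
  exact P.field_cocoercive _ _

lemma potentialLp_zero {E : Type*} [NormedAddCommGroup E] : P.potentialLp (0 : Lp E 2 μ) = 0 := by
  refine integral_eq_zero_of_ae ?_
  filter_upwards [Lp.coeFn_zero E 2 μ] with x hx
  rw [hx, Pi.zero_apply, potential_zero, Pi.zero_apply]

lemma potentialLp_nonneg {E : Type*} [NormedAddCommGroup E] (G : Lp E 2 μ) : 0 ≤ P.potentialLp G :=
  integral_nonneg fun _ => P.potential_nonneg _

lemma potentialLp_sub_le (G H : Lp E 2 μ) :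
    P.potentialLp H - P.potentialLp G ≤ inner ℝ (P.fieldLp H) (H - G) := by
  rw [potentialLp, potentialLp,
    ← integral_sub (P.integrable_potential H) (P.integrable_potential G), inner_fieldLp]
  refine integral_mono_ae ((P.integrable_potential H).sub (P.integrable_potential G))
    (P.integrable_inner_field _ _) ?_
  filter_upwards [Lp.coeFn_sub H G] with x hx
  rw [hx]
  exact P.potential_sub_le _ _

end GenPoly

/-! ### The finite element spaces as monotone systems -/

variable {d : ℕ}

namespace Mesh

variable {Ω : Set (Space d)} {σ h : ℝ} (M : Mesh Ω σ h) {r : ℕ}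

/-- The functions of `W_h` with vanishing elementwise gradient. -/
noncomputable def gradKer (r : ℕ) : Submodule ℝ (L2 Ω) := (M.gradL2 r).ker.map (M.toL2 r)

instance (r : ℕ) : FiniteDimensional ℝ (M.gradKer r) := by
  unfold gradKer; infer_instance

/-- The inverse inequality applied to v − w. It is needed because `proj` selects polynomials by
choice, so its linearity is visible only in L². -/
lemma gradL2_eq_of_toL2_eq (hσ : 0 < σ) (hh : 0 < h) {v w : M.PolySpace r}
    (hvw : M.toL2 r v = M.toL2 r w) : M.gradL2 r v = M.gradL2 r w := by
  obtain ⟨C, -, hb⟩ := exists_norm_gradL2_le d r hσ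
  have h1 := hb Ω h hh M (v - w)
  rw [map_sub (M.toL2 r), hvw, sub_self, norm_zero, zero_pow two_ne_zero, mul_zero, map_sub] at h1
  have h2 : ‖M.gradL2 r v - M.gradL2 r w‖ = 0 := by
    have := sq_nonneg ‖M.gradL2 r v - M.gradL2 r w‖
    exact pow_eq_zero_iff two_ne_zero |>.1 (le_antisymm h1 this)
  exact sub_eq_zero.1 (norm_eq_zero.1 h2)

/-- The elementwise gradient of the projection onto `W_h`, as a linear map. -/
noncomputable def gradProjLinear (hσ : 0 < σ) (hh : 0 < h) (r : ℕ) : L2 Ω →ₗ[ℝ] L2Vec Ω where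
  toFun w := M.gradL2 r (M.proj r w)
  map_add' v w := by
    rw [← map_add]
    refine M.gradL2_eq_of_toL2_eq hσ hh ?_
    simp only [map_add, toL2_proj]
  map_smul' c w := by
    rw [RingHom.id_apply, ← map_smul]
    refine M.gradL2_eq_of_toL2_eq hσ hh ?_
    simp only [map_smul, toL2_proj]

lemma exists_norm_gradProjLinear_le (hσ : 0 < σ) (hh : 0 < h) (r : ℕ) :
    ∃ C : ℝ, ∀ w, ‖M.gradProjLinear hσ hh r w‖ ≤ C * ‖w‖ := by
  obtain ⟨C, hC, hb⟩ := exists_norm_gradL2_le d r hσ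
  refine ⟨√(C * (h ^ 2)⁻¹), fun w => ?_⟩
  refine (pow_le_pow_iff_left₀ (norm_nonneg _) (by positivity) two_ne_zero).1 ?_
  rw [mul_pow, Real.sq_sqrt (by positivity)]
  refine (hb Ω h hh M (M.proj r w)).trans ?_
  exact mul_le_mul_of_nonneg_left (pow_le_pow_left₀ (norm_nonneg _) (M.norm_toL2_proj_le w) 2)
    (by positivity)

/-- The elementwise gradient of the projection onto `W_h`. -/
noncomputable def gradProj (hσ : 0 < σ) (hh : 0 < h) (r : ℕ) : L2 Ω →L[ℝ] L2Vec Ω :=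
  (M.gradProjLinear hσ hh r).mkContinuousOfExistsBound (M.exists_norm_gradProjLinear_le hσ hh r)

lemma gradProj_apply (hσ : 0 < σ) (hh : 0 < h) (w : L2 Ω) :
    M.gradProj hσ hh r w = M.gradL2 r (M.proj r w) := rfl

lemma gradProj_toL2 (hσ : 0 < σ) (hh : 0 < h) (v : M.PolySpace r) :
    M.gradProj hσ hh r (M.toL2 r v) = M.gradL2 r v := by
  rw [gradProj_apply]
  refine M.gradL2_eq_of_toL2_eq hσ hh ?_
  rw [toL2_proj]
  exact Submodule.starProjection_eq_self_iff.2 (LinearMap.mem_range_self _ _)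

lemma gradProj_of_mem_gradKer (hσ : 0 < σ) (hh : 0 < h) {w : L2 Ω} (hw : w ∈ M.gradKer r) :
    M.gradProj hσ hh r w = 0 := by
  obtain ⟨v, hv, rfl⟩ := hw
  rw [gradProj_toL2]
  exact hv

/-- Piecewise constants have zero gradient, so the projection annihilates them, and it does not
increase norms. -/
lemma norm_starProjection_gradKer_le (v : M.PolySpace r) (c : Fin M.card → ℝ) :
    ‖(M.gradKer r)ᗮ.starProjection (M.toL2 r v)‖
      ≤ ‖M.toL2 r v - M.toL2 r (M.piecewiseConst r c)‖ := by
  have hc : M.toL2 r (M.piecewiseConst r c) ∈ M.gradKer r :=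
    ⟨_, M.gradL2_piecewiseConst c, rfl⟩
  have h0 : (M.gradKer r)ᗮ.starProjection (M.toL2 r (M.piecewiseConst r c)) = 0 :=
    Submodule.starProjection_orthogonal_apply_eq_zero hc
  have := Submodule.norm_starProjection_apply_le (M.gradKer r)ᗮ
    (M.toL2 r v - M.toL2 r (M.piecewiseConst r c))
  rwa [map_sub, h0, sub_zero] at this

end Mesh

/-- The underlying function as a continuous linear map. -/
noncomputable def H1.fnL (Ω : Set (Space d)) : H1 Ω →L[ℝ] L2 Ω :=
  (WithLp.fstL 2 ℝ (L2 Ω) (L2Vec Ω)).comp (H1 Ω).subtypeL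

end Forchheimer

/-! ### The dissipation controls Q, and the semidiscrete problem as an abstract equation -/

namespace Forchheimer

variable {d : ℕ}

lemma add_rpow_le_two_rpow_mul {a b β : ℝ} (ha : 0 ≤ a) (hb : 0 ≤ b) (hβ : 0 ≤ β) :
    (a + b) ^ β ≤ 2 ^ β * (a ^ β + b ^ β) := by
  have hm : 0 ≤ max a b := le_max_of_le_left ha
  have h1 : max a b ^ β ≤ a ^ β + b ^ β := by
    rcases max_cases a b with ⟨h, -⟩ | ⟨h, -⟩ <;> rw [h]
    · linarith [Real.rpow_nonneg hb β]
    · linarith [Real.rpow_nonneg ha β]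
  calc (a + b) ^ β ≤ (2 * max a b) ^ β :=
        Real.rpow_le_rpow (add_nonneg ha hb)
          (by linarith [le_max_left a b, le_max_right a b]) hβ
    _ = 2 ^ β * max a b ^ β := Real.mul_rpow two_pos.le hm
    _ ≤ _ := mul_le_mul_of_nonneg_left h1 (by positivity)

lemma rpow_le_one_add_sq {b β : ℝ} (hb : 0 ≤ b) (hβ : 0 ≤ β) (hβ2 : β ≤ 2) :
    b ^ β ≤ 1 + b ^ 2 := by
  rcases le_total b 1 with h | h
  · linarith [Real.rpow_le_one hb h hβ, sq_nonneg b]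
  · have := Real.rpow_le_rpow_of_exponent_le h hβ2
    rw [Real.rpow_two] at this
    linarith

/-- With β = 2 − a this rearranges a (d + 2) ≤ 4; in this form it is the nonnegativity of the
leftover exponent of h. -/
lemma GenPoly.degree_condition (P : GenPoly) (hdeg : P.a ≤ 4 / ((d : ℝ) + 2)) :
    2 * d / P.β ≤ d + 2 := by
  have h0 : (0 : ℝ) < d + 2 := by positivity
  have h1 := P.one_lt_β
  rw [le_div_iff₀ h0] at hdeg
  rw [div_le_iff₀ (by linarith), GenPoly.β]
  nlinarith

/-- The Poincaré inequality on `W_h` in terms of the dissipation. -/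
lemma exists_poincare_dissipation (P : GenPoly) (hd : 0 < d) (hdeg : P.a ≤ 4 / ((d : ℝ) + 2))
    {Ω : Set (Space d)} (hΩ : Bornology.IsBounded Ω) (r : ℕ) {σ : ℝ} (hσ : 0 < σ) :
    ∃ C : ℝ, 0 < C ∧ ∀ h, 0 < h → ∀ (M : Mesh Ω σ h) (v : M.PolySpace r) (p : L2Vec Ω),
      ‖(M.gradKer r)ᗮ.starProjection (M.toL2 r v)‖ ^ P.β
        ≤ C * (1 + inner ℝ (P.fieldLp p) p + ‖p - M.gradL2 r v‖ ^ 2) := by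
  have hβ1 := P.one_lt_β
  have hβ2 := P.β_lt_two.le
  have hβ0 : 0 < P.β := by linarith
  obtain ⟨Cp, hCp, hP⟩ := exists_norm_sub_piecewiseConst_le hd r hσ hβ1 hβ2
    (P.degree_condition hdeg) hΩ
  obtain ⟨C', hC', hg⟩ := P.exists_rpow_le
  have hfin : IsFiniteMeasure (volume.restrict Ω) := ⟨by
    rw [Measure.restrict_apply_univ]; exact hΩ.measure_lt_top⟩
  set m := (volume.restrict Ω).real univ
  have hm : 0 ≤ m := measureReal_nonneg
  refine ⟨Cp ^ (P.β / 2) * (2 ^ P.β * ((C' + 1) * (m + 1))), by positivity, fun h hh M v p => ?_⟩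
  obtain ⟨hint, c, hc⟩ := hP h hh M v
  set I := ∫ x in Ω, ‖M.grad v x‖ ^ P.β
  have hI : 0 ≤ I := integral_nonneg fun x => Real.rpow_nonneg (norm_nonneg _) _
  set n := ‖(M.gradKer r)ᗮ.starProjection (M.toL2 r v)‖
  have hn : 0 ≤ n := norm_nonneg _
  have h1 : n ^ P.β ≤ Cp ^ (P.β / 2) * I := by
    have h2 : n ^ 2 ≤ Cp * I ^ (2 / P.β) :=
      (pow_le_pow_left₀ hn (M.norm_starProjection_gradKer_le v c) 2).trans hc
    calc n ^ P.β = (n ^ 2) ^ (P.β / 2) := by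
          rw [← Real.rpow_two, ← Real.rpow_mul hn]; congr 1; ring
      _ ≤ (Cp * I ^ (2 / P.β)) ^ (P.β / 2) :=
          Real.rpow_le_rpow (sq_nonneg _) h2 (by positivity)
      _ = Cp ^ (P.β / 2) * I := by
          rw [Real.mul_rpow hCp.le (Real.rpow_nonneg hI _), ← Real.rpow_mul hI]
          have e : 2 / P.β * (P.β / 2) = 1 := by field_simp
          rw [e, Real.rpow_one]
  set E := inner ℝ (P.fieldLp p) p
  set q := ‖p - M.gradL2 r v‖ ^ 2
  have hE : E = ∫ x in Ω, P.sol ‖p x‖ * ‖p x‖ := by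
    simp only [E, P.inner_fieldLp, P.inner_field_self]
  have hEint : Integrable (fun x => P.sol ‖p x‖ * ‖p x‖) (volume.restrict Ω) := by
    simpa only [P.inner_field_self] using P.integrable_inner_field p p
  have hq : q = ∫ x in Ω, ‖(p - M.gradL2 r v) x‖ ^ 2 := by
    simp only [q, ← real_inner_self_eq_norm_sq, L2.inner_def]
  have hqint : Integrable (fun x => ‖(p - M.gradL2 r v) x‖ ^ 2) (volume.restrict Ω) :=
    (Lp.memLp _).integrable_norm_pow (by norm_num)
  have hE0 : 0 ≤ E := by
    rw [hE]
    exact integral_nonneg fun x =>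
      mul_nonneg (P.sol_spec (norm_nonneg _)).1 (norm_nonneg _)
  have hq0 : 0 ≤ q := sq_nonneg _
  -- The gradient is split as p minus the defect p − ∇v. The first part is bounded by the
  -- dissipation density through the growth of K, the second by its square because β ≤ 2. The
  -- constants 1 integrate to the finite volume of Ω.
  have hpt : ∀ᵐ x ∂volume.restrict Ω, ‖M.grad v x‖ ^ P.β
      ≤ 2 ^ P.β * (C' * (1 + P.sol ‖p x‖ * ‖p x‖) + (1 + ‖(p - M.gradL2 r v) x‖ ^ 2)) := by
    filter_upwards [M.coeFn_gradL2 v, Lp.coeFn_sub p (M.gradL2 r v)] with x hx1 hx2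
    rw [hx2, Pi.sub_apply, hx1]
    have h3 : ‖M.grad v x‖ ≤ ‖p x‖ + ‖p x - M.grad v x‖ := by
      rw [norm_sub_rev]; exact norm_le_norm_add_norm_sub' _ _
    calc _ ≤ (‖p x‖ + ‖p x - M.grad v x‖) ^ P.β :=
          Real.rpow_le_rpow (norm_nonneg _) h3 hβ0.le
      _ ≤ 2 ^ P.β * (‖p x‖ ^ P.β + ‖p x - M.grad v x‖ ^ P.β) :=
          add_rpow_le_two_rpow_mul (norm_nonneg _) (norm_nonneg _) hβ0.le
      _ ≤ _ := mul_le_mul_of_nonneg_left (add_le_add (hg _ (norm_nonneg _))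
          (rpow_le_one_add_sq (norm_nonneg _) hβ0.le hβ2)) (by positivity)
  have h1E := ((integrable_const (1 : ℝ)).add hEint).const_mul C'
  have h1q := (integrable_const (1 : ℝ)).add hqint
  have hIle : I ≤ 2 ^ P.β * (C' * (m + E) + (m + q)) := by
    refine (integral_mono_ae hint ((h1E.add h1q).const_mul _) hpt).trans (le_of_eq ?_)
    rw [integral_const_mul, integral_add' h1E h1q, integral_const_mul,
      integral_add' (integrable_const _) hEint, integral_add' (integrable_const _) hqint,
      ← hE, ← hq, integral_const, smul_eq_mul, mul_one]
  have h5 : C' * (m + E) + (m + q) ≤ (C' + 1) * (m + 1) * (1 + E + q) := by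
    have e1 := mul_nonneg hC'.le hq0
    have e2 := mul_nonneg (mul_nonneg (by positivity : 0 ≤ C' + 1) hm) (add_nonneg hE0 hq0)
    nlinarith
  calc n ^ P.β ≤ Cp ^ (P.β / 2) * I := h1
    _ ≤ Cp ^ (P.β / 2) * (2 ^ P.β * ((C' + 1) * (m + 1) * (1 + E + q))) := by
        refine mul_le_mul_of_nonneg_left (hIle.trans ?_) (by positivity)
        exact mul_le_mul_of_nonneg_left h5 (by positivity)
    _ = _ := by ring

namespace Mesh

variable {Ω : Set (Space d)} {σ h : ℝ} (M : Mesh Ω σ h) {r : ℕ}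

/-- The semidiscrete problem as a monotone system. -/
noncomputable def monotoneSystem (P : GenPoly) (hσ : 0 < σ) (hh : 0 < h) (r : ℕ) {c C : ℝ}
    (hc : ∀ φ : H1 Ω, ‖M.gradL2 r (M.proj r (H1.fn φ))‖ ^ 2 ≤ c * ‖φ‖ ^ 2)
    (hC : ∀ (v : M.PolySpace r) (p : L2Vec Ω),
      ‖(M.gradKer r)ᗮ.starProjection (M.toL2 r v)‖ ^ P.β
        ≤ C * (1 + inner ℝ (P.fieldLp p) p + ‖p - M.gradL2 r v‖ ^ 2)) :
    MonotoneSystem (L2 Ω) (L2Vec Ω) (H1 Ω) (P.coeff 0) c C P.β where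
  A := P.fieldLp
  J := P.potentialLp
  -- The discarded component has zero elementwise gradient and belongs to W_h, so Q maps W_h to
  -- itself without changing gradients.
  Q := (M.gradKer r)ᗮ.starProjection
  D := M.gradProj hσ hh r
  Λ := (M.gradProj hσ hh r).comp (H1.fnL Ω)
  S := (M.toL2 r).range
  A_zero := P.fieldLp_zero
  cocoercive := P.fieldLp_cocoercive
  J_zero := P.potentialLp_zero
  J_nonneg := P.potentialLp_nonneg
  subgradient := P.potentialLp_sub_le
  inner_Q x y := by
    rw [← Submodule.inner_starProjection_left_eq_right,
      Submodule.starProjection_eq_self_iff.2 (Submodule.starProjection_apply_mem _ _)]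
  norm_Q_le := Submodule.norm_starProjection_apply_le _
  Q_mem w hw := by
    rw [Submodule.starProjection_orthogonal_val]
    exact Submodule.sub_mem _ hw
      (LinearMap.map_le_range (Submodule.starProjection_apply_mem (M.gradKer r) w))
  D_Q w _ := by
    rw [Submodule.starProjection_orthogonal_val, map_sub, M.gradProj_of_mem_gradKer hσ hh
      (Submodule.starProjection_apply_mem (M.gradKer r) w), sub_zero]
  norm_Λ_le := hc
  poincare := by
    rintro _ ⟨v, rfl⟩ p
    rw [gradProj_toL2]
    exact hC v p

lemma IsSemidiscreteSolution.isSolution {P : GenPoly} (hσ : 0 < σ) (hh : 0 < h) {c C : ℝ}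
    {hc : ∀ φ : H1 Ω, ‖M.gradL2 r (M.proj r (H1.fn φ))‖ ^ 2 ≤ c * ‖φ‖ ^ 2}
    {hC : ∀ (v : M.PolySpace r) (p : L2Vec Ω),
      ‖(M.gradKer r)ᗮ.starProjection (M.toL2 r v)‖ ^ P.β
        ≤ C * (1 + inner ℝ (P.fieldLp p) p + ‖p - M.gradL2 r v‖ ^ 2)}
    {φ φt : ℝ → H1 Ω} {F Ft : ℝ → L2 Ω} {u₀ : L2 Ω} {u ut : ℝ → M.PolySpace r}
    (hφ : ∀ t, 0 ≤ t → HasDerivWithinAt φ (φt t) (Ici 0) t)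
    (hF : ∀ t, 0 ≤ t → HasDerivWithinAt F (Ft t) (Ici 0) t)
    (hφt : ∀ t, 1 ≤ t → IntervalIntegrable (fun s => ‖φt s‖ ^ 2) volume (t - 1) t)
    (hFt : ∀ t, 1 ≤ t → IntervalIntegrable (fun s => ‖Ft s‖ ^ 2) volume (t - 1) t)
    (hu : M.IsSemidiscreteSolution P φ F u₀ u ut) :
    (M.monotoneSystem P hσ hh r hc hC).IsSolution φ φt F Ft (fun t => M.toL2 r (u t))
      (fun t => M.toL2 r (ut t)) where
  mem t := LinearMap.mem_range_self _ _
  mem_deriv t := LinearMap.mem_range_self _ _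
  continuousOn := hu.continuousOn
  hasDerivAt := hu.hasDerivAt
  data_continuousOn t ht := (hφ t ht).continuousWithinAt
  data_hasDerivAt t ht := (hφ t ht.le).hasDerivAt (Ici_mem_nhds ht)
  source_continuousOn t ht := (hF t ht).continuousWithinAt
  source_hasDerivAt t ht := (hF t ht.le).hasDerivAt (Ici_mem_nhds ht)
  equation := by
    rintro t ht _ ⟨w, rfl⟩
    rw [← hu.equation t ht w]
    congr 1
    have e1 : (M.monotoneSystem P hσ hh r hc hC).flux (fun t => M.toL2 r (u t)) φ t
        = M.gradL2 r (u t + M.proj r (H1.fn (φ t))) := by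
      rw [map_add]
      exact congrArg₂ (· + ·) (M.gradProj_toL2 hσ hh (u t)) rfl
    have e2 : (M.monotoneSystem P hσ hh r hc hC).D (M.toL2 r w) = M.gradL2 r w :=
      M.gradProj_toL2 hσ hh w
    rw [e1, e2]
    refine (P.inner_fieldLp _ _).trans (integral_congr_ae ?_)
    filter_upwards [M.coeFn_gradL2 (u t + M.proj r (H1.fn (φ t))), M.coeFn_gradL2 w] with x h1 h2
    rw [h1, h2, GenPoly.field]
  data_integrable := hφt
  source_integrable := hFt

end Mesh

end Forchheimer

/-! ### Proof of the theorem -/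

theorem theorem4p5 (P : Forchheimer.GenPoly) (d : ℕ) (hd : 2 ≤ d)
    (hdeg : P.a ≤ 4 / ((d : ℝ) + 2))
    (Ω : Set (Forchheimer.Space d)) (hΩo : IsOpen Ω) (hΩb : Bornology.IsBounded Ω)
    (r : ℕ) (σ : ℝ) (hσ : 0 < σ) :
    ∃ C : ℝ, 0 < C ∧
      ∀ (h : ℝ) (_ : 0 < h) (M : Forchheimer.Mesh Ω σ h)
        (φ φt : ℝ → Forchheimer.H1 Ω) (f F Ft : ℝ → Forchheimer.L2 Ω) (ρ₀ : Forchheimer.L2 Ω)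
        (u ut : ℝ → M.PolySpace r) (Env : ℝ → ℝ)
        (_ : ∀ t, 0 ≤ t → HasDerivWithinAt φ (φt t) (Set.Ici 0) t)
        (_ : ∀ t, 0 ≤ t → F t = f t - Forchheimer.H1.fn (φt t))
        (_ : ∀ t, 0 ≤ t → HasDerivWithinAt F (Ft t) (Set.Ici 0) t)
        (_ : ∀ t, 1 ≤ t → IntervalIntegrable (fun s => ‖φt s‖ ^ 2) MeasureTheory.volume (t - 1) t)
        (_ : ∀ t, 1 ≤ t → IntervalIntegrable (fun s => ‖Ft s‖ ^ 2) MeasureTheory.volume (t - 1) t)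
        (_ : M.IsSemidiscreteSolution P φ F (ρ₀ - Forchheimer.H1.fn (φ 0)) u ut)
        (_ : Forchheimer.IsEnvelope (Set.Ici 0) (fun t => ‖F t‖ ^ P.lam + ‖φ t‖ ^ 2) Env),
        ∀ t, 1 ≤ t →
          ‖M.toL2 r (ut t)‖ ^ 2 ≤
            C * (1 + ‖ρ₀ - Forchheimer.H1.fn (φ 0)‖ ^ 2 + Env t ^ (2 / P.β)
              + ∫ s in (t - 1)..t, (‖φt s‖ ^ 2 + ‖Ft s‖ ^ 2)) := by
  obtain ⟨c, hc, hproj⟩ := Forchheimer.exists_norm_gradL2_proj_le d r hσ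
  obtain ⟨C₁, hC₁, hpoin⟩ := Forchheimer.exists_poincare_dissipation P (by omega) hdeg hΩb r hσ
  -- The abstract constant is fixed before the monotone system is, once a₀, c, C₁, β, λ and the
  -- ambient spaces are given. None of these involves h, the mesh or the data.
  obtain ⟨C, hC, hbound⟩ := Forchheimer.MonotoneSystem.exists_deriv_bound
    (H := Forchheimer.L2 Ω) (V := Forchheimer.L2Vec Ω) (X := Forchheimer.H1 Ω)
    P.coeff_zero_pos hc.le hC₁ P.holderConjugate P.β_lt_two.le P.two_le_lam
  refine ⟨C, hC, fun h hh M φ φt f F Ft ρ₀ u ut Env hφ _ hF hφt hFt hu hEnv t ht => ?_⟩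
  have hsol := Forchheimer.Mesh.IsSemidiscreteSolution.isSolution M hσ hh
    (hc := hproj Ω hΩo h hh M) (hC := hpoin h hh M) hφ hF hφt hFt hu
  refine (hbound _ _ _ _ _ _ _ _ hsol hEnv t ht).trans ?_
  have h0 : ‖M.toL2 r (u 0)‖ ^ 2 ≤ ‖ρ₀ - Forchheimer.H1.fn (φ 0)‖ ^ 2 := by
    rw [hu.initial]
    exact pow_le_pow_left₀ (norm_nonneg _) (M.norm_toL2_proj_le _) 2
  gcongr
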